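/- Let $X$ be a length metric space (the distance of two points is the infimum of the lengths of the paths joining them; for example a connected Riemannian manifold) which admits a universal cover, i.e. is covered by a simply connected space. Let $Y$ be a complete locally CAT(0) metric space (every point is the centre of an open ball of positive radius that is a CAT(0) space in the induced metric). Let $\mathrm{Lip}(X,Y)$ be the space of Lipschitz maps $X\to Y$ with the compact-open topology, let $\mathrm{Lip}(f)\ge 0$ denote the best Lipschitz constant of $f$, and put $\mathrm{Lip}_{\le t}(X,Y)=\{f:\mathrm{Lip}(f)\le t\}$ for $t\in\mathbb R$. Let $PH_n(\mathrm{Lip}(X,Y),\mathrm{Lip})$ be the persistence module $t\mapsto H_n(\mathrm{Lip}_{\le t}(X,Y))$ (singular homology). 1. For all coefficient modules (over any ring), all $n\ge 0$ and all real $s\le t$, the maps $H_n(\mathrm{Lip}_{\le s}(X,Y))\to H_n(\mathrm{Lip}_{\le t}(X,Y))$ and $H_n(\mathrm{Lip}_{\le t}(X,Y))\to H_n(\mathrm{Lip}(X,Y))$ induced by the inclusions are injective. 2. Consequently, for coefficients in any field $k$ and every $n\ge 0$, no bar of $M=PH_n(\mathrm{Lip}(X,Y),\mathrm{Lip};k)$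 has finite length: every nonempty interval $I\subseteq\mathbb R$ whose interval module $k_I$ is a direct summand of $M$ is unbounded above, and for all real $a<b\le c<d$ the number of bars born between $a$ and $b$ and dying between $c$ and $d$, i.e. $\dim_k \frac{\operatorname{im}(M_b\to M_c)\cap\ker(M_c\to M_d)}{\operatorname{im}(M_a\to M_c)\cap\ker(M_c\to M_d)}$, is $0$. 3. Let $f\in\mathrm{Lip}(X,Y)$ and $x\in X$, let $K_f$ be the path component of $f$ in $\mathrm{Lip}(X,Y)$, let $\varphi=f_*:\pi_1(X,x)\to\pi_1(Y,f(x))$, and let $Z=Z(\varphi(\pi_1(X,x)))$ be the centralizer of the image of $\varphi$ in $\pi_1(Y,f(x))$. Then $K_f$ is a $K(Z,1)$ space (it is path connected, $\pi_1\cong Z$, and $\pi_n=0$ for $n\ge2$). For every real $L$ such that $K_f\cap\mathrm{Lip}_{\le L}(X,Y)$ is nonempty, this space is a $K(Z,1)$ space too, and its inclusion into $K_f$ is a weak homotopy equivalence. If moreover $\pi_1(X)$ is finitely generated (for example if $X$ is compact), then $K_f$ is the connected component of $f$ in $\mathrm{Lip}(X,Y)$, and the inclusion $K_f\cap\mathrm{Lip}_{\le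 L}(X,Y)\to K_f$ is a homotopy equivalence whenever its source is nonempty. -/

import Mathlib

open CategoryTheory
open scoped NNReal Topology

universe u v w

noncomputable section

/-! ### Length spaces, universal covers and nonpositive curvature -/

/-- A metric space is a length space if the distance between two points is the infimum of the
lengths of the paths that join them. (Paths never have length less than the distance, so only one
inequality has to be demanded.) In particular any two points are joined by a path. -/
def IsLengthSpace (X : Type u) [MetricSpace X] : Prop :=
  ∀ (x y : X) (r : ℝ), dist x y < r →
    ∃ γ : Path x y, eVariationOn (fun t => γ t) Set.univ < ENNReal.ofReal r

/-- A topological space admits a universal cover if it is covered by a simply connected space. -/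
def AdmitsUniversalCover (X : Type u) [TopologicalSpace X] : Prop :=
  ∃ (E : Type u) (_ : TopologicalSpace E) (p : E → X),
    SimplyConnectedSpace E ∧ IsCoveringMap p ∧ Function.Surjective p

/-- `γ`, restricted to `[0, 1]`, is a geodesic segment from `p` to `q`, parametrized
proportionally to arc length. -/
structure IsGeodesicSegment {Z : Type u} [MetricSpace Z] (γ : ℝ → Z) (p q : Z) : Prop where
  source : γ 0 = p
  target : γ 1 = q
  dist_eq : ∀ s ∈ Set.Icc (0 : ℝ) 1, ∀ t ∈ Set.Icc (0 : ℝ) 1,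
    dist (γ s) (γ t) = |s - t| * dist p q

/-- CAT(0) spaces: any two points are joined by a geodesic segment, and geodesic triangles are not
thicker than their Euclidean comparison triangles `p' q' r'`. Points on two different sides are
compared; `p` is the common vertex of the two sides. -/
structure IsCAT0 (Z : Type u) [MetricSpace Z] : Prop where
  exists_geodesic : ∀ p q : Z, ∃ γ : ℝ → Z, IsGeodesicSegment γ p q
  comparison : ∀ (p q r : Z) (γ δ : ℝ → Z), IsGeodesicSegment γ p q → IsGeodesicSegment δ p r →
    ∀ p' q' r' : EuclideanSpace ℝ (Fin 2),
      dist p' q' = dist p q → dist q' r' = dist q r → dist p' r' = dist p r →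
      ∀ s ∈ Set.Icc (0 : ℝ) 1, ∀ t ∈ Set.Icc (0 : ℝ) 1,
        dist (γ s) (δ t) ≤ dist (AffineMap.lineMap p' q' s) (AffineMap.lineMap p' r' t)

/-- A metric space is locally CAT(0) if each point is the centre of an open ball of positive radius
which is a CAT(0) space in the induced metric. -/
def IsLocallyCAT0 (Y : Type u) [MetricSpace Y] : Prop :=
  ∀ y : Y, ∃ r : ℝ, 0 < r ∧ IsCAT0 (Metric.ball y r)

/-! ### The space of Lipschitz maps -/

/-- The space `Lip(X, Y)` of Lipschitz maps, with the compact-open topology (as a subspace of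
`C(X, Y)`). -/
abbrev LipSpace (X : Type u) (Y : Type v) [MetricSpace X] [MetricSpace Y] : Type (max u v) :=
  {f : C(X, Y) // ∃ K : ℝ≥0, LipschitzWith K f}

/-- The function `Lip`: the best Lipschitz constant of a Lipschitz map. -/
def lipConst {X : Type u} {Y : Type v} [MetricSpace X] [MetricSpace Y] (f : LipSpace X Y) : ℝ :=
  ((sInf {K : ℝ≥0 | LipschitzWith K f.1} : ℝ≥0) : ℝ)

/-- The sublevel sets of `lipConst` are the sets of `L`-Lipschitz maps. -/
theorem lipConst_le_iff {X : Type u} {Y : Type v} [MetricSpace X] [MetricSpace Y]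
    (f : LipSpace X Y) (L : ℝ≥0) : lipConst f ≤ L ↔ LipschitzWith L f.1 := by
  constructor
  · intro h
    have h' : sInf {K : ℝ≥0 | LipschitzWith K f.1} ≤ L := by exact_mod_cast h
    refine LipschitzWith.of_dist_le_mul fun x y => ?_
    have key : ∀ ε : ℝ, 0 < ε → dist (f.1 x) (f.1 y) ≤ ((L : ℝ) + ε) * dist x y := by
      intro ε hε
      have hlt : sInf {K : ℝ≥0 | LipschitzWith K f.1} < L + ε.toNNReal :=
        lt_of_le_of_lt h' (lt_add_of_pos_right L (Real.toNNReal_pos.2 hε))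
      obtain ⟨K, hK, hKlt⟩ := exists_lt_of_csInf_lt f.2 hlt
      have hKle : (K : ℝ) ≤ (L : ℝ) + ε := by
        have := NNReal.coe_lt_coe.2 hKlt
        rw [NNReal.coe_add, Real.coe_toNNReal ε hε.le] at this
        exact this.le
      exact (LipschitzWith.dist_le_mul hK x y).trans
        (mul_le_mul_of_nonneg_right hKle dist_nonneg)
    by_contra hcon
    push Not at hcon
    have hpos : 0 < dist (f.1 x) (f.1 y) - L * dist x y := by linarith
    have hd : 0 < dist x y + 1 := by positivity
    have := key _ (div_pos hpos hd)
    have h2 : (dist (f.1 x) (f.1 y) - L * dist x y) / (dist x y + 1) * dist x y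
        < dist (f.1 x) (f.1 y) - L * dist x y := by
      rw [div_mul_eq_mul_div, div_lt_iff₀ hd]
      nlinarith
    nlinarith
  · intro h
    have : sInf {K : ℝ≥0 | LipschitzWith K f.1} ≤ L := csInf_le (OrderBot.bddBelow _) h
    exact_mod_cast this

/-! ### Persistent homology of sublevel sets, and bars -/

section Persistence

variable {A : Type w} [TopologicalSpace A]

/-- The filtration of `A` by the sublevel sets `{a | h a ≤ t}`, as a functor. -/
def sublevelFunctor (h : A → ℝ) : ℝ ⥤ TopCat.{w} where
  obj t := TopCat.of {a : A // h a ≤ t}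
  map {s t} hst := TopCat.ofHom
    ⟨fun a => ⟨a.1, a.2.trans (leOfHom hst)⟩, by fun_prop⟩

/-- The inclusion of a sublevel set into the whole space. -/
def sublevelInclusion (h : A → ℝ) (t : ℝ) : (sublevelFunctor h).obj t ⟶ TopCat.of A :=
  TopCat.ofHom ⟨fun a => a.1, by fun_prop⟩

/-- Singular homology `Hₙ(-; M)` with coefficients in the module `M`. -/
abbrev singularHomology {R : Type v} [Ring R] (n : ℕ) (M : ModuleCat.{w} R) :
    TopCat.{w} ⥤ ModuleCat.{w} R :=
  (AlgebraicTopology.singularHomologyFunctor (ModuleCat.{w} R) n).obj M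

/-- The persistent homology `PHₙ(A, h; M)`: the persistence module `t ↦ Hₙ({h ≤ t}; M)`. -/
def persistentHomology {R : Type v} [Ring R] (n : ℕ) (h : A → ℝ) (M : ModuleCat.{w} R) :
    ℝ ⥤ ModuleCat.{w} R :=
  sublevelFunctor h ⋙ singularHomology n M

end Persistence

section Bars

variable (k : Type w) [Field k]

/-- The value at `t` of the interval module on `I`: it is `k` for `t ∈ I` and `0` otherwise. -/
def intervalFiber (I : Set ℝ) (t : ℝ) : Submodule k k where
  carrier := {x | t ∉ I → x = 0}
  add_mem' := fun ha hb ht => by rw [ha ht, hb ht, add_zero]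
  zero_mem' := fun _ => rfl
  smul_mem' := fun c x hx ht => by rw [hx ht, smul_zero]

open Classical in
/-- The transition maps of the interval module on `I`: the identity of `k` inside `I`, and zero
otherwise. -/
def intervalMap (I : Set ℝ) (s t : ℝ) : intervalFiber k I s →ₗ[k] intervalFiber k I t where
  toFun x := ⟨if t ∈ I then x.1 else 0, fun ht => if_neg ht⟩
  map_add' x y := by ext; by_cases ht : t ∈ I <;> simp [ht]
  map_smul' c x := by ext; by_cases ht : t ∈ I <;> simp [ht]

/-- The interval (cyclic) persistence module `k_I` on an interval `I ⊆ ℝ`. -/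
def intervalModule (I : Set ℝ) (hI : I.OrdConnected) : ℝ ⥤ ModuleCat.{w} k where
  obj t := ModuleCat.of k (intervalFiber k I t)
  map {s t} _ := ModuleCat.ofHom (intervalMap k I s t)
  map_id t := by
    ext x
    by_cases ht : t ∈ I
    · simp [intervalMap, ht]
    · simp [intervalMap, ht, x.2 ht]
  map_comp {s t r} f g := by
    ext x
    by_cases hr : r ∈ I
    · by_cases ht : t ∈ I
      · simp [intervalMap, hr, ht]
      · have hs : s ∉ I := fun hs => ht (hI.out hs hr ⟨leOfHom f, leOfHom g⟩)
        simp [intervalMap, hr, ht, x.2 hs]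
    · simp [intervalMap, hr]

variable {k}

/-- The interval `I` is a bar of the persistence module `M` if the interval module `k_I` is a
direct summand of `M`. If `M` is a direct sum of interval modules, then these are the intervals
that occur in its barcode. -/
def IsBar (M : ℝ ⥤ ModuleCat.{w} k) (I : Set ℝ) : Prop :=
  I.Nonempty ∧ ∃ hI : I.OrdConnected, Nonempty (Retract (intervalModule k I hI) M)

/-- For `a < b ≤ c < d`, the number of bars of `M` that are born between `a` and `b` and die
between `c` and `d`: the dimension of the space of classes in `M c` which come from `M b` and die
in `M d`, modulo those which come from `M a`. This is the multiplicity of the interval module on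
`{b, c}` in the restriction of `M` to `{a, b, c, d}`. These numbers determine the barcode of a
q-tame persistence module, even if it is not a direct sum of interval modules. -/
def barMultiplicity (M : ℝ ⥤ ModuleCat.{w} k) {a b c d : ℝ} (hab : a < b) (hbc : b ≤ c)
    (hcd : c < d) : Cardinal.{w} :=
  let V : Submodule k (M.obj c) :=
    LinearMap.range (M.map (homOfLE hbc)).hom ⊓ LinearMap.ker (M.map (homOfLE hcd.le)).hom
  let W : Submodule k (M.obj c) := LinearMap.range (M.map (homOfLE (hab.le.trans hbc))).hom
  Module.rank k (V ⧸ W.submoduleOf V)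

/-- No bar of `M` has finite length: bars which are direct summands are unbounded above, and no
bars are detected in any bounded rectangle of births and deaths. -/
structure NoFiniteBars (M : ℝ ⥤ ModuleCat.{w} k) : Prop where
  not_bddAbove : ∀ I : Set ℝ, IsBar M I → ¬ BddAbove I
  multiplicity_eq_zero : ∀ (a b c d : ℝ) (hab : a < b) (hbc : b ≤ c) (hcd : c < d),
    barMultiplicity M hab hbc hcd = 0

end Bars

/-! ### Homotopy equivalences and Eilenberg-MacLane spaces -/

section Homotopy

variable {A : Type u} {B : Type v} [TopologicalSpace A] [TopologicalSpace B]

/-- The map induced on homotopy groups by a continuous map. -/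
def homotopyGroupMap (n : ℕ) (f : C(A, B)) (a : A) : π_ n A a → π_ n B (f a) :=
  Quotient.map
    (fun p => (⟨f.comp p.1, fun y hy => congrArg f (p.2 y hy)⟩ : GenLoop (Fin n) B (f a)))
    (fun _ _ h => h.map fun H => H.compContinuousMap f)

/-- A continuous map is a weak homotopy equivalence if it induces bijections on path components
and on all homotopy groups, at all base points. (The case `n = 0` is the one of path components;
the first condition is needed only when the source is empty.) -/
def IsWeakHomotopyEquiv (f : C(A, B)) : Prop :=
  (Nonempty B → Nonempty A) ∧ ∀ (n : ℕ) (a : A), Function.Bijective (homotopyGroupMap n f a)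

/-- A continuous map is a homotopy equivalence if it has a homotopy inverse. -/
def IsHomotopyEquiv (f : C(A, B)) : Prop :=
  ∃ e : ContinuousMap.HomotopyEquiv A B, e.toFun = f

variable (A) in
/-- `A` is a `K(G, 1)` space: it is path connected, its fundamental group is isomorphic to `G`, and
its higher homotopy groups vanish. -/
structure IsEilenbergMacLaneOne (G : Type w) [Group G] : Prop where
  pathConnected : PathConnectedSpace A
  fundamentalGroup : ∀ a : A, Nonempty (FundamentalGroup A a ≃* G)
  higher : ∀ (n : ℕ) (a : A), 2 ≤ n → Subsingleton (π_ n A a)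

end Homotopy

/-! ### Components of the mapping space -/

section Components

variable {X : Type u} {Y : Type v} [MetricSpace X] [MetricSpace Y]

/-- The centralizer `Z(φ(π₁(X, x)))` in `π₁(Y, f(x))`, where `φ` is induced by `f`. -/
abbrev imageCentralizer (f : LipSpace X Y) (x : X) : Subgroup (FundamentalGroup Y (f.1 x)) :=
  Subgroup.centralizer ((FundamentalGroup.map f.1 x).range : Set (FundamentalGroup Y (f.1 x)))

/-- The `L`-Lipschitz maps in the path component of `f` in the space of Lipschitz maps. -/
abbrev lipComponent (f : LipSpace X Y) (L : ℝ) : Set (LipSpace X Y) :=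
  {g | g ∈ pathComponent f ∧ lipConst g ≤ L}

/-- The inclusion of the `L`-Lipschitz maps into their path component. -/
def lipComponentInclusion (f : LipSpace X Y) (L : ℝ) :
    C(lipComponent f L, pathComponent f) :=
  ⟨fun g => ⟨g.1, g.2.1⟩, by fun_prop⟩

end Components

end

/-!
The proof compares homotopies of maps into `Y` with continuous families of local geodesics.

Let `GeodesicSpace Y` be the space of constant speed local geodesics `[0, 1] → Y`. In small CAT(0)
balls the distance between two geodesics is a convex function of the parameter, and nothing else
about curvature is used. Convexity and completeness imply that the endpoints of a local geodesic can
be moved a little (`IsLocalGeodesic.exists_near`), that local geodesics close to a given one are as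
far apart as their endpoints, and, since Lipschitz paths can be lifted through local isometries of
complete spaces, that the map `GeodesicSpace Y → Y × Y` to the pair of endpoints is a covering map
(`isCoveringMap_ends`). Hence each homotopy class of paths contains exactly one local geodesic, and
it depends continuously on the class. Therefore a homotopy between Lipschitz maps `f` and `g` can be
replaced by the geodesic homotopy, which follows the local geodesics in the classes of the tracks.
As `X` is a length space, Lipschitz constants can be checked locally, and convexity shows that those
of the intermediate maps are at most `max (Lip f) (Lip g)`. So the set `K_f` and its subset of
`L`-Lipschitz maps can be treated alike (`IsGeodesicallyConnected`). Over a cube, classes of tracks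
given at one vertex extend to a continuous family, and geodesic homotopies show that the higher
homotopy groups vanish and that evaluation at `x` is injective on the fundamental group. Its image
is the centralizer: by the lifting criterion for the covering, a loop at `f x` extends to a
continuous family of classes of loops at the points `f x'` if and only if it commutes with the image
of `π₁(X, x)`.

A retraction to the `L`-Lipschitz maps requires a choice, for each map `g` homotopic to one of them,
of a geodesic homotopy to an `L`-Lipschitz map that depends continuously on `g`
(`exists_continuous_lift`). If nearby members of the family of all `g` are joined by short
homotopies, then such homotopies can be chosen locally, by transporting one of them. The local
choices are glued by means of bump functions on `Y`: the endpoints of two choices for `g` are joined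
by a geodesic homotopy among `L`-Lipschitz maps, along which one may interpolate. The hypothesis on
nearby maps holds in the compact-open topology if `π₁(X)` is finitely generated
(`eventually_exists_short_lift`), as a map `g` close to `g₀` on a connected compact set carrying
generators induces the same map on `π₁(X)` up to short
changes of the base point; this gives the homotopy equivalence. In general it need
not hold. But it does hold for locally path connected families, such as the mapping space with the
finest topology that has the same singular simplices, hence the same singular homology. With this
topology, the inclusion of `Lip_{≤ s}` has a left inverse in homology, given by the retraction of
those path components that meet `Lip_{≤ s}`, so that it is injective
(`singularHomology_map_injective`). Persistence modules with injective transition maps have no bars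
of finite length.
-/

/-! ### Geodesics in CAT(0) balls -/

section CAT0Balls

open Set Metric

/-- A ball is Busemann convex if its points are joined by geodesic segments inside the ball, and if
the distance between two affinely parametrized geodesic segments in the ball is a convex function
of the parameter. All that the argument needs from the CAT(0) condition is that there are such
balls around each point. -/
structure IsBusemannBall {Y : Type u} [MetricSpace Y] (z : Y) (r : ℝ) : Prop where
  exists_geodesic : ∀ p ∈ ball z r, ∀ q ∈ ball z r,
    ∃ γ : ℝ → Y, IsGeodesicSegment γ p q ∧ ∀ t ∈ Icc (0 : ℝ) 1, γ t ∈ ball z r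
  convex : ∀ (p q p' q' : Y) (γ δ : ℝ → Y), IsGeodesicSegment γ p q → IsGeodesicSegment δ p' q' →
    (∀ t ∈ Icc (0 : ℝ) 1, γ t ∈ ball z r) → (∀ t ∈ Icc (0 : ℝ) 1, δ t ∈ ball z r) →
    ∀ t ∈ Icc (0 : ℝ) 1, dist (γ t) (δ t) ≤ (1 - t) * dist p p' + t * dist q q'

/-- Euclidean comparison triangles exist. -/
theorem exists_comparison_triangle {a b c : ℝ} (ha : 0 ≤ a) (hc : 0 ≤ c)
    (h1 : a ≤ b + c) (h2 : b ≤ a + c) (h3 : c ≤ a + b) :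
    ∃ p q r : EuclideanSpace ℝ (Fin 2), dist p q = a ∧ dist q r = b ∧ dist p r = c := by
  rcases ha.eq_or_lt with rfl | ha
  · have hbc : b = c := by linarith
    subst hbc
    refine ⟨!₂[0, 0], !₂[0, 0], !₂[b, 0], by simp, ?_, ?_⟩ <;>
      simp [EuclideanSpace.dist_eq, Real.sqrt_sq_eq_abs, Real.dist_eq, abs_of_nonneg hc]
  -- the vertices are `(0, 0)`, `(a, 0)` and the point `(x, y)` with `y ≥ 0` at distances `c`, `b`
  set x : ℝ := (a ^ 2 + c ^ 2 - b ^ 2) / (2 * a) with hx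
  have hxa : 2 * a * x = a ^ 2 + c ^ 2 - b ^ 2 := by rw [hx]; field_simp
  have hb : 0 ≤ b := by linarith
  have hy : 0 ≤ c ^ 2 - x ^ 2 := by
    have h4 : 0 ≤ (2 * a * c - 2 * a * x) * (2 * a * c + 2 * a * x) := by
      rw [hxa]; apply mul_nonneg <;> nlinarith
    have h5 : (2 * a * c - 2 * a * x) * (2 * a * c + 2 * a * x) = 4 * a ^ 2 * (c ^ 2 - x ^ 2) := by
      ring
    rw [h5] at h4
    exact nonneg_of_mul_nonneg_right h4 (by positivity)
  refine ⟨!₂[0, 0], !₂[a, 0], !₂[x, √(c ^ 2 - x ^ 2)], ?_, ?_, ?_⟩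
  · simp [EuclideanSpace.dist_eq, Real.sqrt_sq_eq_abs, Real.dist_eq, abs_of_pos ha]
  · rw [EuclideanSpace.dist_eq, ← Real.sqrt_sq hb]
    congr 1
    simp [Real.dist_eq, Real.sq_sqrt hy]
    nlinarith
  · simp [EuclideanSpace.dist_eq, Real.sq_sqrt hy, Real.sqrt_sq hc]

variable {Z : Type u} [MetricSpace Z]

theorem IsGeodesicSegment.reverse {γ : ℝ → Z} {p q : Z} (h : IsGeodesicSegment γ p q) :
    IsGeodesicSegment (fun t => γ (1 - t)) q p where
  source := by simp [h.target]
  target := by simp [h.source]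
  dist_eq s hs t ht := by
    rw [h.dist_eq _ ⟨by linarith [hs.2], by linarith [hs.1]⟩ _
      ⟨by linarith [ht.2], by linarith [ht.1]⟩, dist_comm q p, abs_sub_comm]
    ring_nf

theorem IsGeodesicSegment.const (p : Z) : IsGeodesicSegment (fun _ => p) p p :=
  ⟨rfl, rfl, by simp⟩

/-- In a CAT(0) space two geodesic segments that start at the same point diverge at least
linearly. -/
theorem IsCAT0.dist_le_of_source_eq (h : IsCAT0 Z) {p q r : Z} {γ δ : ℝ → Z}
    (hγ : IsGeodesicSegment γ p q) (hδ : IsGeodesicSegment δ p r) {t : ℝ} (ht : t ∈ Icc (0 : ℝ) 1) :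
    dist (γ t) (δ t) ≤ t * dist q r := by
  obtain ⟨p', q', r', h1, h2, h3⟩ := exists_comparison_triangle (a := dist p q) (b := dist q r)
    (c := dist p r) dist_nonneg dist_nonneg
    (by linarith [dist_triangle p r q, dist_comm r q])
    (by linarith [dist_triangle q p r, dist_comm q p]) (dist_triangle p q r)
  refine (h.comparison p q r γ δ hγ hδ p' q' r' h1 h2 h3 t ht t ht).trans (le_of_eq ?_)
  rw [← h2, dist_eq_norm, dist_eq_norm, AffineMap.lineMap_apply_module',
    AffineMap.lineMap_apply_module',
    show t • (q' - p') + p' - (t • (r' - p') + p') = t • (q' - r') by module, norm_smul,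
    Real.norm_of_nonneg ht.1]

theorem IsCAT0.dist_le (h : IsCAT0 Z) {p q p' q' : Z} {γ δ : ℝ → Z}
    (hγ : IsGeodesicSegment γ p q) (hδ : IsGeodesicSegment δ p' q') {t : ℝ}
    (ht : t ∈ Icc (0 : ℝ) 1) : dist (γ t) (δ t) ≤ (1 - t) * dist p p' + t * dist q q' := by
  obtain ⟨η, hη⟩ := h.exists_geodesic p q'
  have h1 := h.dist_le_of_source_eq hγ hη ht
  have h2 := h.dist_le_of_source_eq hη.reverse hδ.reverse (t := 1 - t)
    ⟨by linarith [ht.2], by linarith [ht.1]⟩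
  simp only [sub_sub_cancel] at h2
  linarith [dist_triangle (γ t) (η t) (δ t)]

variable {Y : Type u} [MetricSpace Y]

theorem isBusemannBall_of_isCAT0 {z : Y} {r : ℝ} (h : IsCAT0 (ball z r)) :
    IsBusemannBall z r where
  exists_geodesic p hp q hq := by
    obtain ⟨γ, hγ⟩ := h.exists_geodesic ⟨p, hp⟩ ⟨q, hq⟩
    exact ⟨fun t => γ t, ⟨congrArg Subtype.val hγ.source, congrArg Subtype.val hγ.target,
      fun s hs t ht => hγ.dist_eq s hs t ht⟩, fun t _ => (γ t).2⟩
  convex p q p' q' γ δ hγ hδ mγ mδ t ht := by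
    -- a geodesic segment of `Y` inside the ball is a geodesic segment of the ball
    have key : ∀ (p q : Y) (γ : ℝ → Y) (hγ : IsGeodesicSegment γ p q)
        (m : ∀ t ∈ Icc (0 : ℝ) 1, γ t ∈ ball z r),
        IsGeodesicSegment (fun t => (⟨γ (projIcc 0 1 zero_le_one t), m _ (projIcc 0 1 _ t).2⟩ :
          ball z r)) ⟨p, hγ.source ▸ m 0 (by simp)⟩ ⟨q, hγ.target ▸ m 1 (by simp)⟩ := by
      intro p q γ hγ m
      refine ⟨by ext; simp [hγ.source], by ext; simp [hγ.target], fun s hs t ht => ?_⟩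
      rw [projIcc_of_mem _ hs, projIcc_of_mem _ ht]
      exact hγ.dist_eq s hs t ht
    have := h.dist_le (key p q γ hγ mγ) (key p' q' δ hδ mδ) ht
    rw [projIcc_of_mem _ ht] at this
    exact this

theorem IsBusemannBall.mono {z z' : Y} {r r' : ℝ} (h : IsBusemannBall z r)
    (hs : ball z' r' ⊆ ball z r) : IsBusemannBall z' r' where
  exists_geodesic p hp q hq := by
    obtain ⟨γ, hγ, m⟩ := h.exists_geodesic p (hs hp) q (hs hq)
    refine ⟨γ, hγ, fun t ht => ?_⟩
    have hz' : z' ∈ ball z r := hs (mem_ball_self (pos_of_mem_ball hp))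
    have := h.convex _ _ _ _ γ _ hγ (IsGeodesicSegment.const z') m (fun _ _ => hz') t ht
    rw [mem_ball] at *
    have h1 := mul_le_mul_of_nonneg_left (le_max_left (dist p z') (dist q z'))
      (sub_nonneg.2 ht.2)
    have h2 := mul_le_mul_of_nonneg_left (le_max_right (dist p z') (dist q z')) ht.1
    linarith [max_lt hp hq]
  convex p q p' q' γ δ hγ hδ mγ mδ :=
    h.convex p q p' q' γ δ hγ hδ (fun t ht => hs (mγ t ht)) (fun t ht => hs (mδ t ht))

/-! ### Local geodesics -/

/-- `c` is a local geodesic on `[a, b]`: each parameter has a neighbourhood on which `c` is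
a geodesic with constant speed. (The speed is then the same everywhere, but this is not needed.) -/
def IsLocalGeodesic (c : ℝ → Y) (a b : ℝ) : Prop :=
  ∀ t ∈ Icc a b, ∃ δ > 0, ∃ v : ℝ, ∀ s ∈ Icc a b, ∀ s' ∈ Icc a b, |s - t| < δ → |s' - t| < δ →
    dist (c s) (c s') = v * |s - s'|

theorem IsLocalGeodesic.mono {c : ℝ → Y} {a b a' b' : ℝ} (h : IsLocalGeodesic c a b)
    (hs : Icc a' b' ⊆ Icc a b) : IsLocalGeodesic c a' b' := fun t ht => by
  obtain ⟨δ, hδ, v, hv⟩ := h t (hs ht)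
  exact ⟨δ, hδ, v, fun s hs1 s' hs2 => hv s (hs hs1) s' (hs hs2)⟩

theorem IsLocalGeodesic.congr {c c' : ℝ → Y} {a b : ℝ} (h : IsLocalGeodesic c a b)
    (hc : EqOn c' c (Icc a b)) : IsLocalGeodesic c' a b := fun t ht => by
  obtain ⟨δ, hδ, v, hv⟩ := h t ht
  exact ⟨δ, hδ, v, fun s hs1 s' hs2 h1 h2 => by rw [hc hs1, hc hs2, hv s hs1 s' hs2 h1 h2]⟩

theorem isLocalGeodesic_of_dist_eq {c : ℝ → Y} {a b v : ℝ}
    (h : ∀ s ∈ Icc a b, ∀ s' ∈ Icc a b, dist (c s) (c s') = v * |s - s'|) :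
    IsLocalGeodesic c a b :=
  fun _ _ => ⟨1, one_pos, v, fun s hs s' hs' _ _ => h s hs s' hs'⟩

theorem IsLocalGeodesic.continuousOn {c : ℝ → Y} {a b : ℝ} (h : IsLocalGeodesic c a b) :
    ContinuousOn c (Icc a b) := by
  intro t ht
  obtain ⟨δ, hδ, v, hv⟩ := h t ht
  rw [ContinuousWithinAt, tendsto_iff_dist_tendsto_zero]
  have h1 : Filter.Tendsto (fun s => v * |s - t|) (𝓝[Icc a b] t) (𝓝 0) := by
    have : Continuous fun s : ℝ => v * |s - t| := by fun_prop
    simpa using (this.tendsto t).mono_left nhdsWithin_le_nhds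
  refine h1.congr' ?_
  filter_upwards [self_mem_nhdsWithin, mem_nhdsWithin_of_mem_nhds (ball_mem_nhds t hδ)]
    with s hs hs'
  exact (hv s hs t ht hs' (by simpa using hδ)).symm

theorem isGeodesicSegment_of_dist_eq {c : ℝ → Y} {a b v : ℝ} (hab : a ≤ b)
    (h : ∀ s ∈ Icc a b, ∀ s' ∈ Icc a b, dist (c s) (c s') = v * |s - s'|) :
    IsGeodesicSegment (fun u => c (a + (b - a) * u)) (c a) (c b) := by
  have m : ∀ u ∈ Icc (0 : ℝ) 1, a + (b - a) * u ∈ Icc a b := fun u hu =>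
    ⟨by nlinarith [hu.1, hu.2], by nlinarith [hu.1, hu.2]⟩
  refine ⟨by simp, by simp, fun s hs t ht => ?_⟩
  rw [h _ (m s hs) _ (m t ht), h a ⟨le_rfl, hab⟩ b ⟨hab, le_rfl⟩,
    show a + (b - a) * s - (a + (b - a) * t) = (b - a) * (s - t) by ring, abs_mul, abs_sub_comm a b]
  ring

theorem IsGeodesicSegment.dist_eq_rescale {γ : ℝ → Y} {p q : Y} (h : IsGeodesicSegment γ p q)
    {a b : ℝ} (hab : a < b) (s : ℝ) (hs : s ∈ Icc a b) (s' : ℝ) (hs' : s' ∈ Icc a b) :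
    dist (γ ((s - a) / (b - a))) (γ ((s' - a) / (b - a))) = dist p q / (b - a) * |s - s'| := by
  have hba : 0 < b - a := sub_pos.2 hab
  have m : ∀ s ∈ Icc a b, (s - a) / (b - a) ∈ Icc (0 : ℝ) 1 := fun s hs =>
    ⟨div_nonneg (by linarith [hs.1]) hba.le, (div_le_one hba).2 (by linarith [hs.2])⟩
  rw [h.dist_eq _ (m s hs) _ (m s' hs'), ← sub_div, abs_div, abs_of_pos hba]
  ring_nf

/-- A continuous function on `[a, b]` that is locally midpoint convex lies below its chord: where
the difference to the chord first attains a positive maximum, it could not be midpoint convex. -/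
theorem le_chord_of_locally_midpoint {g : ℝ → ℝ} {a b : ℝ} (hg : ContinuousOn g (Icc a b))
    (hm : ∀ t ∈ Ioo a b, ∃ δ > 0, ∀ η, 0 < η → η < δ → g t ≤ (g (t - η) + g (t + η)) / 2)
    {t : ℝ} (ht : t ∈ Icc a b) : g t * (b - a) ≤ (b - t) * g a + (t - a) * g b := by
  set h : ℝ → ℝ := fun t => g t * (b - a) - ((b - t) * g a + (t - a) * g b) with hh
  have hcont : ContinuousOn h (Icc a b) := by
    refine (hg.mul continuousOn_const).sub (Continuous.continuousOn ?_)
    fun_prop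
  obtain ⟨t₀, ht₀, hmax⟩ := isCompact_Icc.exists_isMaxOn ⟨t, ht⟩ hcont
  suffices h t₀ ≤ 0 by have := hmax ht; simp only [mem_ofPred_eq] at this; linarith
  by_contra! hpos
  have hclosed : IsCompact (Icc a b ∩ h ⁻¹' Ici (h t₀)) :=
    isCompact_Icc.of_isClosed_subset (hcont.preimage_isClosed_of_isClosed isClosed_Icc isClosed_Ici)
      inter_subset_left
  obtain ⟨t₁, ⟨ht₁, hht₁⟩, hmin⟩ := hclosed.exists_isLeast ⟨t₀, ht₀, le_refl (h t₀)⟩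
  have hht₁ : h t₀ ≤ h t₁ := hht₁
  have hat : a < t₁ := lt_of_le_of_ne ht₁.1 (by rintro rfl; simp [hh] at hht₁ hpos; linarith)
  have htb : t₁ < b := lt_of_le_of_ne ht₁.2 (by rintro rfl; simp [hh] at hht₁ hpos; linarith)
  obtain ⟨δ, hδ, hmid⟩ := hm t₁ ⟨hat, htb⟩
  obtain ⟨η, hη0, hη⟩ := exists_between (lt_min hδ (lt_min (sub_pos.2 hat) (sub_pos.2 htb)))
  simp only [lt_min_iff] at hη
  have h1 := hmid η hη0 hη.1
  have hl : t₁ - η ∈ Icc a b := ⟨by linarith, by linarith⟩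
  have hr : t₁ + η ∈ Icc a b := ⟨by linarith, by linarith⟩
  have h2 : h (t₁ - η) < h t₀ := by
    by_contra! hcon
    have := hmin ⟨hl, hcon⟩
    linarith
  have h3 : h (t₁ + η) ≤ h t₀ := hmax hr
  have hab : 0 < b - a := by linarith
  have h4 : 2 * h t₁ ≤ h (t₁ - η) + h (t₁ + η) := by
    have := mul_le_mul_of_nonneg_right h1 hab.le
    simp only [hh]
    nlinarith
  linarith

/-- The distance between two local geodesics that stay close to each other is convex. -/
theorem IsLocalGeodesic.dist_mul_le {c c' : ℝ → Y} {a b : ℝ} (hc : IsLocalGeodesic c a b)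
    (hc' : IsLocalGeodesic c' a b)
    (hball : ∀ t ∈ Icc a b, ∃ z r, IsBusemannBall z r ∧ c t ∈ ball z r ∧ c' t ∈ ball z r)
    {t : ℝ} (ht : t ∈ Icc a b) :
    dist (c t) (c' t) * (b - a) ≤ (b - t) * dist (c a) (c' a) + (t - a) * dist (c b) (c' b) := by
  refine le_chord_of_locally_midpoint (g := fun t => dist (c t) (c' t))
    (continuous_dist.comp_continuousOn (hc.continuousOn.prodMk hc'.continuousOn))
    (fun t ht => ?_) ht
  have htI := Ioo_subset_Icc_self ht
  obtain ⟨z, r, hz, hzc, hzc'⟩ := hball t htI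
  obtain ⟨δ₁, hδ₁, v₁, hv₁⟩ := hc t htI
  obtain ⟨δ₂, hδ₂, v₂, hv₂⟩ := hc' t htI
  have hn : Icc a b ∈ 𝓝 t := Icc_mem_nhds ht.1 ht.2
  have hev : ∀ᶠ s in 𝓝 t, s ∈ Icc a b ∧ c s ∈ ball z r ∧ c' s ∈ ball z r :=
    (Filter.eventually_mem_set.2 hn).and
      (((hc.continuousOn.continuousAt hn).eventually_mem (isOpen_ball.mem_nhds hzc)).and
      ((hc'.continuousOn.continuousAt hn).eventually_mem (isOpen_ball.mem_nhds hzc')))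
  obtain ⟨δ₃, hδ₃, hev⟩ := Metric.eventually_nhds_iff.1 hev
  refine ⟨min δ₁ (min δ₂ δ₃), by positivity, fun η hη0 hη => ?_⟩
  simp only [lt_min_iff] at hη
  have near : ∀ s ∈ Icc (t - η) (t + η), |s - t| ≤ η := fun s hs =>
    abs_le.2 ⟨by linarith [hs.1], by linarith [hs.2]⟩
  have hin : ∀ s ∈ Icc (t - η) (t + η), s ∈ Icc a b ∧ c s ∈ ball z r ∧ c' s ∈ ball z r :=
    fun s hs => hev (lt_of_le_of_lt (near s hs) hη.2.2)
  have g₁ := isGeodesicSegment_of_dist_eq (c := c) (v := v₁) (by linarith : t - η ≤ t + η)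
    fun s hs s' hs' => hv₁ s (hin s hs).1 s' (hin s' hs').1 ((near s hs).trans_lt hη.1)
      ((near s' hs').trans_lt hη.1)
  have g₂ := isGeodesicSegment_of_dist_eq (c := c') (v := v₂) (by linarith : t - η ≤ t + η)
    fun s hs s' hs' => hv₂ s (hin s hs).1 s' (hin s' hs').1 ((near s hs).trans_lt hη.2.1)
      ((near s' hs').trans_lt hη.2.1)
  have m : ∀ u ∈ Icc (0 : ℝ) 1, t - η + (t + η - (t - η)) * u ∈ Icc (t - η) (t + η) := fun u hu =>
    ⟨by nlinarith [hu.1, hu.2], by nlinarith [hu.1, hu.2]⟩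
  have := hz.convex _ _ _ _ _ _ g₁ g₂ (fun u hu => (hin _ (m u hu)).2.1)
    (fun u hu => (hin _ (m u hu)).2.2) (1 / 2) (by norm_num)
  rw [show t - η + (t + η - (t - η)) * (1 / 2) = t by ring] at this
  linarith

theorem IsLocalGeodesic.dist_le_of_max {c c' : ℝ → Y} {a b e : ℝ} (hc : IsLocalGeodesic c a b)
    (hc' : IsLocalGeodesic c' a b)
    (hball : ∀ t ∈ Icc a b, ∃ z r, IsBusemannBall z r ∧ c t ∈ ball z r ∧ c' t ∈ ball z r)
    (ha : dist (c a) (c' a) ≤ e) (hb : dist (c b) (c' b) ≤ e)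
    {t : ℝ} (ht : t ∈ Icc a b) : dist (c t) (c' t) ≤ e := by
  rcases (ht.1.trans ht.2).eq_or_lt with rfl | hab
  · rwa [le_antisymm ht.2 ht.1]
  have h1 := hc.dist_mul_le hc' hball ht
  have h2 := mul_le_mul_of_nonneg_left ha (sub_nonneg.2 ht.2)
  have h3 := mul_le_mul_of_nonneg_left hb (sub_nonneg.2 ht.1)
  exact le_of_mul_le_mul_right (by linarith) (sub_pos.2 hab)

theorem IsLocalGeodesic.eqOn {c c' : ℝ → Y} {a b : ℝ} (hc : IsLocalGeodesic c a b)
    (hc' : IsLocalGeodesic c' a b)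
    (hball : ∀ t ∈ Icc a b, ∃ z r, IsBusemannBall z r ∧ c t ∈ ball z r ∧ c' t ∈ ball z r)
    (ha : c a = c' a) (hb : c b = c' b) : EqOn c c' (Icc a b) := fun _ ht =>
  dist_le_zero.1 (hc.dist_le_of_max hc' hball (by simp [ha]) (by simp [hb]) ht)

/-- A local geodesic inside a Busemann convex ball is a geodesic. -/
theorem IsLocalGeodesic.exists_dist_eq {c : ℝ → Y} {a b : ℝ} (hc : IsLocalGeodesic c a b)
    {z : Y} {r : ℝ} (hz : IsBusemannBall z r) (hball : ∀ t ∈ Icc a b, c t ∈ ball z r)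
    (hab : a < b) :
    ∀ s ∈ Icc a b, ∀ s' ∈ Icc a b, dist (c s) (c s') = dist (c a) (c b) / (b - a) * |s - s'| := by
  obtain ⟨γ, hγ, m⟩ := hz.exists_geodesic _ (hball a ⟨le_rfl, hab.le⟩) _ (hball b ⟨hab.le, le_rfl⟩)
  have hba : 0 < b - a := sub_pos.2 hab
  have hd := hγ.dist_eq_rescale hab
  have heq := hc.eqOn (isLocalGeodesic_of_dist_eq hd)
    (fun t ht => ⟨z, r, hz, hball t ht, m _ ⟨div_nonneg (by linarith [ht.1]) hba.le,
      (div_le_one hba).2 (by linarith [ht.2])⟩⟩)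
    (by simp [hγ.source]) (by simp [hγ.target, hba.ne'])
  intro s hs s' hs'
  rw [heq hs, heq hs', hd s hs s' hs']

/-- Two local geodesics that overlap in a nondegenerate interval can be glued. -/
theorem IsLocalGeodesic.glue {c c' : ℝ → Y} {a b a' b' : ℝ} (hc : IsLocalGeodesic c a b')
    (hc' : IsLocalGeodesic c' a' b) (hab : a' < b')
    (heq : EqOn c c' (Icc a' b')) :
    IsLocalGeodesic (fun t => if t ≤ b' then c t else c' t) a b := by
  have e1 : ∀ s ∈ Icc a b', (if s ≤ b' then c s else c' s) = c s := fun s hs => if_pos hs.2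
  have e2 : ∀ s ∈ Icc a' b, (if s ≤ b' then c s else c' s) = c' s := fun s hs => by
    split_ifs with h
    · exact heq ⟨hs.1, h⟩
    · rfl
  intro t ht
  rcases lt_or_ge t b' with h | h
  · obtain ⟨δ, hδ, v, hv⟩ := hc t ⟨ht.1, h.le⟩
    refine ⟨min δ (b' - t), lt_min hδ (sub_pos.2 h), v, fun s hs s' hs' h1 h2 => ?_⟩
    rw [lt_min_iff] at h1 h2
    have m1 : s ∈ Icc a b' := ⟨hs.1, by linarith [(abs_lt.1 h1.2).2]⟩
    have m2 : s' ∈ Icc a b' := ⟨hs'.1, by linarith [(abs_lt.1 h2.2).2]⟩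
    simp only [e1 s m1, e1 s' m2]
    exact hv s m1 s' m2 h1.1 h2.1
  · obtain ⟨δ, hδ, v, hv⟩ := hc' t ⟨by linarith, ht.2⟩
    refine ⟨min δ (t - a'), lt_min hδ (by linarith), v, fun s hs s' hs' h1 h2 => ?_⟩
    rw [lt_min_iff] at h1 h2
    have m1 : s ∈ Icc a' b := ⟨by linarith [(abs_lt.1 h1.2).1], hs.2⟩
    have m2 : s' ∈ Icc a' b := ⟨by linarith [(abs_lt.1 h2.2).1], hs'.2⟩
    simp only [e2 s m1, e2 s' m2]
    exact hv s m1 s' m2 h1.1 h2.1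

/-- A local geodesic can be perturbed to a local geodesic with any prescribed nearby endpoints.
The length of the interval on which this is known grows by the factor `3 / 2` in each step: local
geodesics on the first and on the last two thirds of the interval fit together if their values at
the two points of subdivision agree, and this is a fixed point problem for a contraction. -/
theorem IsLocalGeodesic.exists_near [CompleteSpace Y] {c : ℝ → Y} (hc : IsLocalGeodesic c 0 1)
    {ε : ℝ} (hε : 0 < ε) (hball : ∀ t ∈ Icc (0 : ℝ) 1, IsBusemannBall (c t) (2 * ε))
    {p q : Y} (hp : dist p (c 0) < ε) (hq : dist q (c 1) < ε) :
    ∃ c' : ℝ → Y, IsLocalGeodesic c' 0 1 ∧ c' 0 = p ∧ c' 1 = q ∧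
      ∀ t ∈ Icc (0 : ℝ) 1, dist (c' t) (c t) < ε := by
  set P : ℝ → Prop := fun A => ∀ a b : ℝ, a < b → Icc a b ⊆ Icc 0 1 → b - a ≤ A → ∀ p q : Y,
    dist p (c a) < ε → dist q (c b) < ε → ∃ c' : ℝ → Y, IsLocalGeodesic c' a b ∧ c' a = p ∧
      c' b = q ∧ ∀ t ∈ Icc a b, dist (c' t) (c t) < ε with hP
  suffices ∃ A, 1 ≤ A ∧ P A by
    obtain ⟨A, hA, h⟩ := this
    exact h 0 1 one_pos le_rfl (by simpa using hA) p q hp hq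
  obtain ⟨δ, hδ, hδc⟩ := Metric.uniformContinuousOn_iff.1
    (isCompact_Icc.uniformContinuousOn_of_continuous hc.continuousOn) ε hε
  have base : P (δ / 2) := by
    intro a b hab hsub hA p q hp hq
    have ha : a ∈ Icc a b := ⟨le_rfl, hab.le⟩
    have hb : b ∈ Icc a b := ⟨hab.le, le_rfl⟩
    have hca : ∀ t ∈ Icc a b, dist (c t) (c a) < ε := fun t ht =>
      hδc t (hsub ht) a (hsub ha) (by
        rw [Real.dist_eq, abs_of_nonneg (by linarith [ht.1])]; linarith [ht.2])
    have hz := hball a (hsub ha)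
    obtain ⟨γ, hγ, m⟩ := hz.exists_geodesic p (by rw [mem_ball]; linarith) q
      (by rw [mem_ball]; linarith [dist_triangle q (c b) (c a), hca b hb])
    have hba : 0 < b - a := sub_pos.2 hab
    have hloc := isLocalGeodesic_of_dist_eq (hγ.dist_eq_rescale hab)
    have e0 : γ ((a - a) / (b - a)) = p := by simp [hγ.source]
    have e1 : γ ((b - a) / (b - a)) = q := by rw [div_self hba.ne', hγ.target]
    refine ⟨_, hloc, e0, e1, fun t ht => ?_⟩
    refine lt_of_le_of_lt (hloc.dist_le_of_max (hc.mono hsub) (fun t ht => ⟨c a, 2 * ε, hz,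
      m _ ⟨div_nonneg (by linarith [ht.1]) hba.le, (div_le_one hba).2 (by linarith [ht.2])⟩,
      by rw [mem_ball]; linarith [hca t ht]⟩) (e := max (dist p (c a)) (dist q (c b)))
      (by simp only [e0]; exact le_max_left _ _) (by simp only [e1]; exact le_max_right _ _) ht)
      (max_lt hp hq)
  have step : ∀ A, P A → P (3 / 2 * A) := by
    intro A hA a b hab hsub hbA p q hp hq
    set l : ℝ := (b - a) / 3 with hl
    have hl0 : 0 < l := by rw [hl]; linarith
    have hbl : b = a + 3 * l := by rw [hl]; ring
    set p₁ : ℝ := a + l with hp₁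
    set p₂ : ℝ := a + 2 * l with hp₂
    have hs₁ : Icc a p₂ ⊆ Icc a b := Icc_subset_Icc le_rfl (by linarith)
    have hs₂ : Icc p₁ b ⊆ Icc a b := Icc_subset_Icc (by linarith) le_rfl
    set e := max (dist p (c a)) (dist q (c b)) with he
    have heε : e < ε := max_lt hp hq
    -- two local geodesics that are `ε`-close to `c` lie in common balls
    have common : ∀ {c₁ c₂ : ℝ → Y} {a' b' : ℝ}, Icc a' b' ⊆ Icc a b →
        (∀ t ∈ Icc a' b', dist (c₁ t) (c t) < ε) → (∀ t ∈ Icc a' b', dist (c₂ t) (c t) < ε) →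
        ∀ t ∈ Icc a' b', ∃ z r, IsBusemannBall z r ∧ c₁ t ∈ ball z r ∧ c₂ t ∈ ball z r :=
      fun hs h1 h2 t ht => ⟨c t, 2 * ε, hball t (hsub (hs ht)),
        by rw [mem_ball]; linarith [h1 t ht], by rw [mem_ball]; linarith [h2 t ht]⟩
    have self : ∀ t ∈ Icc a b, dist (c t) (c t) < ε := fun t _ => by simpa using hε
    have hφ : ∀ x : closedBall (c p₂) e, ∃ c' : ℝ → Y, IsLocalGeodesic c' a p₂ ∧ c' a = p ∧
        c' p₂ = x ∧ ∀ t ∈ Icc a p₂, dist (c' t) (c t) < ε := fun x =>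
      hA a p₂ (by linarith) (hs₁.trans hsub) (by linarith) p x hp (lt_of_le_of_lt x.2 heε)
    have hψ : ∀ y : closedBall (c p₁) e, ∃ c' : ℝ → Y, IsLocalGeodesic c' p₁ b ∧ c' p₁ = y ∧
        c' b = q ∧ ∀ t ∈ Icc p₁ b, dist (c' t) (c t) < ε := fun y =>
      hA p₁ b (by linarith) (hs₂.trans hsub) (by linarith) y q (lt_of_le_of_lt y.2 heε) hq
    choose φ φloc φa φp φε using hφ
    choose ψ ψloc ψp ψb ψε using hψ
    have mp₁ : p₁ ∈ Icc a p₂ := ⟨by linarith, by linarith⟩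
    have mp₂ : p₂ ∈ Icc p₁ b := ⟨by linarith, by linarith⟩
    have φmem : ∀ x, φ x p₁ ∈ closedBall (c p₁) e := fun x =>
      (φloc x).dist_le_of_max (hc.mono (hs₁.trans hsub)) (common hs₁ (φε x)
        fun t ht => self t (hs₁ ht)) (by rw [φa]; exact le_max_left _ _) (by rw [φp]; exact x.2) mp₁
    have ψmem : ∀ y, ψ y p₂ ∈ closedBall (c p₂) e := fun y =>
      (ψloc y).dist_le_of_max (hc.mono (hs₂.trans hsub)) (common hs₂ (ψε y)
        fun t ht => self t (hs₂ ht)) (by rw [ψp]; exact y.2) (by rw [ψb]; exact le_max_right _ _) mp₂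
    have φcontr : ∀ x x', dist (φ x p₁) (φ x' p₁) ≤ 1 / 2 * dist x x' := fun x x' => by
      have := (φloc x).dist_mul_le (φloc x') (common hs₁ (φε x) (φε x')) mp₁
      rw [φa, φa, φp, φp, dist_self, ← Subtype.dist_eq, show p₂ - a = 2 * l by linarith,
        show p₂ - p₁ = l by linarith, show p₁ - a = l by linarith] at this
      nlinarith
    have ψcontr : ∀ y y', dist (ψ y p₂) (ψ y' p₂) ≤ 1 / 2 * dist y y' := fun y y' => by
      have := (ψloc y).dist_mul_le (ψloc y') (common hs₂ (ψε y) (ψε y')) mp₂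
      rw [ψb, ψb, ψp, ψp, dist_self, ← Subtype.dist_eq, show b - p₁ = 2 * l by linarith,
        show p₂ - p₁ = l by linarith, show b - p₂ = l by linarith] at this
      nlinarith
    let F : closedBall (c p₁) e → closedBall (c p₁) e := fun y => ⟨φ ⟨ψ y p₂, ψmem y⟩ p₁, φmem _⟩
    have hF : ContractingWith (1 / 2) F := by
      refine ⟨by rw [← NNReal.coe_lt_coe]; norm_num, LipschitzWith.of_dist_le_mul fun y y' => ?_⟩
      have h1 := φcontr ⟨ψ y p₂, ψmem y⟩ ⟨ψ y' p₂, ψmem y'⟩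
      have h2 := ψcontr y y'
      rw [Subtype.dist_eq] at h1 ⊢
      push_cast
      linarith [dist_nonneg (x := y) (y := y')]
    have : CompleteSpace (closedBall (c p₁) e) := isClosed_closedBall.completeSpace_coe
    have : Nonempty (closedBall (c p₁) e) :=
      ⟨⟨c p₁, mem_closedBall_self (dist_nonneg.trans (le_max_left _ _))⟩⟩
    obtain ⟨y, hy⟩ : ∃ y, F y = y := ⟨_, hF.fixedPoint_isFixedPt⟩
    set x : closedBall (c p₂) e := ⟨ψ y p₂, ψmem y⟩ with hx
    have hs₃ : Icc p₁ p₂ ⊆ Icc a p₂ := Icc_subset_Icc (by linarith) le_rfl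
    have hs₄ : Icc p₁ p₂ ⊆ Icc p₁ b := Icc_subset_Icc le_rfl (by linarith)
    have heq : EqOn (φ x) (ψ y) (Icc p₁ p₂) :=
      ((φloc x).mono hs₃).eqOn ((ψloc y).mono hs₄) (common (hs₃.trans hs₁)
        (fun t ht => φε x t (hs₃ ht)) fun t ht => ψε y t (hs₄ ht))
        (by rw [ψp]; exact congrArg Subtype.val hy) (by rw [φp])
    refine ⟨_, (φloc x).glue (ψloc y) (by linarith) heq, ?_, ?_, fun t ht => ?_⟩
    · rw [if_pos (by linarith), φa]
    · rw [if_neg (by linarith), ψb]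
    · split_ifs with h
      · exact φε x t ⟨ht.1, h⟩
      · exact ψε y t ⟨by linarith, ht.2⟩
  have iter : ∀ n : ℕ, P ((3 / 2) ^ n * (δ / 2)) := fun n => by
    induction n with
    | zero => simpa using base
    | succ n ih =>
      have := step _ ih
      rwa [← mul_assoc, ← pow_succ'] at this
  obtain ⟨n, hn⟩ := pow_unbounded_of_one_lt (2 / δ) (by norm_num : (1 : ℝ) < 3 / 2)
  refine ⟨_, ?_, iter n⟩
  rw [div_lt_iff₀ hδ] at hn
  linarith

end CAT0Balls

/-! ### Local isometries from complete spaces, and covering maps -/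

section LocalIsometries

open Set Metric unitInterval

variable {E : Type u} {B : Type v}

/-- A map of metric spaces which maps small balls isometrically onto balls. -/
def IsBallIsometry [MetricSpace E] [MetricSpace B] (p : E → B) : Prop :=
  ∀ e, ∃ ε > 0, (∀ e' ∈ ball e ε, ∀ e'' ∈ ball e ε, dist (p e') (p e'') = dist e' e'') ∧
    ball (p e) ε ⊆ p '' ball e ε

theorem IsBallIsometry.isLocalHomeomorph [MetricSpace E] [MetricSpace B] {p : E → B}
    (hp : IsBallIsometry p) : IsLocalHomeomorph p := by
  rw [isLocalHomeomorph_iff_isOpenEmbedding_restrict]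
  intro e
  obtain ⟨ε, hε, h1, h2⟩ := hp e
  refine ⟨ball e ε, ball_mem_nhds e hε, ?_, ?_⟩
  · exact (Isometry.of_dist_eq (f := (ball e ε).domRestrict p)
      fun a b => h1 a a.2 b b.2).isEmbedding
  · have : range ((ball e ε).domRestrict p) = ball (p e) ε := by
      rw [range_domRestrict]
      refine Subset.antisymm ?_ h2
      rintro _ ⟨e', he', rfl⟩
      rw [mem_ball, h1 e' he' e (mem_ball_self hε)]
      exact he'
    rw [this]
    exact isOpen_ball

/-- Lipschitz paths can be lifted through a local isometry of a complete space: the lift can be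
continued to the right at each point, and by completeness it can be continued to limits. -/
theorem IsBallIsometry.exists_lift [MetricSpace E] [CompleteSpace E] [MetricSpace B] {p : E → B}
    (hp : IsBallIsometry p) {K : ℝ≥0} {u : ℝ → B} (hu : LipschitzWith K u) {e : E}
    (he : p e = u 0) :
    ∃ Γ : ℝ → E, ContinuousOn Γ (Icc 0 1) ∧ Γ 0 = e ∧ ∀ t ∈ Icc (0 : ℝ) 1, p (Γ t) = u t := by
  have homeo := hp.isLocalHomeomorph
  have sep : IsSeparatedMap p := T2Space.isSeparatedMap p
  set S : Set ℝ := {s | ∃ Γ : ℝ → E, LipschitzOnWith K Γ (Icc 0 s) ∧ Γ 0 = e ∧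
    ∀ t ∈ Icc (0 : ℝ) s, p (Γ t) = u t} with hS
  suffices Icc (0 : ℝ) 1 ⊆ S by
    obtain ⟨Γ, h1, h2, h3⟩ := this ⟨zero_le_one, le_rfl⟩
    exact ⟨Γ, h1.continuousOn, h2, h3⟩
  have down : ∀ s ∈ S, ∀ s' ≤ s, s' ∈ S := fun s ⟨Γ, h1, h2, h3⟩ s' hs' =>
    ⟨Γ, h1.mono (Icc_subset_Icc_right hs'), h2, fun t ht => h3 t ⟨ht.1, ht.2.trans hs'⟩⟩
  have uniq : ∀ (s : ℝ) (Γ Γ' : ℝ → E), ContinuousOn Γ (Icc 0 s) → ContinuousOn Γ' (Icc 0 s) →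
      Γ 0 = e → Γ' 0 = e → (∀ t ∈ Icc (0 : ℝ) s, p (Γ t) = u t) →
      (∀ t ∈ Icc (0 : ℝ) s, p (Γ' t) = u t) → EqOn Γ Γ' (Icc 0 s) := by
    intro s Γ Γ' c c' h0 h0' hl hl' t ht
    exact sep.eqOn_of_comp_eqOn homeo.isLocallyInjective isPreconnected_Icc c c'
      (fun t ht => (hl t ht).trans (hl' t ht).symm) ⟨le_rfl, ht.1.trans ht.2⟩
      (h0.trans h0'.symm) ht
  refine IsClosed.Icc_subset_of_forall_exists_gt (isClosed_of_closure_subset fun s hs => ?_)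
    ⟨fun _ => e, LipschitzOnWith.of_dist_le_mul fun _ _ _ _ => by rw [dist_self]; positivity, rfl,
      fun t ht => by
      rw [le_antisymm ht.2 ht.1, he]⟩ ?_
  · have hs01 : s ∈ Icc (0 : ℝ) 1 := closure_minimal inter_subset_right isClosed_Icc hs
    refine ⟨?_, hs01⟩
    by_cases hex : ∃ s' ∈ S, s ≤ s'
    · obtain ⟨s', h1, h2⟩ := hex
      exact down s' h1 s h2
    push Not at hex
    have hlt : ∀ t < s, ∃ s' ∈ S, t < s' := fun t ht => by
      obtain ⟨s', h1, h2⟩ := mem_closure_iff.1 hs (Ioi t) isOpen_Ioi ht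
      exact ⟨s', h2.1, h1⟩
    have hs0 : 0 < s := hex 0 (by
      obtain ⟨s', h1⟩ := closure_nonempty_iff.1 ⟨s, hs⟩
      exact down s' h1.1 0 h1.2.1)
    have hlt' : ∀ t : ℝ, ∃ Γ : ℝ → E, t < s → LipschitzOnWith K Γ (Icc 0 t) ∧ Γ 0 = e ∧
        ∀ t' ∈ Icc (0 : ℝ) t, p (Γ t') = u t' := fun t => by
      by_cases ht : t < s
      · obtain ⟨s', h1, h2⟩ := hlt t ht
        obtain ⟨Γ, h⟩ := down s' h1 t h2.le
        exact ⟨Γ, fun _ => h⟩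
      · exact ⟨fun _ => e, fun h => absurd h ht⟩
    choose G hG using hlt'
    have hGeq : ∀ t t', 0 ≤ t → t ≤ t' → t' < s → G t t = G t' t := fun t t' h0 htt' ht' => by
      obtain ⟨a1, a2, a3⟩ := hG t (htt'.trans_lt ht')
      obtain ⟨b1, b2, b3⟩ := hG t' ht'
      exact uniq t (G t) (G t') a1.continuousOn
        (b1.continuousOn.mono (Icc_subset_Icc_right htt')) a2 b2 a3
        (fun r hr => b3 r ⟨hr.1, hr.2.trans htt'⟩) ⟨h0, le_rfl⟩
    have hlip : LipschitzOnWith K (fun t => G t t) (Ico 0 s) := by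
      refine LipschitzOnWith.of_dist_le_mul fun t ht t' ht' => ?_
      rcases le_total t t' with h | h
      · rw [hGeq t t' ht.1 h ht'.2]
        exact (hG t' ht'.2).1.dist_le_mul t ⟨ht.1, h⟩ t' ⟨ht'.1, le_rfl⟩
      · rw [hGeq t' t ht'.1 h ht.2]
        exact (hG t ht.2).1.dist_le_mul t ⟨ht.1, le_rfl⟩ t' ⟨ht'.1, h⟩
    have : (𝓝[Ico 0 s] s).NeBot := by
      rw [← mem_closure_iff_nhdsWithin_neBot, closure_Ico hs0.ne]
      exact ⟨hs0.le, le_rfl⟩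
    obtain ⟨e', he'⟩ := cauchy_map_iff_exists_tendsto.1
      ((cauchy_nhds.mono nhdsWithin_le_nhds).map_of_le hlip.uniformContinuousOn
        (Filter.le_principal_iff.2 self_mem_nhdsWithin) : Cauchy (Filter.map _ (𝓝[Ico 0 s] s)))
    have hne : ∀ t < s, Function.update (fun t => G t t) s e' t = G t t := fun t ht =>
      Function.update_of_ne ht.ne _ _
    have hself : Function.update (fun t => G t t) s e' s = e' := Function.update_self ..
    have hcl : closure (Ico 0 s) = Icc 0 s := closure_Ico hs0.ne
    refine ⟨Function.update (fun t => G t t) s e', ?_, ?_, fun t ht => ?_⟩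
    · rw [← hcl, lipschitzOnWith_closure_iff]
      · exact fun t ht t' ht' => by
          rw [hne t ht.2, hne t' ht'.2]; exact hlip ht ht'
      · rw [hcl, continuousOn_update_iff]
        have : Icc 0 s \ {s} = Ico 0 s := by
          ext t; simp only [mem_sdiff, mem_Icc, mem_singleton_iff, mem_Ico]
          exact ⟨fun h => ⟨h.1.1, lt_of_le_of_ne h.1.2 h.2⟩, fun h => ⟨⟨h.1, h.2.le⟩, h.2.ne⟩⟩
        rw [this]
        exact ⟨hlip.continuousOn, fun _ => he'⟩
    · rw [hne 0 hs0]; exact (hG 0 hs0).2.1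
    · rcases ht.2.eq_or_lt with rfl | hts
      · rw [hself]
        have h1 : Filter.Tendsto (fun t' => p (G t' t')) (𝓝[Ico 0 t] t) (𝓝 (p e')) :=
          (homeo.continuous.tendsto e').comp he'
        have h2 : Filter.Tendsto u (𝓝[Ico 0 t] t) (𝓝 (u t)) :=
          (hu.continuous.tendsto t).mono_left nhdsWithin_le_nhds
        refine tendsto_nhds_unique (h1.congr' ?_) h2
        filter_upwards [self_mem_nhdsWithin] with t' ht'
        exact (hG t' ht'.2).2.2 t' ⟨ht'.1, le_rfl⟩
      · rw [hne t hts]; exact (hG t hts).2.2 t ⟨ht.1, le_rfl⟩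
  · rintro s ⟨⟨Γ, hΓ, hΓ0, hΓu⟩, hs0, hs1⟩ y hy
    obtain ⟨ε, hε, h1, h2⟩ := hp (Γ s)
    obtain ⟨η, hη0, hη⟩ : ∃ η > 0, K * η < ε := by
      refine ⟨ε / (K + 1), by positivity, ?_⟩
      rw [mul_div_assoc', div_lt_iff₀ (by positivity)]
      nlinarith [K.2]
    have hmem : ∀ t, ∃ x : E, t ∈ Icc s (s + η) → x ∈ ball (Γ s) ε ∧ p x = u t := fun t => by
      by_cases ht : t ∈ Icc s (s + η)
      · obtain ⟨x, hx⟩ := h2 (show u t ∈ ball (p (Γ s)) ε by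
          rw [mem_ball, hΓu s ⟨hs0, le_rfl⟩]
          refine (hu.dist_le_mul t s).trans_lt (lt_of_le_of_lt ?_ hη)
          rw [Real.dist_eq, abs_of_nonneg (by linarith [ht.1])]
          exact mul_le_mul_of_nonneg_left (by linarith [ht.2]) K.2)
        exact ⟨x, fun _ => hx⟩
      · exact ⟨e, fun h => absurd h ht⟩
    choose Γ' hΓ' using hmem
    have hs' : s ∈ Icc s (s + η) := ⟨le_rfl, by linarith⟩
    have hΓ's : Γ' s = Γ s := by
      rw [← dist_eq_zero, ← h1 _ (hΓ' s hs').1 _ (mem_ball_self hε), (hΓ' s hs').2,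
        hΓu s ⟨hs0, le_rfl⟩, dist_self]
    have hΓ'lip : ∀ t ∈ Icc s (s + η), ∀ t' ∈ Icc s (s + η), dist (Γ' t) (Γ' t') ≤ K * dist t t' :=
      fun t ht t' ht' => by
        rw [← h1 _ (hΓ' t ht).1 _ (hΓ' t' ht').1, (hΓ' t ht).2, (hΓ' t' ht').2]
        exact hu.dist_le_mul t t'
    have key : s + η ∈ S := by
      have cross : ∀ t t', 0 ≤ t → t ≤ s → s < t' → t' ≤ s + η →
          dist (Γ t) (Γ' t') ≤ K * dist t t' := fun t t' a1 a2 a3 a4 => by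
        have b1 := hΓ.dist_le_mul t ⟨a1, a2⟩ s ⟨hs0, le_rfl⟩
        have b2 := hΓ'lip s hs' t' ⟨a3.le, a4⟩
        rw [hΓ's] at b2
        have b3 : dist t t' = dist t s + dist s t' := by
          rw [dist_comm, dist_comm t s, dist_comm s t', Real.dist_eq, Real.dist_eq, Real.dist_eq,
            abs_of_nonneg, abs_of_nonneg, abs_of_nonneg] <;> linarith
        rw [b3, mul_add]
        exact (dist_triangle _ (Γ s) _).trans (add_le_add b1 b2)
      refine ⟨fun t => if t ≤ s then Γ t else Γ' t, ?_, by simp [hs0, hΓ0], fun t ht => ?_⟩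
      · refine LipschitzOnWith.of_dist_le_mul fun t ht t' ht' => ?_
        by_cases h : t ≤ s <;> by_cases h' : t' ≤ s <;> simp only [h, h', if_true, if_false]
        · exact hΓ.dist_le_mul t ⟨ht.1, h⟩ t' ⟨ht'.1, h'⟩
        · exact cross t t' ht.1 h (not_le.1 h') ht'.2
        · rw [dist_comm, dist_comm t]; exact cross t' t ht'.1 h' (not_le.1 h) ht.2
        · exact hΓ'lip t ⟨(not_le.1 h).le, ht.2⟩ t' ⟨(not_le.1 h').le, ht'.2⟩
      · dsimp only
        split_ifs with h
        · exact hΓu t ⟨ht.1, h⟩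
        · exact (hΓ' t ⟨(not_le.1 h).le, ht.2⟩).2
    have hy : s < y := hy
    exact ⟨min (s + η) y, down _ key _ (min_le_left _ _), lt_min (by linarith) hy, min_le_right _ _⟩

/-- The version of `IsBallIsometry.exists_lift` for paths parametrized by the unit interval. -/
theorem IsBallIsometry.exists_path_lift [MetricSpace E] [CompleteSpace E] [MetricSpace B]
    {p : E → B} (hp : IsBallIsometry p) {K : ℝ≥0} {u : I → B} (hu : LipschitzWith K u) {e : E}
    (he : p e = u 0) : ∃ Γ : C(I, E), Γ 0 = e ∧ ∀ t, p (Γ t) = u t := by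
  obtain ⟨Γ, h1, h2, h3⟩ := hp.exists_lift (hu.comp (LipschitzWith.projIcc zero_le_one)) (e := e)
    (by simpa using he)
  refine ⟨⟨fun t => Γ t, h1.comp_continuous continuous_subtype_val fun t => t.2⟩, h2, fun t => ?_⟩
  simpa using h3 t t.2

/-- A separated local homeomorphism is a covering map if each point `b` has a neighbourhood that
contracts to `b` along paths which can be lifted, in both directions. -/
theorem IsLocalHomeomorph.isCoveringMap_of_radial [TopologicalSpace E] [TopologicalSpace B]
    {p : E → B} (homeo : IsLocalHomeomorph p) (sep : IsSeparatedMap p)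
    (h : ∀ b, ∃ (U : Set B) (_ : IsOpen U) (_ : b ∈ U) (R : C(I × U, B)),
      (∀ x, R (0, x) = b) ∧ (∀ x, R (1, x) = x) ∧ ∀ x,
      (∀ e, p e = b → ∃ Γ : C(I, E), Γ 0 = e ∧ ∀ t, p (Γ t) = R (t, x)) ∧
      (∀ e, p e = x → ∃ Γ : C(I, E), Γ 1 = e ∧ ∀ t, p (Γ t) = R (t, x))) :
    IsCoveringMap p := by
  intro b
  obtain ⟨U, hU, hb, R, hR0, hR1, hR⟩ := h b
  have uniq : ∀ Γ Γ' : C(I, E), (∀ t, p (Γ t) = p (Γ' t)) → ∀ t₀, Γ t₀ = Γ' t₀ → Γ = Γ' :=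
    fun Γ Γ' h1 t₀ h2 => DFunLike.coe_injective <| sep.eq_of_comp_eq homeo.isLocallyInjective
      Γ.continuous Γ'.continuous (funext h1) t₀ h2
  have hout : ∀ x : U × p ⁻¹' {b}, ∃ Γ : C(I, E), Γ 0 = x.2 ∧ ∀ t, p (Γ t) = R (t, x.1) :=
    fun x => (hR x.1).1 x.2 x.2.2
  have hin : ∀ e : p ⁻¹' U, ∃ Γ : C(I, E), Γ 1 = e ∧ ∀ t, p (Γ t) = R (t, ⟨p e, e.2⟩) :=
    fun e => (hR ⟨p e, e.2⟩).2 e rfl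
  choose Out Out0 Outp using hout
  choose In In1 Inp using hin
  have cOut : Continuous fun q : I × (U × p ⁻¹' {b}) => Out q.2 q.1 := by
    refine homeo.continuous_lift sep (R.comp
      ⟨fun q : I × (U × p ⁻¹' {b}) => (q.1, q.2.1), by fun_prop⟩)
      (funext fun q => Outp q.2 q.1) ?_ fun a => (Out a).continuous
    simp only [Out0]
    fun_prop
  have cIn : Continuous fun q : I × p ⁻¹' U => In q.2 (σ q.1) := by
    refine homeo.continuous_lift sep (R.comp ⟨fun q : I × p ⁻¹' U => (σ q.1, ⟨p q.2, q.2.2⟩), by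
        have := homeo.continuous; fun_prop⟩)
      (funext fun q => Inp q.2 (σ q.1)) ?_ fun a => (In a).continuous.comp continuous_symm
    simp only [symm_zero, In1]
    fun_prop
  have hInmem : ∀ e, In e 0 ∈ p ⁻¹' {b} := fun e => (Inp e 0).trans (hR0 _)
  have hOutmem : ∀ x, p (Out x 1) = x.1 := fun x => (Outp x 1).trans (hR1 _)
  have : DiscreteTopology (p ⁻¹' {b}) := by
    refine (discreteTopology_iff_locallyInjective b).2 ?_
    have := homeo.isLocallyInjective.comp_right (g := ((↑) : p ⁻¹' {b} → E))
      continuous_subtype_val Subtype.val_injective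
    convert! this using 1
    exact funext fun x => x.2.symm
  refine
    ⟨this, U, hb, hU, hU.preimage homeo.continuous,
    { toFun := fun e => (⟨p e, e.2⟩, ⟨In e 0, hInmem e⟩)
      invFun := fun x => ⟨Out x 1, by rw [mem_preimage, hOutmem x]; exact x.1.2⟩
      left_inv := fun e => ?_
      right_inv := fun x => ?_
      continuous_toFun := ?_
      continuous_invFun := ?_ }, fun _ => rfl⟩
  · ext
    have := uniq (Out (⟨p e, e.2⟩, ⟨In e 0, hInmem e⟩)) (In e)
      (fun t => by rw [Outp, Inp]) 0 (by rw [Out0])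
    simp only [this, In1]
  · have hx : p (Out x 1) ∈ U := by rw [hOutmem]; exact x.1.2
    have := uniq (In ⟨Out x 1, hx⟩) (Out x) (fun t => (Inp _ t).trans
      ((congrArg (fun y => R (t, y)) (Subtype.ext (hOutmem x))).trans (Outp x t).symm)) 1 (by rw [In1])
    ext
    · exact hOutmem x
    · simp only [this, Out0]
  · have := homeo.continuous
    have h2 := cIn.comp (Continuous.prodMk_right (1 : I))
    simp only [Function.comp_def, symm_one] at h2
    exact Continuous.prodMk (by fun_prop) (h2.subtype_mk _)
  · exact (cOut.comp (Continuous.prodMk_right (1 : I))).subtype_mk _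

end LocalIsometries

/-! ### The space of local geodesics -/

section GeodesicSpace

open Set Metric unitInterval

/-- Each point is the centre of a Busemann convex ball. -/
def IsLocallyBusemann (Y : Type u) [MetricSpace Y] : Prop :=
  ∀ y : Y, ∃ r > 0, IsBusemannBall y r

theorem IsLocallyCAT0.isLocallyBusemann {Y : Type u} [MetricSpace Y] (hY : IsLocallyCAT0 Y) :
    IsLocallyBusemann Y := fun y => by
  obtain ⟨r, hr, h⟩ := hY y
  exact ⟨r, hr, isBusemannBall_of_isCAT0 h⟩

/-- The space of local geodesics `[0, 1] → Y`, parametrized with constant speed, with the metric of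
uniform convergence. For complete locally CAT(0) spaces `Y` it is a covering space of `Y × Y`, with
the homotopy classes of paths from `p` to `q` as the fibre over `(p, q)`. -/
abbrev GeodesicSpace (Y : Type u) [MetricSpace Y] : Type u :=
  {c : C(I, Y) // IsLocalGeodesic (fun t : ℝ => c (projIcc 0 1 zero_le_one t)) 0 1}

variable {Y : Type u} [MetricSpace Y]

namespace GeodesicSpace

/-- The endpoints of a local geodesic. -/
def ends (c : GeodesicSpace Y) : Y × Y := (c.1 0, c.1 1)

/-- The constant geodesics. -/
def const (y : Y) : GeodesicSpace Y :=
  ⟨ContinuousMap.const I y, isLocalGeodesic_of_dist_eq (v := 0) (by simp)⟩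

@[simp] theorem const_apply (y : Y) (t : I) : (const y).1 t = y := rfl

theorem continuous_const : Continuous (const (Y := Y)) :=
  Continuous.subtype_mk ContinuousMap.continuous_const' _

theorem exists_radius_of_isCompact (hY : IsLocallyBusemann Y) {C : Set Y} (hC : IsCompact C) :
    ∃ ε > 0, ∀ y ∈ C, IsBusemannBall y (2 * ε) := by
  choose r hr hb using hY
  obtain ⟨δ, hδ, h⟩ := lebesgue_number_lemma_of_metric hC (c := fun y => ball y (r y))
    (fun _ => isOpen_ball) fun y _ => mem_iUnion.2 ⟨y, mem_ball_self (hr y)⟩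
  refine ⟨δ / 2, by positivity, fun y hy => ?_⟩
  obtain ⟨z, hz⟩ := h y hy
  rw [mul_div_cancel₀ _ two_ne_zero]
  exact (hb z).mono hz

/-- The estimate for two local geodesics that are close to a third one. -/
theorem dist_apply_le_of_mem_ball {c c' c'' : GeodesicSpace Y} {ε : ℝ}
    (hc : ∀ t, IsBusemannBall (c.1 t) (2 * ε)) (h' : c' ∈ ball c ε) (h'' : c'' ∈ ball c ε) (t : I) :
    dist (c'.1 t) (c''.1 t) ≤
      (1 - t) * dist (c'.1 0) (c''.1 0) + t * dist (c'.1 1) (c''.1 1) := by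
  have near : ∀ {d : GeodesicSpace Y}, d ∈ ball c ε → ∀ s, d.1 s ∈ ball (c.1 s) (2 * ε) :=
    fun {d} hd s => by
      have h1 : dist d.1 c.1 < ε := hd
      have h2 := ContinuousMap.dist_apply_le_dist (f := d.1) (g := c.1) s
      rw [mem_ball]
      linarith [dist_nonneg (x := d.1) (y := c.1)]
  have := c'.2.dist_mul_le c''.2 (fun s _ => ⟨_, _, hc (projIcc 0 1 zero_le_one s), near h' _,
    near h'' _⟩) t.2
  simpa using this

/-- Local geodesics close to a given one are as far apart as their endpoints, by convexity of the
distance. -/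
theorem dist_ends_of_mem_ball {c c' c'' : GeodesicSpace Y} {ε : ℝ}
    (hc : ∀ t, IsBusemannBall (c.1 t) (2 * ε)) (h' : c' ∈ ball c ε) (h'' : c'' ∈ ball c ε) :
    dist (ends c') (ends c'') = dist c' c'' := by
  refine le_antisymm (max_le (ContinuousMap.dist_apply_le_dist 0)
    (ContinuousMap.dist_apply_le_dist 1)) ((ContinuousMap.dist_le dist_nonneg).2 fun t => ?_)
  have h0 : dist (c'.1 0) (c''.1 0) ≤ dist (ends c') (ends c'') := le_max_left _ _
  have h1 : dist (c'.1 1) (c''.1 1) ≤ dist (ends c') (ends c'') := le_max_right _ _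
  have := dist_apply_le_of_mem_ball hc h' h'' t
  have h3 := mul_le_mul_of_nonneg_left h0 (sub_nonneg.2 t.2.2)
  have h4 := mul_le_mul_of_nonneg_left h1 t.2.1
  linarith

theorem exists_mem_ball_ends_eq [CompleteSpace Y] {c : GeodesicSpace Y} {ε : ℝ} (hε : 0 < ε)
    (hc : ∀ t, IsBusemannBall (c.1 t) (2 * ε)) {u : Y × Y} (hu : u ∈ ball (ends c) ε) :
    ∃ c' ∈ ball c ε, ends c' = u := by
  have hu' : dist u.1 (c.1 0) < ε ∧ dist u.2 (c.1 1) < ε := max_lt_iff.1 hu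
  obtain ⟨c', h1, h2, h3, h4⟩ := c.2.exists_near hε (fun t _ => hc _) (p := u.1) (q := u.2)
    (by simpa using hu'.1) (by simpa using hu'.2)
  refine ⟨⟨⟨fun t : I => c' t,
    h1.continuousOn.comp_continuous continuous_subtype_val fun t => t.2⟩, ?_⟩, ?_, ?_⟩
  · exact h1.congr fun t ht => by simp [projIcc_of_mem zero_le_one ht]
  · refine (ContinuousMap.dist_lt_iff hε).2 fun t => ?_
    simpa using h4 t t.2
  · exact Prod.ext (by simpa [ends] using h2) (by simpa [ends] using h3)

theorem exists_radius (hY : IsLocallyBusemann Y) (c : GeodesicSpace Y) :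
    ∃ ε > 0, ∀ t, IsBusemannBall (c.1 t) (2 * ε) := by
  obtain ⟨ε, hε, h⟩ := exists_radius_of_isCompact hY (isCompact_range c.1.continuous)
  exact ⟨ε, hε, fun t => h _ (mem_range_self t)⟩

/-- The map `ends` is locally an isometry, as nearby local geodesics are as far apart as their
endpoints, and it is locally onto, as the endpoints of a local geodesic can be moved. -/
theorem isBallIsometry_ends [CompleteSpace Y] (hY : IsLocallyBusemann Y) :
    IsBallIsometry (ends (Y := Y)) := fun c => by
  obtain ⟨ε, hε, h⟩ := exists_radius hY c
  exact ⟨ε, hε, fun c' h' c'' h'' => dist_ends_of_mem_ball h h' h'',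
    fun u hu => exists_mem_ball_ends_eq hε h hu⟩

/-- Limits of local geodesics are local geodesics: in a Busemann convex ball local geodesics are
geodesics. -/
theorem completeSpace [CompleteSpace Y] (hY : IsLocallyBusemann Y) :
    CompleteSpace (GeodesicSpace Y) := by
  refine IsClosed.completeSpace_coe (hs := isClosed_of_closure_subset fun c hc => ?_)
  intro t ht
  set c' : ℝ → Y := fun t => c (projIcc 0 1 zero_le_one t) with hc'
  have cont : Continuous c' := c.continuous.comp continuous_projIcc
  obtain ⟨r, hr, hb⟩ := hY (c' t)
  obtain ⟨δ, hδ, h⟩ := Metric.continuous_iff.1 cont t (r / 2) (by positivity)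
  set a : ℝ := max 0 (t - δ / 2) with ha
  set b : ℝ := min 1 (t + δ / 2) with hb'
  have hab : a < b := by
    rw [ha, hb', max_lt_iff, lt_min_iff, lt_min_iff]
    exact ⟨⟨one_pos, by linarith [ht.1]⟩, by linarith [ht.2], by linarith⟩
  have sub01 : Icc a b ⊆ Icc 0 1 := Icc_subset_Icc (le_max_left _ _) (min_le_left _ _)
  have near : ∀ s ∈ Icc a b, dist (c' s) (c' t) < r / 2 := fun s hs => h s (by
    rw [Real.dist_eq, abs_lt]
    constructor <;> linarith [le_max_right 0 (t - δ / 2), min_le_right 1 (t + δ / 2), hs.1, hs.2])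
  refine ⟨δ / 2, by positivity, dist (c' a) (c' b) / (b - a), fun s hs s' hs' h1 h2 => ?_⟩
  have mem : ∀ s ∈ Icc (0 : ℝ) 1, |s - t| < δ / 2 → s ∈ Icc a b := fun s hs h => by
    rw [abs_lt] at h
    exact ⟨max_le hs.1 (by linarith [h.1]), le_min hs.2 (by linarith [h.2])⟩
  have hfreq := (mem_closure_iff_frequently.1 hc).and_eventually
    (ball_mem_nhds c (show 0 < r / 2 by positivity))
  have hclosed : IsClosed {d : C(I, Y) | dist (d (projIcc 0 1 zero_le_one s))
      (d (projIcc 0 1 zero_le_one s')) = dist (d (projIcc 0 1 zero_le_one a))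
      (d (projIcc 0 1 zero_le_one b)) / (b - a) * |s - s'|} :=
    isClosed_eq (by fun_prop) (by fun_prop)
  refine hclosed.mem_of_frequently_of_tendsto (hfreq.mono ?_) Filter.tendsto_id
  rintro d ⟨hd, hdc⟩
  refine (IsLocalGeodesic.mono hd sub01).exists_dist_eq hb (fun s hs => ?_) hab s (mem s hs h1) s'
    (mem s' hs' h2)
  have h3 := ContinuousMap.dist_apply_le_dist (f := d) (g := c) (projIcc 0 1 zero_le_one s)
  have h4 : dist d c < r / 2 := hdc
  change dist (d (projIcc 0 1 zero_le_one s)) (c' t) < r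
  linarith [dist_triangle (d (projIcc 0 1 zero_le_one s)) (c' s) (c' t), near s hs]

/-- Geodesics from the centre to the points of a Busemann convex ball depend continuously on the
endpoint. -/
theorem _root_.IsBusemannBall.exists_radial {z : Y} {r : ℝ} (h : IsBusemannBall z r) (hr : 0 < r) :
    ∃ γ : C(I × ball z r, Y), (∀ x, γ (0, x) = z) ∧ (∀ x, γ (1, x) = x) ∧
      ∀ x : ball z r, LipschitzWith (dist z (x : Y)).toNNReal fun t => γ (t, x) := by
  have hz : z ∈ ball z r := mem_ball_self hr
  choose γ hγ m using fun x : ball z r => h.exists_geodesic z hz x x.2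
  have hlip : ∀ x : ball z r, LipschitzWith (dist z (x : Y)).toNNReal fun t : I => γ x t := fun x =>
    LipschitzWith.of_dist_le_mul fun s t => by
      rw [(hγ x).dist_eq s s.2 t t.2, Real.coe_toNNReal _ dist_nonneg, mul_comm]
      exact le_of_eq rfl
  refine ⟨⟨fun q => γ q.2 q.1, continuous_prod_of_continuous_lipschitzWith' _ 1 (fun t => ?_)
    fun x => (hlip x).continuous⟩, fun x => (hγ x).source, fun x => (hγ x).target, hlip⟩
  refine LipschitzWith.of_dist_le_mul fun x y => ?_
  have := h.convex _ _ _ _ _ _ (hγ x) (hγ y) (m x) (m y) t t.2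
  rw [dist_self, mul_zero, zero_add] at this
  rw [NNReal.coe_one, one_mul]
  exact this.trans (mul_le_of_le_one_left dist_nonneg t.2.2)

/-- The endpoint map of the space of local geodesics is a covering map. This is the form in which
the theorem of Cartan and Hadamard is used. -/
theorem isCoveringMap_ends [CompleteSpace Y] (hY : IsLocallyBusemann Y) :
    IsCoveringMap (ends (Y := Y)) := by
  have hiso := isBallIsometry_ends hY
  have := completeSpace hY
  refine hiso.isLocalHomeomorph.isCoveringMap_of_radial (T2Space.isSeparatedMap _) fun b => ?_
  obtain ⟨r₁, hr₁, hb₁⟩ := hY b.1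
  obtain ⟨r₂, hr₂, hb₂⟩ := hY b.2
  obtain ⟨γ₁, a₁, b₁, l₁⟩ := hb₁.exists_radial hr₁
  obtain ⟨γ₂, a₂, b₂, l₂⟩ := hb₂.exists_radial hr₂
  refine ⟨ball b.1 r₁ ×ˢ ball b.2 r₂, isOpen_ball.prod isOpen_ball,
    ⟨mem_ball_self hr₁, mem_ball_self hr₂⟩,
    ⟨fun q => (γ₁ (q.1, ⟨q.2.1.1, q.2.2.1⟩), γ₂ (q.1, ⟨q.2.1.2, q.2.2.2⟩)), by fun_prop⟩,
    fun x => Prod.ext (a₁ _) (a₂ _), fun x => Prod.ext (b₁ _) (b₂ _), fun x => ?_⟩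
  have hlip := (l₁ ⟨x.1.1, x.2.1⟩).prodMk (l₂ ⟨x.1.2, x.2.2⟩)
  constructor
  · intro e he
    exact hiso.exists_path_lift hlip (e := e) (by simp only [a₁, a₂]; exact he)
  · intro e he
    have hσ : LipschitzWith 1 σ := LipschitzWith.of_dist_le_mul fun s t => by
      rw [NNReal.coe_one, one_mul, Subtype.dist_eq, Subtype.dist_eq, Real.dist_eq, Real.dist_eq,
        coe_symm_eq, coe_symm_eq, sub_sub_sub_cancel_left, abs_sub_comm]
    obtain ⟨Γ, h0, h1⟩ := hiso.exists_path_lift (hlip.comp hσ) (e := e)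
      (by simp only [Function.comp, symm_zero, b₁, b₂]; exact he)
    refine ⟨Γ.comp ⟨σ, continuous_symm⟩, by simpa using h0, fun t => ?_⟩
    simpa using h1 (σ t)

end GeodesicSpace

end GeodesicSpace

/-! ### Local geodesics and homotopy classes of paths -/

section PathClasses

open Set Metric unitInterval

/-- The two ways around a square are homotopic. -/
theorem Path.Homotopic.of_square {Z : Type u} [TopologicalSpace Z] (H : C(I × I, Z)) {a b c d : Z}
    (left : Path a c) (top : Path c d) (bottom : Path a b) (right : Path b d)
    (hl : ∀ s, H (0, s) = left s) (ht : ∀ s, H (s, 1) = top s) (hb : ∀ s, H (s, 0) = bottom s)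
    (hr : ∀ s, H (1, s) = right s) : (left.trans top).Homotopic (bottom.trans right) := by
  obtain rfl : H (0, 0) = a := by rw [hl, left.source]
  obtain rfl : H (0, 1) = c := by rw [hl, left.target]
  obtain rfl : H (1, 0) = b := by rw [hb, bottom.target]
  obtain rfl : H (1, 1) = d := by rw [hr, right.target]
  let L : Path ((0 : I), (0 : I)) (0, 1) := (Path.refl 0).prod ⟨.id I, rfl, rfl⟩
  let T : Path ((0 : I), (1 : I)) (1, 1) := Path.prod ⟨.id I, rfl, rfl⟩ (Path.refl 1)
  let B : Path ((0 : I), (0 : I)) (1, 0) := Path.prod ⟨.id I, rfl, rfl⟩ (Path.refl 0)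
  let R : Path ((1 : I), (0 : I)) (1, 1) := (Path.refl 1).prod ⟨.id I, rfl, rfl⟩
  obtain rfl : left = L.map H.continuous := by ext s; exact (hl s).symm
  obtain rfl : top = T.map H.continuous := by ext s; exact (ht s).symm
  obtain rfl : bottom = B.map H.continuous := by ext s; exact (hb s).symm
  obtain rfl : right = R.map H.continuous := by ext s; exact (hr s).symm
  rw [← Path.map_trans, ← Path.map_trans]
  have : ContractibleSpace I := (convex_Icc (0 : ℝ) 1).contractibleSpace ⟨0, by simp⟩
  exact (SimplyConnectedSpace.paths_homotopic _ _).map H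

theorem Path.Homotopic.Quotient.symm_trans_cancel_left {Z : Type u} [TopologicalSpace Z]
    {a b c : Z} (κ : Path.Homotopic.Quotient a b) (μ : Path.Homotopic.Quotient b c) :
    κ.symm.trans (κ.trans μ) = μ := by
  rw [← trans_assoc, symm_trans, refl_trans]

theorem Path.Homotopic.Quotient.trans_symm_cancel_left {Z : Type u} [TopologicalSpace Z]
    {a b c : Z} (κ : Path.Homotopic.Quotient a b) (μ : Path.Homotopic.Quotient a c) :
    κ.trans (κ.symm.trans μ) = μ := by
  rw [← trans_assoc, trans_symm, refl_trans]

namespace GeodesicSpace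

variable {Y : Type u} [MetricSpace Y]

/-- The restriction of a local geodesic to `[0, s]`, reparametrized. -/
def shrink (s : I) (c : GeodesicSpace Y) : GeodesicSpace Y :=
  ⟨c.1.comp ⟨fun t => s * t, by fun_prop⟩, by
    refine IsLocalGeodesic.congr (c := fun t : ℝ => c.1 (projIcc 0 1 zero_le_one (s * t)))
      (fun t ht => ?_) fun t ht => ?_
    · have hs : ∀ t ∈ Icc (0 : ℝ) 1, (s : ℝ) * t ∈ Icc (0 : ℝ) 1 := fun t ht =>
        ⟨mul_nonneg s.2.1 ht.1, mul_le_one₀ s.2.2 ht.1 ht.2⟩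
      obtain ⟨δ, hδ, v, hv⟩ := c.2 _ (hs t ht)
      have hle : ∀ x : ℝ, |x| < δ → |(s : ℝ) * x| < δ := fun x hx => by
        rw [abs_mul, abs_of_nonneg s.2.1]
        exact (mul_le_of_le_one_left (abs_nonneg _) s.2.2).trans_lt hx
      refine ⟨δ, hδ, v * s, fun t₁ h₁ t₂ h₂ a₁ a₂ => ?_⟩
      have := hv _ (hs t₁ h₁) _ (hs t₂ h₂) (by rw [← mul_sub]; exact hle _ a₁)
        (by rw [← mul_sub]; exact hle _ a₂)
      simp only [this, ← mul_sub, abs_mul, abs_of_nonneg s.2.1, mul_assoc]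
    · have : s * projIcc 0 1 zero_le_one t = projIcc 0 1 zero_le_one ((s : ℝ) * t) := by
        rw [projIcc_of_mem zero_le_one ht, projIcc_of_mem zero_le_one
          ⟨mul_nonneg s.2.1 ht.1, mul_le_one₀ s.2.2 ht.1 ht.2⟩]
        rfl
      simp [this]⟩

@[simp] theorem shrink_apply (s : I) (c : GeodesicSpace Y) (t : I) :
    (shrink s c).1 t = c.1 (s * t) := rfl

theorem continuous_shrink : Continuous fun x : I × GeodesicSpace Y => shrink x.1 x.2 := by
  refine Continuous.subtype_mk (ContinuousMap.continuous_of_continuous_uncurry _ ?_) _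
  have : Continuous fun x : (I × GeodesicSpace Y) × I => x.1.2.1 (x.1.1 * x.2) := by fun_prop
  exact this

/-- The homotopy class of a local geodesic, as a class of paths between given points. -/
def cls (c : GeodesicSpace Y) {p q : Y} (hp : c.1 0 = p) (hq : c.1 1 = q) :
    Path.Homotopic.Quotient p q :=
  .mk ⟨c.1, hp, hq⟩

variable [CompleteSpace Y] (hY : IsLocallyBusemann Y)

/-- The local geodesic in a homotopy class of paths from `p` to `q`: it is obtained from the
constant geodesic at `p` by moving the second endpoint along a path of the class. -/
noncomputable def geo {p q : Y} (κ : Path.Homotopic.Quotient p q) : GeodesicSpace Y :=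
  ((isCoveringMap_ends hY).monodromy (Path.Homotopic.prod (.refl p) κ) ⟨const p, rfl⟩).1

theorem ends_geo {p q : Y} (κ : Path.Homotopic.Quotient p q) : ends (geo hY κ) = (p, q) :=
  ((isCoveringMap_ends hY).monodromy (Path.Homotopic.prod (.refl p) κ) ⟨const p, rfl⟩).2

@[simp] theorem geo_zero {p q : Y} (κ : Path.Homotopic.Quotient p q) : (geo hY κ).1 0 = p :=
  congrArg Prod.fst (ends_geo hY κ)

@[simp] theorem geo_one {p q : Y} (κ : Path.Homotopic.Quotient p q) : (geo hY κ).1 1 = q :=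
  congrArg Prod.snd (ends_geo hY κ)

/-- The geodesic representative of `α` is the end of any lift of `s ↦ (p, α s)` that starts at the
constant geodesic. -/
theorem geo_mk_eq {p q : Y} (α : Path p q) (Γ : C(I, GeodesicSpace Y)) (h0 : Γ 0 = const p)
    (h : ∀ s, ends (Γ s) = (p, α s)) : geo hY (.mk α) = Γ 1 := by
  have := ((isCoveringMap_ends hY).eq_liftPath_iff' (γ := ((Path.refl p).prod α).toContinuousMap)
    (e := const p) (Γ := Γ) (by simp; rfl)).2 ⟨funext h, h0⟩
  rw [this]
  rfl

/-- A local geodesic is the only one in its homotopy class. -/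
@[simp] theorem geo_cls (c : GeodesicSpace Y) {p q : Y} (hp : c.1 0 = p) (hq : c.1 1 = q) :
    geo hY (c.cls hp hq) = c := by
  subst hp hq
  refine (geo_mk_eq hY _ ⟨fun s => shrink s c,
    continuous_shrink.comp (Continuous.prodMk_left c)⟩ ?_ ?_).trans ?_
  · ext t; simp
  · intro s; simp [ends]
  · ext t; simp

/-- Continuous families of paths have continuous families of geodesic representatives. -/
theorem continuous_geo_mk {A : Type w} [TopologicalSpace A] {p q : A → Y}
    (α : ∀ a, Path (p a) (q a)) (hα : Continuous fun x : A × I => α x.1 x.2) :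
    Continuous fun a => geo hY (.mk (α a)) := by
  have cov := isCoveringMap_ends hY
  have hp : Continuous p := by
    have := hα.comp (Continuous.prodMk_left (0 : I))
    simpa [Function.comp_def] using this
  let H : C(I × A, Y × Y) := ⟨fun x => (p x.2, α x.2 x.1),
    (hp.comp continuous_snd).prodMk (hα.comp continuous_swap)⟩
  let f : C(A, GeodesicSpace Y) := ContinuousMap.mk (fun a => const (p a))
    (continuous_const.comp hp)
  have h0 : ∀ a, H (0, a) = ends (f a) := fun a => by simp [H, f, ends]
  have key : ∀ a, geo hY (.mk (α a)) = cov.liftHomotopy H f h0 (1, a) := fun a =>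
    geo_mk_eq hY (α a) ((cov.liftHomotopy H f h0).comp ⟨fun s => (s, a), Continuous.prodMk_left a⟩)
      (cov.liftHomotopy_zero H f h0 a)
      fun s => congrFun (cov.liftHomotopy_lifts H f h0) (s, a)
  simp only [key]
  exact (cov.liftHomotopy H f h0).continuous.comp (Continuous.prodMk_right (1 : I))

omit [CompleteSpace Y] in
/-- Moving the endpoints of a local geodesic along paths changes its class in the expected way. -/
theorem cls_trans_eq (Γ : C(I, GeodesicSpace Y)) {p p' q q' : Y} (α : Path p p') (β : Path q q')
    (h : ∀ s, ends (Γ s) = (α s, β s)) (h0 : (Γ 0).1 0 = p) (h1 : (Γ 0).1 1 = q)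
    (h0' : (Γ 1).1 0 = p') (h1' : (Γ 1).1 1 = q') :
    ((Γ 0).cls h0 h1).trans (.mk β) = (Path.Homotopic.Quotient.mk α).trans ((Γ 1).cls h0' h1') := by
  refine Path.Homotopic.Quotient.eq.2 (Path.Homotopic.of_square
    ⟨fun x => (Γ x.1).1 x.2, by fun_prop⟩ _ _ _ _ (fun _ => rfl) (fun s => ?_) (fun s => ?_)
    fun _ => rfl)
  · exact congrArg Prod.snd (h s)
  · exact congrArg Prod.fst (h s)

/-- The geodesic representative of a homotopy class belongs to this class. -/
@[simp] theorem cls_geo {p q : Y} (κ : Path.Homotopic.Quotient p q) (hp : (geo hY κ).1 0 = p)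
    (hq : (geo hY κ).1 1 = q) : (geo hY κ).cls hp hq = κ := by
  induction κ using Path.Homotopic.Quotient.ind with | mk α =>
  have cov := isCoveringMap_ends hY
  have h0 : ((Path.refl p).prod α).toContinuousMap 0 = ends (const p) := by simp; rfl
  set Γ := cov.liftPath ((Path.refl p).prod α).toContinuousMap (const p) h0 with hΓ
  have hl : ∀ s, ends (Γ s) = (p, α s) := fun s => congrFun (cov.liftPath_lifts _ _ h0) s
  have hz : Γ 0 = const p := cov.liftPath_zero _ _ h0
  have hgeo : geo hY (.mk α) = Γ 1 := rfl
  have := cls_trans_eq Γ (Path.refl p) α hl (by simp [hz]) (by simp [hz])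
    (by rw [← hgeo]; exact hp) (by rw [← hgeo]; exact hq)
  have hc : (Γ 0).cls (p := p) (q := p) (by simp [hz]) (by simp [hz]) = .refl p := by
    rw [← Path.Homotopic.Quotient.mk_refl, cls]
    congr 1
    ext t
    simp [hz]
  rw [hc, Path.Homotopic.Quotient.refl_trans, Path.Homotopic.Quotient.mk_refl,
    Path.Homotopic.Quotient.refl_trans] at this
  exact this.symm

theorem cls_of_eq_geo {p q : Y} {c : GeodesicSpace Y} {κ : Path.Homotopic.Quotient p q}
    (h : c = geo hY κ) (hp : c.1 0 = p) (hq : c.1 1 = q) : c.cls hp hq = κ := by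
  subst h
  exact cls_geo hY κ hp hq

theorem geo_injective {p q : Y} : Function.Injective (geo hY (p := p) (q := q)) := fun κ κ' h => by
  rw [← cls_geo hY κ (geo_zero hY κ) (geo_one hY κ),
    ← cls_geo hY κ' (geo_zero hY κ') (geo_one hY κ')]
  simp only [h]

@[simp] theorem geo_refl (p : Y) : geo hY (.refl p) = const p :=
  geo_cls hY (const p) rfl rfl

/-- The geodesic representative, as a path. -/
noncomputable def geoPath {p q : Y} (κ : Path.Homotopic.Quotient p q) : Path p q :=
  ⟨(geo hY κ).1, geo_zero hY κ, geo_one hY κ⟩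

@[simp] theorem mk_geoPath {p q : Y} (κ : Path.Homotopic.Quotient p q) : .mk (geoPath hY κ) = κ :=
  cls_geo hY κ (geo_zero hY κ) (geo_one hY κ)

/-- A family of homotopy classes of paths is continuous if the geodesic representatives are. -/
def ContinuousClasses {A : Type w} [TopologicalSpace A] {p q : A → Y}
    (κ : ∀ a, Path.Homotopic.Quotient (p a) (q a)) : Prop :=
  Continuous fun a => geo hY (κ a)

namespace ContinuousClasses

variable {hY} {A : Type w} [TopologicalSpace A] {p q r : A → Y}
  {κ : ∀ a, Path.Homotopic.Quotient (p a) (q a)} {μ : ∀ a, Path.Homotopic.Quotient (q a) (r a)}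

theorem continuous_geoPath (hκ : ContinuousClasses hY κ) :
    Continuous fun x : A × I => geoPath hY (κ x.1) x.2 := by
  have h : Continuous fun a => geo hY (κ a) := hκ
  have h' : Continuous fun x : A × I => ((geo hY (κ x.1)).1, x.2) :=
    (continuous_subtype_val.comp (h.comp continuous_fst)).prodMk continuous_snd
  exact continuous_eval.comp h'

theorem mk {α : ∀ a, Path (p a) (q a)} (hα : Continuous fun x : A × I => α x.1 x.2) :
    ContinuousClasses hY fun a => .mk (α a) :=
  continuous_geo_mk hY α hα

theorem trans (hκ : ContinuousClasses hY κ) (hμ : ContinuousClasses hY μ) :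
    ContinuousClasses hY fun a => (κ a).trans (μ a) := by
  have := mk (hY := hY) (α := fun a => (geoPath hY (κ a)).trans (geoPath hY (μ a)))
    (Path.trans_continuous_family (fun a => geoPath hY (κ a)) hκ.continuous_geoPath
      (fun a => geoPath hY (μ a)) hμ.continuous_geoPath)
  simpa using this

theorem symm (hκ : ContinuousClasses hY κ) : ContinuousClasses hY fun a => (κ a).symm := by
  have := mk (hY := hY) (α := fun a => (geoPath hY (κ a)).symm) (Path.symm_continuous_family
    (fun a => geoPath hY (κ a)) hκ.continuous_geoPath)
  simpa using this

theorem comp {B : Type v} [TopologicalSpace B] (hκ : ContinuousClasses hY κ) {f : B → A}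
    (hf : Continuous f) : ContinuousClasses hY fun b => κ (f b) :=
  Continuous.comp (f := f) hκ hf

/-- Continuous families of classes are natural with respect to paths in the parameter space. -/
theorem naturality (hκ : ContinuousClasses hY κ) {a b : A} (γ : Path a b) (hp : Continuous p)
    (hq : Continuous q) :
    (κ a).trans (.mk (γ.map hq)) = (Path.Homotopic.Quotient.mk (γ.map hp)).trans (κ b) := by
  have h : Continuous fun a => geo hY (κ a) := hκ
  have := cls_trans_eq (⟨fun s => geo hY (κ (γ s)), h.comp γ.continuous⟩ : C(I, GeodesicSpace Y))
    (γ.map hp) (γ.map hq) (fun s => by simp [ends_geo]) (by simp) (by simp) (by simp) (by simp)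
  have e0 : (geo hY (κ (γ 0))) = geo hY (κ a) := congrArg (fun a => geo hY (κ a)) γ.source
  have e1 : (geo hY (κ (γ 1))) = geo hY (κ b) := congrArg (fun a => geo hY (κ a)) γ.target
  simp only [ContinuousMap.coe_mk] at this
  rwa [cls_of_eq_geo hY e0, cls_of_eq_geo hY e1] at this

/-- A continuous family of classes over a connected space is determined by one of its members. -/
theorem eq_of_eq [PreconnectedSpace A] {κ' : ∀ a, Path.Homotopic.Quotient (p a) (q a)}
    (hκ : ContinuousClasses hY κ) (hκ' : ContinuousClasses hY κ') {a : A} (h : κ a = κ' a) :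
    κ = κ' := by
  have := (isCoveringMap_ends hY).eq_of_comp_eq (A := A) hκ hκ'
    (funext fun a => by simp [ends_geo]) a (by rw [h])
  exact funext fun a => geo_injective hY (congrFun this a)

theorem of_geo_eq {E : A → GeodesicSpace Y} (hE : Continuous E) (h : ∀ a, geo hY (κ a) = E a) :
    ContinuousClasses hY κ := by
  unfold ContinuousClasses
  simpa only [h] using hE

theorem cls {E : A → GeodesicSpace Y} (hE : Continuous E) (hp : ∀ a, (E a).1 0 = p a)
    (hq : ∀ a, (E a).1 1 = q a) : ContinuousClasses hY fun a => (E a).cls (hp a) (hq a) :=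
  of_geo_eq hE fun _ => geo_cls hY _ _ _

/-- The lifting criterion for the covering by local geodesics: a class of paths from `p a₀` to
`q a₀` extends to a continuous family if it intertwines the actions of `p` and `q` on loops. -/
theorem exists_of_intertwine [PathConnectedSpace A] [LocallyPathConnectedSpace A]
    (hp : Continuous p) (hq : Continuous q) {a₀ : A} (κ₀ : Path.Homotopic.Quotient (p a₀) (q a₀))
    (h : ∀ γ : Path a₀ a₀, κ₀.trans (.mk (γ.map hq)) =
      (Path.Homotopic.Quotient.mk (γ.map hp)).trans κ₀) :
    ∃ κ : ∀ a, Path.Homotopic.Quotient (p a) (q a), ContinuousClasses hY κ ∧ κ a₀ = κ₀ := by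
  have cov := isCoveringMap_ends hY
  have he : ends (geo hY κ₀) = (p a₀, q a₀) := ends_geo hY κ₀
  -- the endpoint of a lifted path represents the class obtained by moving both ends of `κ₀`
  have key : ∀ (a : A) (γ : Path a₀ a) (Γ : C(I, GeodesicSpace Y)), Γ 0 = geo hY κ₀ →
      (∀ s, ends (Γ s) = (p (γ s), q (γ s))) → Γ 1 = geo hY
        ((Path.Homotopic.Quotient.mk (γ.map hp)).symm.trans (κ₀.trans (.mk (γ.map hq)))) := by
    intro a γ Γ hΓ hl
    have e0 : (Γ 1).1 0 = p a := (congrArg Prod.fst (hl 1)).trans (congrArg p γ.target)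
    have e1 : (Γ 1).1 1 = q a := (congrArg Prod.snd (hl 1)).trans (congrArg q γ.target)
    have := cls_trans_eq Γ (γ.map hp) (γ.map hq) hl (by rw [hΓ]; simp) (by rw [hΓ]; simp)
      e0 e1
    rw [cls_of_eq_geo hY hΓ] at this
    rw [this, ← Path.Homotopic.Quotient.trans_assoc, Path.Homotopic.Quotient.symm_trans,
      Path.Homotopic.Quotient.refl_trans, geo_cls]
  let f : C(A, Y × Y) := ⟨fun a => (p a, q a), by fun_prop⟩
  obtain ⟨F, ⟨hF0, hF⟩, -⟩ : ∃! F : C(A, GeodesicSpace Y), F a₀ = geo hY κ₀ ∧ ends ∘ F = f := by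
    refine cov.isLocalHomeomorph.existsUnique_continuousMap_lifts f a₀ (geo hY κ₀) he ?_ ?_
    · intro γ hγ
      obtain ⟨Γ, h1, h2⟩ := cov.exists_path_lifts
        (f.comp γ) (geo hY κ₀)
        (by simp [hγ, he, f])
      exact ⟨Γ, h2, h1⟩
    · intro γ γ' Γ Γ' hγ hγ' hΓ hΓ' hl hl' h1
      rw [key _ ⟨γ, hγ, rfl⟩ Γ hΓ fun s => congrFun hl s,
        key (γ 1) ⟨γ', hγ', h1.symm⟩ Γ' hΓ' fun s => congrFun hl' s]
      congr 1
      set δ : Path a₀ (γ 1) := ⟨γ, hγ, rfl⟩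
      set δ' : Path a₀ (γ 1) := ⟨γ', hγ', h1.symm⟩
      have := h (δ'.trans δ.symm)
      rw [Path.map_trans, Path.map_trans, Path.Homotopic.Quotient.mk_trans,
        Path.Homotopic.Quotient.mk_trans, ← Path.map_symm, ← Path.map_symm,
        Path.Homotopic.Quotient.mk_symm, Path.Homotopic.Quotient.mk_symm] at this
      have h3 := congrArg (fun c => (Path.Homotopic.Quotient.mk (δ'.map hp)).symm.trans
        (c.trans (.mk (δ.map hq)))) this
      simp only [Path.Homotopic.Quotient.trans_assoc, Path.Homotopic.Quotient.symm_trans,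
        Path.Homotopic.Quotient.trans_refl] at h3
      rw [Path.Homotopic.Quotient.symm_trans_cancel_left] at h3
      exact h3.symm
  have hF' : ∀ a, ends (F a) = (p a, q a) := fun a => congrFun hF a
  refine ⟨fun a => (F a).cls (congrArg Prod.fst (hF' a)) (congrArg Prod.snd (hF' a)),
    cls F.continuous _ _, cls_of_eq_geo hY hF0 _ _⟩

end ContinuousClasses

section Interpolation

open scoped Classical in
/-- For two local geodesics `d` and `e` with the same source, the local geodesic which is homotopic
to `d` followed by the part over `[0, t]` of the geodesic from the target of `d` to the target of
`e` in the class of `d⁻¹ e`. -/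
noncomputable def interpolate (t : I) (d e : GeodesicSpace Y) : GeodesicSpace Y :=
  if h : d.1 0 = e.1 0 then
    geo hY ((d.cls rfl rfl).trans
      ((shrink t (geo hY ((d.cls rfl rfl).symm.trans (e.cls h.symm rfl)))).cls
        (by simp) rfl))
  else d

theorem geo_trans_cls {p q z : Y} (κ : Path.Homotopic.Quotient p q) {c : GeodesicSpace Y}
    (h0 : c.1 0 = q) (h1 : c.1 1 = z) :
    geo hY (κ.trans (c.cls h0 rfl)) = geo hY (κ.trans (c.cls h0 h1)) := by
  subst h1
  rfl

theorem interpolate_geo {p q r : Y} (t : I) (κ : Path.Homotopic.Quotient p q)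
    (μ : Path.Homotopic.Quotient p r) : interpolate hY t (geo hY κ) (geo hY μ) =
      geo hY (κ.trans ((shrink t (geo hY (κ.symm.trans μ))).cls
        (q := (geo hY (κ.symm.trans μ)).1 t) (by simp) (by simp))) := by
  have key : ∀ d e : GeodesicSpace Y, ∀ (h1 : d.1 0 = p) (h2 : d.1 1 = q) (h3 : e.1 0 = p)
      (h4 : e.1 1 = r), interpolate hY t d e = geo hY ((d.cls h1 h2).trans
        ((shrink t (geo hY ((d.cls h1 h2).symm.trans (e.cls h3 h4)))).cls (by simp) rfl)) := by
    intro d e h1 h2 h3 h4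
    subst h1 h2 h4
    rw [interpolate, dif_pos h3.symm]
  rw [key _ _ (geo_zero hY κ) (geo_one hY κ) (geo_zero hY μ) (geo_one hY μ),
    geo_trans_cls hY _ _ (z := (geo hY (κ.symm.trans μ)).1 t) (by simp)]
  simp only [cls_geo]

theorem interpolate_apply_zero (t : I) (d e : GeodesicSpace Y) :
    (interpolate hY t d e).1 0 = d.1 0 := by
  unfold interpolate
  split_ifs with h
  · simp
  · rfl

theorem interpolate_geo_apply_one {p q r : Y} (t : I) (κ : Path.Homotopic.Quotient p q)
    (μ : Path.Homotopic.Quotient p r) :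
    (interpolate hY t (geo hY κ) (geo hY μ)).1 1 = (geo hY (κ.symm.trans μ)).1 t := by
  rw [interpolate_geo]
  simp

omit [CompleteSpace Y] in
@[simp] theorem shrink_one (c : GeodesicSpace Y) : shrink 1 c = c := by
  ext t
  simp

omit [CompleteSpace Y] in
theorem shrink_zero (c : GeodesicSpace Y) : shrink 0 c = const (c.1 0) := by
  ext t
  simp

theorem interpolate_zero (d e : GeodesicSpace Y) : interpolate hY 0 d e = d := by
  unfold interpolate
  split_ifs with h
  · rw [geo_trans_cls hY _ _ (z := d.1 1) (by simp), cls_of_eq_geo hY (κ := .refl (d.1 1))]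
    · simp
    · rw [shrink_zero]
      simp
  · rfl

theorem interpolate_one {d e : GeodesicSpace Y} (h : d.1 0 = e.1 0) :
    interpolate hY 1 d e = e := by
  rw [interpolate, dif_pos h, geo_trans_cls hY _ _ (z := e.1 1) (by simp),
    cls_of_eq_geo hY (shrink_one _), ← Path.Homotopic.Quotient.trans_assoc,
    Path.Homotopic.Quotient.trans_symm, Path.Homotopic.Quotient.refl_trans, geo_cls]

theorem continuous_interpolate {A : Type w} [TopologicalSpace A] {t : A → I}
    {d e : A → GeodesicSpace Y} (ht : Continuous t) (hd : Continuous d) (he : Continuous e)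
    (h : ∀ a, (d a).1 0 = (e a).1 0) : Continuous fun a => interpolate hY (t a) (d a) (e a) := by
  have h1 : ContinuousClasses hY fun a => (d a).cls rfl rfl := .cls hd _ _
  have h2 : ContinuousClasses hY fun a => (e a).cls (h a).symm rfl := .cls he _ _
  have h3 : Continuous fun a => geo hY (((d a).cls rfl rfl).symm.trans
    ((e a).cls (h a).symm rfl)) := h1.symm.trans h2
  have h4 : ContinuousClasses hY fun a => (shrink (t a) (geo hY (((d a).cls rfl rfl).symm.trans
    ((e a).cls (h a).symm rfl)))).cls (p := (d a).1 1) (by simp) rfl :=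
    .cls (continuous_shrink.comp (ht.prodMk h3)) _ _
  exact Continuous.congr (h1.trans h4) fun a => by rw [interpolate, dif_pos (h a)]

end Interpolation

end GeodesicSpace

end PathClasses

/-! ### Length spaces -/

section LengthSpace

open Set Metric unitInterval Filter

variable {X : Type u} [MetricSpace X]

theorem IsLengthSpace.pathConnectedSpace (hX : IsLengthSpace X) [Nonempty X] :
    PathConnectedSpace X :=
  ⟨‹_›, fun x y => (hX x y (dist x y + 1) (by linarith)).elim fun γ _ => ⟨γ⟩⟩

theorem IsLengthSpace.joinedIn_ball (hX : IsLengthSpace X) {x y : X} {r : ℝ} (hy : y ∈ ball x r) :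
    JoinedIn (ball x r) x y := by
  obtain ⟨γ, hγ⟩ := hX x y r (by rwa [dist_comm])
  refine ⟨γ, fun t => ?_⟩
  have := (eVariationOn.edist_le (fun t => γ t) (mem_univ t) (mem_univ 0)).trans_lt hγ
  rw [edist_lt_ofReal] at this
  simpa using this

theorem IsLengthSpace.locallyPathConnectedSpace (hX : IsLengthSpace X) :
    LocallyPathConnectedSpace X := by
  refine .of_bases (fun x => nhds_basis_ball) fun x r hr => ⟨x, mem_ball_self hr, fun {y} hy => ?_⟩
  exact hX.joinedIn_ball hy

/-- In a length space, maps which are locally Lipschitz with constant `K` are Lipschitz with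
constant `K`. -/
theorem IsLengthSpace.lipschitzWith {Y : Type v} [MetricSpace Y] (hX : IsLengthSpace X) {K : ℝ≥0}
    {f : X → Y} (hf : ∀ x, ∃ U ∈ 𝓝 x, LipschitzOnWith K f U) : LipschitzWith K f := by
  have key : ∀ {x y : X} (γ : Path x y),
      edist (f x) (f y) ≤ K * eVariationOn (fun t => γ t) univ := by
    intro x y γ
    choose U hU hf using hf
    obtain ⟨t, h0, hmono, ⟨n, hn⟩, ht⟩ := exists_monotone_Icc_subset_open_cover_unitInterval
      (c := fun x => γ ⁻¹' interior (U x)) (fun x => isOpen_interior.preimage γ.continuous)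
      fun s _ => mem_iUnion.2 ⟨γ s, mem_interior_iff_mem_nhds.2 (hU _)⟩
    have ind : ∀ m, edist (f (γ 0)) (f (γ (t m))) ≤
        K * eVariationOn (fun t => γ t) (Icc 0 (t m)) := by
      intro m
      induction m with
      | zero => simp [h0]
      | succ m ih =>
        have h1 := hmono m.le_succ
        obtain ⟨i, hi⟩ := ht m
        have h2 : edist (f (γ (t m))) (f (γ (t (m + 1)))) ≤ K * edist (γ (t m)) (γ (t (m + 1))) :=
          hf i (interior_subset (hi ⟨le_rfl, h1⟩)) (interior_subset (hi ⟨h1, le_rfl⟩))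
        have h3 : edist (γ (t m)) (γ (t (m + 1))) ≤
            eVariationOn (fun t => γ t) (Icc (t m) (t (m + 1))) :=
          eVariationOn.edist_le (fun t => γ t) (s := Icc (t m) (t (m + 1))) ⟨le_rfl, h1⟩ ⟨h1, le_rfl⟩
        have h4 := eVariationOn.Icc_add_Icc (fun t => γ t) (s := univ) (a := 0) (b := t m)
          (c := t (m + 1)) (t m).2.1 h1 (mem_univ _)
        simp only [univ_inter] at h4
        rw [← h4, mul_add]
        exact (edist_triangle _ _ _).trans (add_le_add ih (h2.trans (by gcongr)))
    have := ind n
    rw [hn n le_rfl, γ.source, γ.target] at this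
    exact this.trans (by gcongr; exact eVariationOn.mono _ (subset_univ _))
  refine LipschitzWith.of_dist_le_mul fun x y => le_of_forall_pos_le_add fun ε hε => ?_
  have hpos : 0 < ε / (K + 1) := by positivity
  obtain ⟨γ, hγ⟩ := hX x y (dist x y + ε / (K + 1)) (by linarith)
  have h1 : edist (f x) (f y) ≤ ENNReal.ofReal (K * (dist x y + ε / (K + 1))) := by
    rw [ENNReal.ofReal_mul K.coe_nonneg, ENNReal.ofReal_coe_nnreal]
    exact (key γ).trans (by gcongr)
  rw [edist_dist, ENNReal.ofReal_le_ofReal_iff (by positivity)] at h1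
  have h2 : (K : ℝ) * (ε / (K + 1)) ≤ ε := by
    rw [mul_div_assoc', div_le_iff₀ (by positivity)]
    nlinarith [K.coe_nonneg]
  linarith

end LengthSpace

/-! ### Geodesic homotopies -/

section GeodesicHomotopy

open Set Metric unitInterval Filter GeodesicSpace

variable {X : Type u} {Y : Type v} [MetricSpace X] [MetricSpace Y]

/-- Geodesic homotopies do not increase Lipschitz constants. -/
theorem GeodesicSpace.ContinuousClasses.lipschitzWith [CompleteSpace Y] {hY : IsLocallyBusemann Y}
    (hX : IsLengthSpace X) {K : ℝ≥0} {p q : X → Y} {κ : ∀ x, Path.Homotopic.Quotient (p x) (q x)}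
    (hκ : ContinuousClasses hY κ) (hp : LipschitzWith K p) (hq : LipschitzWith K q) (t : I) :
    LipschitzWith K fun x => (geo hY (κ x)).1 t := by
  refine hX.lipschitzWith fun x => ?_
  obtain ⟨ε, hε, h⟩ := exists_radius hY (geo hY (κ x))
  refine ⟨_, (show Continuous fun x => geo hY (κ x) from hκ).continuousAt.preimage_mem_nhds
    (ball_mem_nhds _ hε), LipschitzOnWith.of_dist_le_mul fun y hy z hz => ?_⟩
  refine (dist_apply_le_of_mem_ball h hy hz t).trans ?_
  simp only [geo_zero, geo_one]
  have h1 := mul_le_mul_of_nonneg_left (hp.dist_le_mul y z) (sub_nonneg.2 t.2.2)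
  have h2 := mul_le_mul_of_nonneg_left (hq.dist_le_mul y z) t.2.1
  linarith

/-- Families of maps that are uniformly Lipschitz are continuous if they are continuous
pointwise. -/
theorem ContinuousMap.continuous_of_lipschitzWith {A : Type w} [TopologicalSpace A] {K : ℝ≥0}
    {F : A → C(X, Y)} (hF : ∀ a, LipschitzWith K (F a)) (hc : ∀ x, Continuous fun a => F a x) :
    Continuous F :=
  ContinuousMap.continuous_of_continuous_uncurry _
    (continuous_prod_of_continuous_lipschitzWith' (fun q : A × X => F q.1 q.2) K hF hc)

/-- Sequentially parametrized continuous families in the compact-open topology are jointly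
continuous, although `X` need not be locally compact. -/
theorem ContinuousMap.continuous_uncurry_of_sequential {A : Type w} [TopologicalSpace A]
    [SequentialSpace (A × X)] {F : A → C(X, Y)} (hF : Continuous F) :
    Continuous fun q : A × X => F q.1 q.2 := by
  refine SeqContinuous.continuous fun u l hu => ?_
  have h1 : Tendsto (fun n => (u n).1) atTop (𝓝 l.1) := (continuous_fst.tendsto l).comp hu
  have h2 : Tendsto (fun n => (u n).2) atTop (𝓝 l.2) := (continuous_snd.tendsto l).comp hu
  have h3 := ContinuousMap.tendsto_iff_forall_isCompact_tendstoUniformlyOn.1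
    ((hF.tendsto l.1).comp h1) _ h2.isCompact_insert_range
  refine Metric.tendsto_atTop.2 fun ε hε => ?_
  have h4 := Metric.tendstoUniformlyOn_iff.1 h3 (ε / 2) (by positivity)
  have h5 := Metric.tendsto_nhds.1 (((F l.1).continuous.tendsto l.2).comp h2) (ε / 2) (by positivity)
  obtain ⟨N, hN⟩ := eventually_atTop.1 (h4.and h5)
  refine ⟨N, fun n hn => ?_⟩
  have h6 := (hN n hn).1 ((u n).2) (mem_insert_of_mem _ (mem_range_self n))
  have h7 := (hN n hn).2
  simp only [Function.comp] at h6 h7 ⊢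
  rw [dist_comm] at h6
  exact (dist_triangle _ _ _).trans_lt (by linarith)

end GeodesicHomotopy

/-! ### Families of Lipschitz maps and geodesic homotopies between them -/

section GeodesicallyConnected

open Set Metric unitInterval Filter GeodesicSpace

variable {X : Type u} {Y : Type v} [MetricSpace X] [MetricSpace Y]

theorem LipSpace.exists_lipschitzWith_common (f g : LipSpace X Y) :
    ∃ K : ℝ≥0, LipschitzWith K f.1 ∧ LipschitzWith K g.1 := by
  obtain ⟨K, hK⟩ := f.2
  obtain ⟨K', hK'⟩ := g.2
  exact ⟨max K K', hK.weaken (le_max_left _ _), hK'.weaken (le_max_right _ _)⟩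

theorem LipSpace.ext_apply {f g : LipSpace X Y} (h : ∀ x, f.1 x = g.1 x) : f = g :=
  Subtype.ext (ContinuousMap.ext h)

/-- Evaluation at a point, as a map on a set of Lipschitz maps. -/
def LipSpace.eval (S : Set (LipSpace X Y)) (x : X) : C(S, Y) :=
  ⟨fun f => f.1.1 x, by fun_prop⟩

theorem LipSpace.continuous_uncurry {P : Type w} [TopologicalSpace P] [SequentialSpace (P × X)]
    {F : P → LipSpace X Y} (hF : Continuous F) : Continuous fun z : P × X => (F z.1).1 z.2 :=
  ContinuousMap.continuous_uncurry_of_sequential (continuous_subtype_val.comp hF)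

variable [CompleteSpace Y] {hY : IsLocallyBusemann Y}

/-- The intermediate maps of the geodesic homotopy given by a continuous family of classes of
paths from `f x` to `g x`. -/
noncomputable def geodesicMap (hX : IsLengthSpace X) {f g : LipSpace X Y}
    {κ : ∀ x, Path.Homotopic.Quotient (f.1 x) (g.1 x)} (hκ : ContinuousClasses hY κ) (t : I) :
    LipSpace X Y :=
  ⟨⟨fun x => (geo hY (κ x)).1 t,
    (show Continuous fun c : GeodesicSpace Y => c.1 t by fun_prop).comp hκ⟩, by
    obtain ⟨K, hf, hg⟩ := LipSpace.exists_lipschitzWith_common f g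
    exact ⟨K, hκ.lipschitzWith hX hf hg t⟩⟩

@[simp] theorem geodesicMap_apply (hX : IsLengthSpace X) {f g : LipSpace X Y}
    {κ : ∀ x, Path.Homotopic.Quotient (f.1 x) (g.1 x)} (hκ : ContinuousClasses hY κ) (t : I)
    (x : X) : (geodesicMap hX hκ t).1 x = (geo hY (κ x)).1 t := rfl

/-- A continuous family of classes of loops over a connected space is trivial if one of its members
is. -/
theorem GeodesicSpace.ContinuousClasses.geo_eq_const {A : Type w} [TopologicalSpace A]
    [PreconnectedSpace A] {p q : A → Y} {κ : ∀ a, Path.Homotopic.Quotient (p a) (q a)}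
    (hκ : ContinuousClasses hY κ) (hp : Continuous p) (hpq : ∀ a, q a = p a) {a : A}
    (ha : geo hY (κ a) = const (p a)) (b : A) : geo hY (κ b) = const (p b) :=
  congrFun ((isCoveringMap_ends hY).eq_of_comp_eq (A := A) hκ (continuous_const.comp hp)
    (funext fun a => by simp [hpq a, ends]) a ha) b

/-- A family of classes over a product is continuous in the second variable. -/
theorem GeodesicSpace.ContinuousClasses.slice {P : Type w} [TopologicalSpace P]
    {F G : P → LipSpace X Y}
    {κ : ∀ z : P × X, Path.Homotopic.Quotient ((F z.1).1 z.2) ((G z.1).1 z.2)}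
    (hκ : ContinuousClasses hY κ) (p : P) : ContinuousClasses hY fun x => κ (p, x) :=
  hκ.comp (f := fun x => (p, x)) (Continuous.prodMk_right p)

theorem continuous_geodesicMap (hX : IsLengthSpace X) {P : Type w} [TopologicalSpace P]
    {F G : P → LipSpace X Y}
    {κ : ∀ z : P × X, Path.Homotopic.Quotient ((F z.1).1 z.2) ((G z.1).1 z.2)}
    (hκ : ContinuousClasses hY κ) :
    Continuous fun z : I × P => geodesicMap hX (f := F z.2) (g := G z.2)
      (κ := fun x => κ (z.2, x)) (hκ.slice z.2) z.1 := by
  refine Continuous.subtype_mk (ContinuousMap.continuous_of_continuous_uncurry _ ?_) _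
  have h1 := hκ.continuous_geoPath.comp
    (show Continuous fun z : (I × P) × X => ((z.1.2, z.2), z.1.1) by fun_prop)
  exact h1

/-- The geodesic homotopy, as a path of Lipschitz maps. -/
noncomputable def geodesicMapPath (hX : IsLengthSpace X) {f g : LipSpace X Y}
    {κ : ∀ x, Path.Homotopic.Quotient (f.1 x) (g.1 x)} (hκ : ContinuousClasses hY κ) :
    Path f g where
  toFun t := geodesicMap hX hκ t
  continuous_toFun := by
    have := continuous_geodesicMap (hY := hY) hX (P := Unit) (F := fun _ => f) (G := fun _ => g)
      (κ := fun z => κ z.2) (hκ.comp continuous_snd)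
    exact this.comp (Continuous.prodMk_left ())
  source' := LipSpace.ext_apply fun x => by simp
  target' := LipSpace.ext_apply fun x => by simp

/-- The tracks of the points along a path of maps. -/
def LipSpace.track {f g : LipSpace X Y} (γ : Path f g) (x : X) : Path (f.1 x) (g.1 x) :=
  γ.map (f := fun h : LipSpace X Y => h.1 x) (by fun_prop)

theorem LipSpace.continuousClasses_track {f g : LipSpace X Y} (γ : Path f g) :
    ContinuousClasses hY fun x => .mk (LipSpace.track γ x) :=
  .mk ((LipSpace.continuous_uncurry γ.continuous).comp continuous_swap)

variable (hY) in
/-- A set of Lipschitz maps is geodesically convex if it contains all geodesic homotopies between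
its members. -/
def IsGeodesicallyConvex (S : Set (LipSpace X Y)) : Prop :=
  ∀ f ∈ S, ∀ g ∈ S, ∀ (κ : ∀ x, Path.Homotopic.Quotient (f.1 x) (g.1 x)),
    ContinuousClasses hY κ → ∀ (t : I) (h : LipSpace X Y),
      (∀ x, h.1 x = (geo hY (κ x)).1 t) → h ∈ S

variable (hY) in
/-- Sets of Lipschitz maps which are geodesically convex, and in which any two maps are
homotopic. Such sets turn out to be Eilenberg-MacLane spaces. -/
structure IsGeodesicallyConnected (S : Set (LipSpace X Y)) : Prop where
  exists_classes : ∀ f ∈ S, ∀ g ∈ S, ∃ κ : ∀ x, Path.Homotopic.Quotient (f.1 x) (g.1 x),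
    ContinuousClasses hY κ
  mem : IsGeodesicallyConvex hY S

theorem isGeodesicallyConnected_pathComponent (hX : IsLengthSpace X) (f : LipSpace X Y) :
    IsGeodesicallyConnected hY (pathComponent f) where
  exists_classes g hg h hh := by
    obtain ⟨γ⟩ : Joined g h := (Joined.symm hg).trans hh
    exact ⟨_, LipSpace.continuousClasses_track γ⟩
  mem g hg h hh κ hκ t k hk := by
    have : k = geodesicMapPath hX hκ t := LipSpace.ext_apply hk
    rw [this]
    exact Joined.trans hg ⟨((geodesicMapPath hX hκ).truncateOfLE t.2.1).cast (by simp) (by simp)⟩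

omit [CompleteSpace Y] in
theorem lipConst_nonneg (f : LipSpace X Y) : 0 ≤ lipConst f := NNReal.coe_nonneg _

theorem isGeodesicallyConnected_lipComponent (hX : IsLengthSpace X) (f : LipSpace X Y) (L : ℝ) :
    IsGeodesicallyConnected hY (lipComponent f L) where
  exists_classes g hg h hh :=
    (isGeodesicallyConnected_pathComponent hX f).exists_classes g hg.1 h hh.1
  mem g hg h hh κ hκ t k hk := by
    refine ⟨(isGeodesicallyConnected_pathComponent hX f).mem g hg.1 h hh.1 κ hκ t k hk, ?_⟩
    lift L to ℝ≥0 using (lipConst_nonneg g).trans hg.2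
    have hg' := (lipConst_le_iff _ _).1 hg.2
    have hh' := (lipConst_le_iff _ _).1 hh.2
    refine (lipConst_le_iff _ _).2 ?_
    have : (k.1 : X → Y) = fun x => (geo hY (κ x)).1 t := funext hk
    rw [this]
    exact hκ.lipschitzWith hX hg' hh' t

namespace IsGeodesicallyConnected

variable {S : Set (LipSpace X Y)}

/-- The geodesic homotopy between two families, which is stationary where the given classes of
paths are trivial. -/
theorem homotopicRel (hS : IsGeodesicallyConnected hY S) (hX : IsLengthSpace X) {P : Type w}
    [TopologicalSpace P] (F G : C(P, S))
    {κ : ∀ z : P × X, Path.Homotopic.Quotient ((F z.1).1.1 z.2) ((G z.1).1.1 z.2)}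
    (hκ : ContinuousClasses hY κ) {C : Set P}
    (hC : ∀ p ∈ C, ∀ x, geo hY (κ (p, x)) = const ((F p).1.1 x)) : F.HomotopicRel G C := by
  have hκ' : ContinuousClasses (p := fun z : P × X => ((fun p => (F p).1) z.1).1 z.2)
    (q := fun z : P × X => ((fun p => (G p).1) z.1).1 z.2) hY κ := hκ
  have hs : ∀ p, ContinuousClasses (p := (F p).1.1) (q := (G p).1.1) hY fun x => κ (p, x) :=
    fun p => hκ.comp (f := fun x => (p, x)) (Continuous.prodMk_right p)
  have cont := continuous_geodesicMap (F := fun p => (F p).1) (G := fun p => (G p).1) hX hκ'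
  refine ⟨⟨⟨⟨fun z => ⟨geodesicMap hX (f := (F z.2).1) (g := (G z.2).1)
    (κ := fun x => κ (z.2, x)) (hs z.2) z.1,
    hS.mem _ (F z.2).2 _ (G z.2).2 (fun x => κ (z.2, x)) (hs z.2) z.1 _ fun x => rfl⟩,
    cont.subtype_mk _⟩, fun p => ?_, fun p => ?_⟩, fun t p hp => ?_⟩⟩
  · exact Subtype.ext (LipSpace.ext_apply fun x => geo_zero hY _)
  · exact Subtype.ext (LipSpace.ext_apply fun x => geo_one hY _)
  · refine Subtype.ext (LipSpace.ext_apply fun x => ?_)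
    exact congrArg (fun c : GeodesicSpace Y => c.1 t) (hC p hp x)

/-- Over a parameter space which contracts to a point `p₀`, classes of paths that are given over
`p₀` extend to continuous families. -/
theorem exists_extension {P : Type w} [MetricSpace P] (F G : C(P, S)) (p₀ : P)
    (line : C(I × P, P)) (h0 : ∀ p, line (0, p) = p₀) (h1 : ∀ p, line (1, p) = p)
    (h2 : ∀ s, line (s, p₀) = p₀)
    {κ₀ : ∀ x, Path.Homotopic.Quotient ((F p₀).1.1 x) ((G p₀).1.1 x)}
    (hκ₀ : ContinuousClasses hY κ₀) :
    ∃ κ : ∀ z : P × X, Path.Homotopic.Quotient ((F z.1).1.1 z.2) ((G z.1).1.1 z.2),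
      ContinuousClasses hY κ ∧ ∀ x, κ (p₀, x) = κ₀ x := by
  have hF := LipSpace.continuous_uncurry (continuous_subtype_val.comp F.continuous)
  have hG := LipSpace.continuous_uncurry (continuous_subtype_val.comp G.continuous)
  have cont' : Continuous fun z : (P × X) × I => (line (z.2, z.1.1), z.1.2) := by fun_prop
  let α : ∀ z : P × X, Path ((F p₀).1.1 z.2) ((F z.1).1.1 z.2) := fun z =>
    ⟨⟨fun s => (F (line (s, z.1))).1.1 z.2, hF.comp (f := fun s => (line (s, z.1), z.2))
      (by fun_prop)⟩, by simp [h0], by simp [h1]⟩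
  let β : ∀ z : P × X, Path ((G p₀).1.1 z.2) ((G z.1).1.1 z.2) := fun z =>
    ⟨⟨fun s => (G (line (s, z.1))).1.1 z.2, hG.comp (f := fun s => (line (s, z.1), z.2))
      (by fun_prop)⟩, by simp [h0], by simp [h1]⟩
  have hα : ContinuousClasses hY fun z => .mk (α z) := .mk (hF.comp cont')
  have hβ : ContinuousClasses hY fun z => .mk (β z) := .mk (hG.comp cont')
  refine ⟨fun z => (Path.Homotopic.Quotient.mk (α z)).symm.trans ((κ₀ z.2).trans (.mk (β z))),
    hα.symm.trans ((hκ₀.comp continuous_snd).trans hβ), fun x => ?_⟩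
  have h3 : α (p₀, x) = Path.refl _ := by ext s; simp [α, h2]
  have h4 : β (p₀, x) = Path.refl _ := by ext s; simp [β, h2]
  dsimp only
  rw [h3, h4]
  rw [Path.Homotopic.Quotient.mk_refl, Path.Homotopic.Quotient.mk_refl,
    Path.Homotopic.Quotient.trans_refl, ← Path.Homotopic.Quotient.mk_refl,
    ← Path.Homotopic.Quotient.mk_symm, Path.refl_symm]
  exact Path.Homotopic.Quotient.refl_trans _

theorem pathConnectedSpace (hS : IsGeodesicallyConnected hY S) (hX : IsLengthSpace X)
    (hne : S.Nonempty) : PathConnectedSpace S := by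
  refine ⟨hne.to_subtype, fun f g => ?_⟩
  obtain ⟨κ, hκ⟩ := hS.exists_classes f f.2 g g.2
  exact ⟨⟨⟨fun t => ⟨geodesicMapPath hX hκ t, hS.mem f f.2 g g.2 κ hκ t _ fun x => rfl⟩,
    (geodesicMapPath hX hκ).continuous.subtype_mk _⟩, Subtype.ext (Path.source _),
    Subtype.ext (Path.target _)⟩⟩

/-- Evaluation at a point is injective on the fundamental group of `S`: loops in `S` with the same
class are joined by the geodesic homotopy. -/
theorem injective_map_eval (hS : IsGeodesicallyConnected hY S) (hX : IsLengthSpace X) (a : S)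
    (x : X) : Function.Injective (FundamentalGroup.map (LipSpace.eval S x) a) := by
  have : Nonempty X := ⟨x⟩
  have := hX.pathConnectedSpace
  intro u v huv
  induction u using Path.Homotopic.Quotient.ind with | mk γ =>
  induction v using Path.Homotopic.Quotient.ind with | mk δ =>
  have huv : Path.Homotopic.Quotient.mk (γ.map (LipSpace.eval S x).continuous) =
    .mk (δ.map (LipSpace.eval S x).continuous) := huv
  obtain ⟨H⟩ := Path.Homotopic.Quotient.exact huv
  have e0 : γ 0 = δ 0 := γ.source.trans δ.source.symm
  have e1 : γ 1 = δ 1 := γ.target.trans δ.target.symm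
  obtain ⟨κ, hκ, hκ0⟩ := exists_extension (hY := hY) γ.toContinuousMap δ.toContinuousMap 0
    ⟨fun z => z.1 * z.2, by fun_prop⟩ (fun p => zero_mul p) (fun p => one_mul p)
    (fun s => mul_zero s) (κ₀ := fun x => (const ((γ 0).1.1 x)).cls rfl
      (congrArg (fun f : S => f.1.1 x) e0))
    (.cls (GeodesicSpace.continuous_const.comp (γ 0).1.1.continuous) _ _)
  have hκ0' : ∀ x, geo hY (κ (0, x)) = const ((γ 0).1.1 x) := fun x => by
    rw [hκ0]
    exact geo_cls hY _ _ _
  -- the homotopy of the tracks of `x` gives the classes over `x`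
  let μ : ∀ s, Path ((γ s).1.1 x) ((δ s).1.1 x) := fun s =>
    ⟨⟨fun t => H (t, s), by fun_prop⟩, H.apply_zero s, H.apply_one s⟩
  have hμ : ContinuousClasses hY fun s => .mk (μ s) :=
    .mk (show Continuous fun z : I × I => H (z.2, z.1) by fun_prop)
  have hμs : ∀ s ∈ ({0, 1} : Set I), geo hY (.mk (μ s)) = const ((γ s).1.1 x) := fun s hs =>
    geo_mk_eq hY _ (ContinuousMap.const I (const ((γ s).1.1 x))) rfl fun t =>
      Prod.ext rfl (H.eq_fst t hs).symm
  have hκμ := (hκ.comp (f := fun s : I => (s, x)) (by fun_prop)).eq_of_eq hμ (a := 0)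
    (geo_injective hY ((hκ0' x).trans (hμs 0 (by simp)).symm))
  have hκ1 : ∀ x, geo hY (κ (1, x)) = const ((γ 1).1.1 x) :=
    (hκ.comp (f := fun x : X => ((1 : I), x)) (by fun_prop)).geo_eq_const (γ 1).1.1.continuous
      (fun x => congrArg (fun f : S => f.1.1 x) e1.symm) (a := x)
      ((congrArg (geo hY) (congrFun hκμ 1)).trans (hμs 1 (by simp)))
  refine Path.Homotopic.Quotient.eq.2 (hS.homotopicRel hX γ.toContinuousMap δ.toContinuousMap hκ ?_)
  rintro _ (rfl | rfl) x
  · exact hκ0' x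
  · exact hκ1 x

/-- The classes of the tracks of `x` along loops in `S` are those which commute with the image of
the fundamental group of `X`: by the lifting criterion these are the classes of loops that extend to
continuous families over `X`. -/
theorem range_map_eval (hS : IsGeodesicallyConnected hY S) (hX : IsLengthSpace X) (a : S)
    (x : X) : (FundamentalGroup.map (LipSpace.eval S x) a).range = imageCentralizer a.1 x := by
  have : Nonempty X := ⟨x⟩
  have := hX.pathConnectedSpace
  have := hX.locallyPathConnectedSpace
  refine le_antisymm ?_ fun κ₀ hκ₀ => ?_
  · rintro _ ⟨u, rfl⟩
    induction u using Path.Homotopic.Quotient.ind with | mk γ =>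
    refine (Subgroup.mem_centralizer_iff (G := FundamentalGroup Y (a.1.1 x))).2 ?_
    rintro _ ⟨v, rfl⟩
    induction v using Path.Homotopic.Quotient.ind with | mk δ =>
    have := (LipSpace.continuousClasses_track (hY := hY)
      (γ.map (f := Subtype.val) continuous_subtype_val)).naturality δ a.1.1.continuous
      a.1.1.continuous
    exact this
  · replace hκ₀ := (Subgroup.mem_centralizer_iff (G := FundamentalGroup Y (a.1.1 x))).1 hκ₀
    obtain ⟨κ, hκ, hκx⟩ := ContinuousClasses.exists_of_intertwine (hY := hY) (A := X) (p := a.1.1)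
      (q := a.1.1) (a₀ := x) a.1.1.continuous a.1.1.continuous κ₀ fun δ =>
        hκ₀ _ ⟨FundamentalGroup.fromPath (.mk δ), rfl⟩
    refine ⟨FundamentalGroup.fromPath (.mk ⟨⟨fun t => ⟨geodesicMapPath hX hκ t,
      hS.mem a a.2 a a.2 κ hκ t _ fun x => rfl⟩,
      (geodesicMapPath hX hκ).continuous.subtype_mk _⟩, Subtype.ext (Path.source _),
      Subtype.ext (Path.target _)⟩), ?_⟩
    have h1 : (Path.Homotopic.Quotient.mk (geoPath hY (κ x))) = κ₀ := by rw [mk_geoPath, hκx]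
    exact h1

end IsGeodesicallyConnected

end GeodesicallyConnected

/-! ### Homotopy groups of spaces of Lipschitz maps -/

section HomotopyGroups

open Set Metric unitInterval Filter GeodesicSpace
open scoped Topology.Homotopy

/-- The boundary of a cube of dimension at least two is connected. -/
theorem Cube.isPathConnected_boundary {n : ℕ} (hn : 2 ≤ n) :
    IsPathConnected (Cube.boundary (Fin n)) := by
  have : NeZero n := ⟨by omega⟩
  refine ⟨fun _ => 0, ⟨0, Or.inl rfl⟩, fun {y} hy => JoinedIn.symm ?_⟩
  obtain ⟨i, hi⟩ := hy
  have : Nontrivial (Fin n) := Fin.nontrivial_iff_two_le.2 hn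
  obtain ⟨j, hj⟩ := exists_ne i
  -- shrink all coordinates but the `i`-th, and then the `i`-th one
  refine JoinedIn.trans (y := fun k => if k = i then y i else 0)
    ⟨⟨⟨fun s k => if k = i then y i else σ s * y k, ?_⟩, ?_, ?_⟩, fun s =>
      ⟨i, hi.imp ((if_pos rfl).trans ·) ((if_pos rfl).trans ·)⟩⟩
    ⟨⟨⟨fun s k => if k = i then σ s * y i else 0, ?_⟩, ?_, ?_⟩, fun s =>
      ⟨j, Or.inl (if_neg hj)⟩⟩
  · refine continuous_pi fun k => ?_
    split_ifs <;> fun_prop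
  · ext k
    by_cases h : k = i <;> simp [h]
  · ext k
    by_cases h : k = i <;> simp [h]
  · refine continuous_pi fun k => ?_
    split_ifs <;> fun_prop
  · ext k
    by_cases h : k = i <;> simp [h]
  · ext k
    by_cases h : k = i <;> simp [h]

theorem homotopyGroupMap_one {A : Type u} {B : Type v} [TopologicalSpace A] [TopologicalSpace B]
    (f : C(A, B)) (a : A) (p : π_ 1 A a) :
    HomotopyGroup.pi1EquivFundamentalGroup (homotopyGroupMap 1 f a p) =
      FundamentalGroup.map f a (HomotopyGroup.pi1EquivFundamentalGroup p) := by
  induction p using Quotient.inductionOn with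
  | h p => rfl

variable {X : Type u} {Y : Type v} [MetricSpace X] [MetricSpace Y] [CompleteSpace Y]
  {hY : IsLocallyBusemann Y}

namespace IsGeodesicallyConnected

variable {S S' : Set (LipSpace X Y)}

/-- Two cubes with constant boundary are joined by a continuous family of classes, which is trivial
at a point of the boundary, whence on the whole boundary if this is connected. The geodesic homotopy
is then constant on the boundary. -/
theorem subsingleton_homotopyGroup (hS : IsGeodesicallyConnected hY S) (hX : IsLengthSpace X)
    (a : S) {n : ℕ} (hn : n = 0 ∨ 2 ≤ n) : Subsingleton (π_ n S a) := by
  refine ⟨fun u v => ?_⟩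
  induction u, v using Quotient.inductionOn₂ with | h F G =>
  refine Quotient.sound ?_
  let line : C(I × (Fin n → I), Fin n → I) := ⟨fun z k => z.1 * z.2 k, by fun_prop⟩
  have hl0 : ∀ p, line (0, p) = 0 := fun p => funext fun k => zero_mul (p k)
  have hl1 : ∀ p, line (1, p) = p := fun p => funext fun k => one_mul (p k)
  have hl2 : ∀ s, line (s, 0) = 0 := fun s => funext fun k => mul_zero s
  obtain rfl | hn := hn
  · obtain ⟨κ₀, hκ₀⟩ := hS.exists_classes _ (F.1 0).2 _ (G.1 0).2
    obtain ⟨κ, hκ, -⟩ := exists_extension F.1 G.1 0 line hl0 hl1 hl2 hκ₀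
    exact hS.homotopicRel hX F.1 G.1 hκ fun p ⟨i, _⟩ => i.elim0
  · have hb := Cube.isPathConnected_boundary hn
    have hb' := isPathConnected_iff_pathConnectedSpace.1 hb
    have : NeZero n := ⟨by omega⟩
    have h0 : (0 : Fin n → I) ∈ Cube.boundary (Fin n) := ⟨0, Or.inl rfl⟩
    have e0 : F.1 0 = G.1 0 := (F.2 0 h0).trans (G.2 0 h0).symm
    obtain ⟨κ, hκ, hκ0⟩ := exists_extension (hY := hY) F.1 G.1 0 line hl0 hl1 hl2
      (κ₀ := fun x => (const ((F.1 0).1.1 x)).cls rfl (congrArg (fun f : S => f.1.1 x) e0))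
      (.cls (GeodesicSpace.continuous_const.comp (F.1 0).1.1.continuous) _ _)
    refine hS.homotopicRel hX F.1 G.1 hκ fun p hp x => ?_
    refine (hκ.comp (f := fun p : Cube.boundary (Fin n) => (p.1, x)) (by fun_prop)).geo_eq_const
      (p := fun p : Cube.boundary (Fin n) => (F.1 p.1).1.1 x) (by fun_prop)
      (fun p => congrArg (fun f : S => f.1.1 x) ((G.2 p p.2).trans (F.2 p p.2).symm))
      (a := ⟨0, h0⟩) ?_ ⟨p, hp⟩
    rw [hκ0]
    exact geo_cls hY _ _ _

/-- Evaluation at `x` identifies the fundamental group with a centralizer. -/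
noncomputable def fundamentalGroupEquiv (hS : IsGeodesicallyConnected hY S) (hX : IsLengthSpace X)
    (a : S) (x : X) : FundamentalGroup S a ≃* imageCentralizer a.1 x :=
  (MonoidHom.ofInjective (hS.injective_map_eval hX a x)).trans
    (MulEquiv.subgroupCongr (hS.range_map_eval hX a x))

theorem isEilenbergMacLaneOne (hS : IsGeodesicallyConnected hY S) (hX : IsLengthSpace X)
    (hne : S.Nonempty) {G : Type w} [Group G] (x : X)
    (e : ∀ a ∈ S, Nonempty (imageCentralizer a x ≃* G)) : IsEilenbergMacLaneOne S G where
  pathConnected := hS.pathConnectedSpace hX hne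
  fundamentalGroup a := (e a a.2).map fun e => (hS.fundamentalGroupEquiv hX a x).trans e
  higher _ a hn := hS.subsingleton_homotopyGroup hX a (Or.inr hn)

/-- On fundamental groups the inclusion is bijective, as evaluation at `x` identifies both groups
with the same centralizer. -/
theorem isWeakHomotopyEquiv (hS : IsGeodesicallyConnected hY S)
    (hS' : IsGeodesicallyConnected hY S') (hX : IsLengthSpace X) (x : X) (hne : S.Nonempty)
    (h : S ⊆ S') : IsWeakHomotopyEquiv ⟨Set.inclusion h, continuous_inclusion h⟩ := by
  refine ⟨fun _ => hne.to_subtype, fun n a => ?_⟩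
  by_cases hn : n = 0 ∨ 2 ≤ n
  · have := hS.subsingleton_homotopyGroup hX a hn
    have := hS'.subsingleton_homotopyGroup hX (Set.inclusion h a) hn
    exact ⟨Function.injective_of_subsingleton _, fun b =>
      ⟨Quotient.mk _ GenLoop.const, Subsingleton.elim _ _⟩⟩
  obtain rfl : n = 1 := by omega
  set i : C(S, S') := ⟨Set.inclusion h, continuous_inclusion h⟩
  have key : Function.Bijective (FundamentalGroup.map i a) := by
    have comp : ∀ u, FundamentalGroup.map (LipSpace.eval S' x) (i a) (FundamentalGroup.map i a u) =
        FundamentalGroup.map (LipSpace.eval S x) a u := fun u => by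
      induction u using Path.Homotopic.Quotient.ind with | mk γ => rfl
    refine ⟨fun u v huv => hS.injective_map_eval hX a x ?_, fun u => ?_⟩
    · rw [← comp, ← comp, huv]
    · have hu : FundamentalGroup.map (LipSpace.eval S' x) (i a) u ∈
          (FundamentalGroup.map (LipSpace.eval S' x) (i a)).range := ⟨u, rfl⟩
      rw [hS'.range_map_eval hX] at hu
      obtain ⟨v, hv⟩ := (hS.range_map_eval hX a x).ge hu
      exact ⟨v, hS'.injective_map_eval hX (i a) x ((comp v).trans hv)⟩
  have := (HomotopyGroup.pi1EquivFundamentalGroup.symm.bijective.comp key).comp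
    HomotopyGroup.pi1EquivFundamentalGroup.bijective
  convert this using 1
  funext p
  simp only [Function.comp]
  rw [← homotopyGroupMap_one, Equiv.symm_apply_apply]

end IsGeodesicallyConnected

theorem isEilenbergMacLaneOne_pathComponent (hY : IsLocallyBusemann Y) (hX : IsLengthSpace X)
    (f : LipSpace X Y) (x : X) :
    IsEilenbergMacLaneOne (pathComponent f) (imageCentralizer f x) := by
  have hK := isGeodesicallyConnected_pathComponent (hY := hY) hX f
  have := hK.pathConnectedSpace hX ⟨f, mem_pathComponent_self f⟩
  exact hK.isEilenbergMacLaneOne hX ⟨f, mem_pathComponent_self f⟩ x fun a ha =>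
    ⟨(hK.fundamentalGroupEquiv hX ⟨a, ha⟩ x).symm.trans
      ((FundamentalGroup.fundamentalGroupMulEquivOfPathConnected _ _).trans
        (hK.fundamentalGroupEquiv hX ⟨f, mem_pathComponent_self f⟩ x))⟩

theorem isEilenbergMacLaneOne_lipComponent (hY : IsLocallyBusemann Y) (hX : IsLengthSpace X)
    (f : LipSpace X Y) (x : X) {L : ℝ} (hne : (lipComponent f L).Nonempty) :
    IsEilenbergMacLaneOne (lipComponent f L) (imageCentralizer f x) := by
  have hK := isGeodesicallyConnected_pathComponent (hY := hY) hX f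
  refine (isGeodesicallyConnected_lipComponent (hY := hY) hX f L).isEilenbergMacLaneOne hX hne x
    fun a ha => ?_
  obtain ⟨e⟩ := (isEilenbergMacLaneOne_pathComponent hY hX f x).fundamentalGroup ⟨a, ha.1⟩
  exact ⟨(hK.fundamentalGroupEquiv hX ⟨a, ha.1⟩ x).symm.trans e⟩

theorem isWeakHomotopyEquiv_lipComponentInclusion (hY : IsLocallyBusemann Y)
    (hX : IsLengthSpace X) (f : LipSpace X Y) (x : X) {L : ℝ}
    (hne : (lipComponent f L).Nonempty) : IsWeakHomotopyEquiv (lipComponentInclusion f L) :=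
  (isGeodesicallyConnected_lipComponent (hY := hY) hX f L).isWeakHomotopyEquiv
    (isGeodesicallyConnected_pathComponent hX f) hX x hne fun _ h => h.1

end HomotopyGroups

/-! ### Continuous choice of geodesic homotopies -/

section Deformation

open Set Metric unitInterval Filter GeodesicSpace

theorem Path.Homotopic.Quotient.trans_symm_trans {Z : Type u} [TopologicalSpace Z] {a b c d : Z}
    (κ : Path.Homotopic.Quotient a b) (μ : Path.Homotopic.Quotient b c)
    (ν : Path.Homotopic.Quotient b d) :
    (κ.trans μ).symm.trans (κ.trans ν) = μ.symm.trans ν := by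
  have h : κ.trans ν = (κ.trans μ).trans (μ.symm.trans ν) := by
    rw [trans_assoc, trans_symm_cancel_left]
  rw [h, symm_trans_cancel_left]

namespace GeodesicSpace

variable {Y : Type u} [MetricSpace Y] [CompleteSpace Y] (hY : IsLocallyBusemann Y)

theorem tendsto_geo_trans {A : Type w} {l : Filter A} {p q r : A → Y} {p₀ q₀ r₀ : Y}
    {κ : ∀ a, Path.Homotopic.Quotient (p a) (q a)} {μ : ∀ a, Path.Homotopic.Quotient (q a) (r a)}
    {κ₀ : Path.Homotopic.Quotient p₀ q₀} {μ₀ : Path.Homotopic.Quotient q₀ r₀}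
    (hκ : Tendsto (fun a => geo hY (κ a)) l (𝓝 (geo hY κ₀)))
    (hμ : Tendsto (fun a => geo hY (μ a)) l (𝓝 (geo hY μ₀))) :
    Tendsto (fun a => geo hY ((κ a).trans (μ a))) l (𝓝 (geo hY (κ₀.trans μ₀))) := by
  let P := {c : GeodesicSpace Y × GeodesicSpace Y // c.1.1 1 = c.2.1 0}
  have h1 : ContinuousClasses hY fun c : P => c.1.1.cls rfl rfl :=
    .cls (continuous_fst.comp continuous_subtype_val) _ _
  have h2 : ContinuousClasses hY fun c : P => c.1.2.cls c.2.symm rfl :=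
    .cls (continuous_snd.comp continuous_subtype_val) _ _
  have h3 : Continuous fun c : P => geo hY ((c.1.1.cls rfl rfl).trans (c.1.2.cls c.2.symm rfl)) :=
    h1.trans h2
  have key : ∀ {p q r : Y} (κ : Path.Homotopic.Quotient p q) (μ : Path.Homotopic.Quotient q r),
      ∀ c : P, c.1.1 = geo hY κ → c.1.2 = geo hY μ →
        geo hY ((c.1.1.cls rfl rfl).trans (c.1.2.cls c.2.symm rfl)) = geo hY (κ.trans μ) := by
    rintro p q r κ μ ⟨⟨c, d⟩, h⟩ hc hd
    simp only at hc hd h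
    have hp : c.1 0 = p := by rw [hc]; simp
    have hq : c.1 1 = q := by rw [hc]; simp
    have hr : d.1 1 = r := by rw [hd]; simp
    subst hp hq hr
    rw [cls_of_eq_geo hY hc, cls_of_eq_geo hY hd]
  let φ : A → P := fun a => ⟨(geo hY (κ a), geo hY (μ a)), by simp⟩
  let φ₀ : P := ⟨(geo hY κ₀, geo hY μ₀), by simp⟩
  have hφ : Tendsto φ l (𝓝 φ₀) := tendsto_subtype_rng.2 (hκ.prodMk_nhds hμ)
  have := (h3.tendsto φ₀).comp hφ
  rw [key κ₀ μ₀ φ₀ rfl rfl] at this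
  exact this.congr fun a => key _ _ (φ a) rfl rfl

theorem exists_radius_geo_trans {p q r : Y} (κ₀ : Path.Homotopic.Quotient p q)
    (μ₀ : Path.Homotopic.Quotient q r) {W : Set (GeodesicSpace Y)}
    (hW : W ∈ 𝓝 (geo hY (κ₀.trans μ₀))) :
    ∃ δ > 0, ∀ (p' q' r' : Y) (κ : Path.Homotopic.Quotient p' q')
      (μ : Path.Homotopic.Quotient q' r'),
      dist (geo hY κ) (geo hY κ₀) < δ → dist (geo hY μ) (geo hY μ₀) < δ →
        geo hY (κ.trans μ) ∈ W := by
  let A := Σ p' q' r' : Y, Path.Homotopic.Quotient p' q' × Path.Homotopic.Quotient q' r'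
  let φ : A → GeodesicSpace Y × GeodesicSpace Y := fun a =>
    (geo hY a.2.2.2.1, geo hY a.2.2.2.2)
  have h := tendsto_geo_trans hY (l := comap φ (𝓝 (geo hY κ₀, geo hY μ₀)))
    (κ := fun a : A => a.2.2.2.1) (μ := fun a : A => a.2.2.2.2) (κ₀ := κ₀) (μ₀ := μ₀)
    ((continuous_fst.tendsto _).comp tendsto_comap) ((continuous_snd.tendsto _).comp tendsto_comap)
  obtain ⟨s, hs, hsub⟩ := mem_comap.1 (h hW)
  obtain ⟨δ, hδ, hb⟩ := Metric.mem_nhds_iff.1 hs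
  exact ⟨δ, hδ, fun p' q' r' κ μ h1 h2 => hsub (a := ⟨p', q', r', κ, μ⟩) (hb (max_lt h1 h2))⟩

theorem tendsto_interpolate {A : Type w} {l : Filter A} {t : A → I} {d e : A → GeodesicSpace Y}
    {t₀ : I} {d₀ e₀ : GeodesicSpace Y} (ht : Tendsto t l (𝓝 t₀)) (hd : Tendsto d l (𝓝 d₀))
    (he : Tendsto e l (𝓝 e₀)) (h : ∀ᶠ a in l, (d a).1 0 = (e a).1 0) (h₀ : d₀.1 0 = e₀.1 0) :
    Tendsto (fun a => interpolate hY (t a) (d a) (e a)) l (𝓝 (interpolate hY t₀ d₀ e₀)) := by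
  let s : Set (I × GeodesicSpace Y × GeodesicSpace Y) := {c | c.2.1.1 0 = c.2.2.1 0}
  have h3 : ContinuousOn (fun c => interpolate hY c.1 c.2.1 c.2.2) s := by
    rw [continuousOn_iff_continuous_domRestrict]
    exact continuous_interpolate hY (A := s) (by fun_prop) (by fun_prop) (by fun_prop) fun a => a.2
  exact (h3 (t₀, d₀, e₀) h₀).tendsto.comp
    (tendsto_nhdsWithin_iff.2 ⟨ht.prodMk_nhds (hd.prodMk_nhds he), h⟩)

variable {hY} in
/-- A point close to the centre of a Busemann convex ball is joined to it by a short class. -/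
theorem exists_short {y z : Y} {ε : ℝ} (hε : 0 < ε) (hy : IsBusemannBall y (2 * ε))
    (hz : z ∈ ball y ε) :
    ∃ κ : Path.Homotopic.Quotient z y, geo hY κ ∈ ball (const y) ε := by
  obtain ⟨c, hc, h⟩ := exists_mem_ball_ends_eq (c := const y) hε (fun _ => hy) (u := (z, y))
    (max_lt (show dist z y < ε from hz) (by simpa using hε) : dist (z, y) (y, y) < ε)
  have h0 : c.1 0 = z := congrArg Prod.fst h
  have h1 : c.1 1 = y := congrArg Prod.snd h
  exact ⟨c.cls h0 h1, by rwa [geo_cls]⟩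

variable {hY} in
theorem short_unique {y z : Y} {ε : ℝ} (hy : IsBusemannBall y (2 * ε))
    {κ κ' : Path.Homotopic.Quotient z y} (h : geo hY κ ∈ ball (const y) ε)
    (h' : geo hY κ' ∈ ball (const y) ε) : κ = κ' := by
  refine geo_injective hY (dist_eq_zero.1 ?_)
  rw [← dist_ends_of_mem_ball (c := const y) (fun _ => hy) h h', ends_geo, ends_geo, dist_self]

/-- If `κ` is sufficiently short and `τ` belongs to a small ball, then the composite belongs to the
ball, too. -/
theorem exists_radius_trans {y z : Y} {ε : ℝ} {τ : Path.Homotopic.Quotient z y}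
    (hτ : geo hY τ ∈ ball (const y) ε) : ∃ r > 0, ∀ (w : Y) (κ : Path.Homotopic.Quotient w z),
      dist (geo hY κ) (const z) < r → geo hY (κ.trans τ) ∈ ball (const y) ε := by
  have h : Tendsto (fun c : {c : GeodesicSpace Y // c.1 1 = z} =>
      geo hY ((c.1.cls rfl c.2).trans τ)) (comap Subtype.val (𝓝 (const z)))
      (𝓝 (geo hY ((Path.Homotopic.Quotient.refl z).trans τ))) := by
    refine tendsto_geo_trans hY ?_ tendsto_const_nhds
    simp only [geo_cls, geo_refl]
    exact tendsto_comap
  rw [Path.Homotopic.Quotient.refl_trans] at h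
  obtain ⟨s, hs, hsub⟩ := mem_comap.1 (h (isOpen_ball.mem_nhds hτ))
  obtain ⟨r, hr, hb⟩ := Metric.mem_nhds_iff.1 hs
  refine ⟨r, hr, fun w κ hκ => ?_⟩
  have key : ∀ (c : GeodesicSpace Y) (h0 : c.1 0 = w) (h1 : c.1 1 = z),
      geo hY ((c.cls rfl h1).trans τ) = geo hY ((c.cls h0 h1).trans τ) := by
    intro c h0 h1
    subst h0
    rfl
  have := hsub (a := ⟨geo hY κ, geo_one hY κ⟩) (hb hκ)
  rwa [mem_preimage, key _ (geo_zero hY κ), cls_geo] at this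

end GeodesicSpace

variable {X : Type u} {Y : Type v} [MetricSpace X] [MetricSpace Y] [CompleteSpace Y]
  {hY : IsLocallyBusemann Y}

/-- A continuous family of local geodesics that starts at the map `g` and ends at some map in the
set `S`. -/
structure IsGeodesicLift (S : Set (LipSpace X Y)) (g : LipSpace X Y) (e : X → GeodesicSpace Y) :
    Prop where
  continuous : Continuous e
  source : ∀ x, (e x).1 0 = g.1 x
  target : ∃ b ∈ S, ∀ x, (e x).1 1 = b.1 x

variable {S : Set (LipSpace X Y)} {g : LipSpace X Y}

theorem IsGeodesicLift.of_classes {b : LipSpace X Y} (hb : b ∈ S)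
    {κ : ∀ x, Path.Homotopic.Quotient (g.1 x) (b.1 x)} (hκ : ContinuousClasses hY κ) :
    IsGeodesicLift S g fun x => geo hY (κ x) :=
  ⟨hκ, fun _ => geo_zero hY _, b, hb, fun _ => geo_one hY _⟩

variable (hY) in
theorem IsGeodesicLift.exists_classes {e : X → GeodesicSpace Y} (he : IsGeodesicLift S g e) :
    ∃ b ∈ S, ∃ κ : ∀ x, Path.Homotopic.Quotient (g.1 x) (b.1 x), ContinuousClasses hY κ ∧
      e = fun x => geo hY (κ x) := by
  obtain ⟨b, hb, h⟩ := he.target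
  exact ⟨b, hb, fun x => (e x).cls (he.source x) (h x), .cls he.continuous _ _,
    funext fun x => (geo_cls hY _ _ _).symm⟩

/-- Lifts may be interpolated: their ends are moved by the geodesic homotopy between them. -/
theorem IsGeodesicLift.interpolate (hX : IsLengthSpace X) (hS : IsGeodesicallyConvex hY S)
    {d e : X → GeodesicSpace Y} (hd : IsGeodesicLift S g d) (he : IsGeodesicLift S g e) (t : I) :
    IsGeodesicLift S g fun x => interpolate hY t (d x) (e x) := by
  obtain ⟨b, hb, κ, hκ, rfl⟩ := hd.exists_classes hY
  obtain ⟨b', hb', μ, hμ, rfl⟩ := he.exists_classes hY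
  have h : ContinuousClasses hY fun x => (κ x).symm.trans (μ x) := hκ.symm.trans hμ
  refine ⟨continuous_interpolate hY (by fun_prop) hd.continuous he.continuous fun x => by simp,
    fun x => ?_, geodesicMap hX h t, hS b hb b' hb' _ h t _ fun x => rfl, fun x => ?_⟩
  · rw [interpolate_apply_zero, geo_zero]
  · rw [interpolate_geo_apply_one, geodesicMap_apply]

/-- The set of all pairs of a map `b ∈ S` and a geodesic from `y` to `b x₀` which occurs as
composite of a short geodesic from `y` to `g x₀` with a lift from `g` to `b`. It is locally constant
in `g`, which makes it possible to choose lifts in a locally consistent way. -/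
def liftData (hY : IsLocallyBusemann Y) (S : Set (LipSpace X Y)) (x₀ : X) (y : Y) (ε : ℝ)
    (g : LipSpace X Y) : Set (LipSpace X Y × GeodesicSpace Y) :=
  {c | c.1 ∈ S ∧ ∃ κ : ∀ x, Path.Homotopic.Quotient (g.1 x) (c.1.1 x), ContinuousClasses hY κ ∧
    ∃ τ : Path.Homotopic.Quotient (g.1 x₀) y, geo hY τ ∈ ball (const y) ε ∧
      geo hY (τ.symm.trans (κ x₀)) = c.2}

/-- The lift data of two maps agree if the maps are joined by a lift that is short at `x₀`. -/
theorem liftData_eq {x₀ : X} {y : Y} {ε : ℝ} (hy : IsBusemannBall y (2 * ε)) {g₀ : LipSpace X Y}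
    {ν : ∀ x, Path.Homotopic.Quotient (g.1 x) (g₀.1 x)} (hν : ContinuousClasses hY ν)
    {τ₀ : Path.Homotopic.Quotient (g₀.1 x₀) y} (hτ₀ : geo hY τ₀ ∈ ball (const y) ε)
    (h : geo hY ((ν x₀).trans τ₀) ∈ ball (const y) ε) :
    liftData hY S x₀ y ε g = liftData hY S x₀ y ε g₀ := by
  refine Subset.antisymm ?_ ?_
  · rintro ⟨b, c⟩ ⟨hb, κ, hκ, τ, hτ, hc⟩
    obtain rfl := short_unique hy hτ h
    refine ⟨hb, fun x => (ν x).symm.trans (κ x), hν.symm.trans hκ, τ₀, hτ₀, ?_⟩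
    rw [← hc, ← Path.Homotopic.Quotient.trans_symm_trans (ν x₀),
      Path.Homotopic.Quotient.trans_symm_cancel_left]
  · rintro ⟨b, c⟩ ⟨hb, κ, hκ, τ, hτ, hc⟩
    obtain rfl := short_unique hy hτ hτ₀
    refine ⟨hb, fun x => (ν x).trans (κ x), hν.trans hκ, _, h, ?_⟩
    rw [← hc, Path.Homotopic.Quotient.trans_symm_trans]

theorem liftData_nonempty {x₀ : X} {y : Y} {ε : ℝ} (hε : 0 < ε) (hy : IsBusemannBall y (2 * ε))
    (hg : g.1 x₀ ∈ ball y ε) {e : X → GeodesicSpace Y} (he : IsGeodesicLift S g e) :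
    (liftData hY S x₀ y ε g).Nonempty := by
  obtain ⟨b, hb, κ, hκ, -⟩ := he.exists_classes hY
  obtain ⟨τ, hτ⟩ := exists_short (hY := hY) hε hy hg
  exact ⟨(b, geo hY (τ.symm.trans (κ x₀))), hb, κ, hκ, τ, hτ, rfl⟩

open scoped Classical in
/-- A lift whose data are chosen in dependence of the set `liftData` only. -/
noncomputable def chosenLift (hY : IsLocallyBusemann Y) (S : Set (LipSpace X Y)) (x₀ : X) (y : Y)
    (ε : ℝ) (g : LipSpace X Y) : X → GeodesicSpace Y :=
  if h : (liftData hY S x₀ y ε g).Nonempty then fun x => geo hY (h.some_mem.2.choose x)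
  else fun x => const (g.1 x)

theorem chosenLift_spec {x₀ : X} {y : Y} {ε : ℝ} (h : (liftData hY S x₀ y ε g).Nonempty)
    {c : LipSpace X Y × GeodesicSpace Y} (hc : h.some = c) : c.1 ∈ S ∧
      ∃ κ : ∀ x, Path.Homotopic.Quotient (g.1 x) (c.1.1 x), ContinuousClasses hY κ ∧
        (chosenLift hY S x₀ y ε g = fun x => geo hY (κ x)) ∧
        ∃ τ : Path.Homotopic.Quotient (g.1 x₀) y, geo hY τ ∈ ball (const y) ε ∧
          geo hY (τ.symm.trans (κ x₀)) = c.2 := by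
  subst hc
  refine ⟨h.some_mem.1, h.some_mem.2.choose, h.some_mem.2.choose_spec.1, ?_,
    h.some_mem.2.choose_spec.2⟩
  rw [chosenLift, dif_pos h]

theorem isGeodesicLift_chosenLift {x₀ : X} {y : Y} {ε : ℝ}
    (h : (liftData hY S x₀ y ε g).Nonempty) :
    IsGeodesicLift S g (chosenLift hY S x₀ y ε g) := by
  obtain ⟨hb, κ, hκ, he, -⟩ := chosenLift_spec h rfl
  rw [he]
  exact .of_classes hb hκ

/-- The chosen lifts of two maps differ by the lift that joins the maps, if it is short at `x₀`. -/
theorem chosenLift_eq [PreconnectedSpace X] {x₀ : X} {y : Y} {ε : ℝ}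
    (hy : IsBusemannBall y (2 * ε)) {g₀ : LipSpace X Y}
    (h₀ : (liftData hY S x₀ y ε g₀).Nonempty) :
    ∃ b ∈ S, ∃ κ : ∀ x, Path.Homotopic.Quotient (g₀.1 x) (b.1 x), ContinuousClasses hY κ ∧
      (chosenLift hY S x₀ y ε g₀ = fun x => geo hY (κ x)) ∧
      ∃ r > 0, ∀ (g : LipSpace X Y) (ν : ∀ x, Path.Homotopic.Quotient (g.1 x) (g₀.1 x)),
        ContinuousClasses hY ν → dist (geo hY (ν x₀)) (const (g₀.1 x₀)) < r →
        chosenLift hY S x₀ y ε g = fun x => geo hY ((ν x).trans (κ x)) := by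
  obtain ⟨hb, κ, hκ, he, τ₀, hτ₀, hc⟩ := chosenLift_spec h₀ rfl
  obtain ⟨r, hr, hrad⟩ := exists_radius_trans hY hτ₀
  refine ⟨_, hb, κ, hκ, he, r, hr, fun g ν hν hshort => ?_⟩
  have hντ := hrad _ (ν x₀) hshort
  have heq := liftData_eq (S := S) hy hν hτ₀ hντ
  have some_eq : ∀ (s t : Set (LipSpace X Y × GeodesicSpace Y)) (hs : s.Nonempty)
      (ht : t.Nonempty), s = t → hs.some = ht.some := by
    rintro s t hs ht rfl
    rfl
  obtain ⟨-, κ', hκ', he', τ, hτ, hc'⟩ := chosenLift_spec (by rw [heq]; exact h₀)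
    (some_eq _ _ (by rw [heq]; exact h₀) h₀ heq)
  rw [he']
  obtain rfl := short_unique hy hτ hντ
  have : κ' = fun x => (ν x).trans (κ x) := by
    refine hκ'.eq_of_eq (hν.trans hκ) (a := x₀) ?_
    have h1 := geo_injective hY (hc'.trans hc.symm)
    rw [← Path.Homotopic.Quotient.trans_symm_trans (ν x₀) τ₀] at h1
    have h2 := congrArg (fun c => ((ν x₀).trans τ₀).trans c) h1
    simpa only [Path.Homotopic.Quotient.trans_symm_cancel_left] using h2
  rw [this]

/-- Elements which act trivially may be omitted from a fold over a sorted list. -/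
theorem List.foldl_sort_eq {α : Type u} {β : Type v} [LinearOrder α] {s t : Finset α} (hst : s ⊆ t)
    (f : β → α → β) (h : ∀ b, ∀ a ∈ t, a ∉ s → f b a = b) (b : β) :
    (t.sort (· ≤ ·)).foldl f b = (s.sort (· ≤ ·)).foldl f b := by
  have h1 : (t.sort (· ≤ ·)).filter (· ∈ s) = s.sort (· ≤ ·) := by
    refine List.Perm.eq_of_pairwise' ((t.pairwise_sort _).filter _) (s.pairwise_sort _) ?_
    refine (List.perm_ext_iff_of_nodup ((t.sort_nodup _).filter _) (s.sort_nodup _)).2 fun a => ?_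
    simp only [List.mem_filter, Finset.mem_sort, decide_eq_true_eq]
    exact ⟨fun h => h.2, fun h => ⟨hst h, h⟩⟩
  rw [← h1, List.foldl_filter]
  refine List.foldl_ext _ _ _ fun b a ha => ?_
  by_cases has : a ∈ s
  · simp [has]
  · simp [has, h b a ((Finset.mem_sort _).1 ha) has]

/-- The continuous choice of geodesics into a geodesically convex set `S`, for a family `j` of maps
such that nearby members of the family are joined by short geodesics. Over the members `g` with
`g x₀` in a given small ball, lifts can be chosen consistently (`chosenLift`), and such choices are
glued by interpolation with weights from a covering by bump functions. -/
theorem exists_continuous_lift (hX : IsLengthSpace X) (x₀ : X) {T : Type w} [TopologicalSpace T]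
    {j : T → LipSpace X Y} (hj : Continuous fun g => (j g).1 x₀) {𝒞 : Set (Set X)}
    (h𝒞 : ∀ C ∈ 𝒞, x₀ ∈ C)
    (hlocal : ∀ g₀, ∀ C ∈ 𝒞, ∀ r > 0, ∀ᶠ g in 𝓝 g₀,
      ∃ ν : ∀ x, Path.Homotopic.Quotient ((j g).1 x) ((j g₀).1 x), ContinuousClasses hY ν ∧
        ∀ x ∈ C, dist (geo hY (ν x)) (const ((j g₀).1 x)) < r)
    (hS : IsGeodesicallyConvex hY S) (hex : ∀ g, ∃ e, IsGeodesicLift S (j g) e) :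
    ∃ E : T → X → GeodesicSpace Y, (∀ g, IsGeodesicLift S (j g) (E g)) ∧
      ∀ C ∈ 𝒞, Continuous fun z : T × C => E z.1 z.2 := by
  have : Nonempty X := ⟨x₀⟩
  have := hX.pathConnectedSpace
  have hrad : ∀ y : Y, ∃ ε > 0, IsBusemannBall y (2 * ε) := fun y =>
    exists_radius hY (const y) |>.imp fun ε h => ⟨h.1, h.2 0⟩
  choose ε hε hb using hrad
  obtain ⟨f, hf⟩ := BumpCovering.exists_isSubordinate (s := univ) isClosed_univ
    (fun y => ball y (ε y)) (fun _ => isOpen_ball) fun y _ => mem_iUnion.2 ⟨y, mem_ball_self (hε y)⟩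
  choose s hs using hex
  let φ : Y → Y → I := fun y z => ⟨f y z, f.nonneg y z, f.le_one y z⟩
  let z : T → Y := fun g => (j g).1 x₀
  let e : Y → T → X → GeodesicSpace Y := fun y g => chosenLift hY S x₀ y (ε y) (j g)
  have hne : ∀ y g, z g ∈ ball y (ε y) → (liftData hY S x₀ y (ε y) (j g)).Nonempty := fun y g h =>
    liftData_nonempty (hε y) (hb y) h (hs g)
  have he : ∀ y g, z g ∈ ball y (ε y) → IsGeodesicLift S (j g) (e y g) := fun y g h =>
    isGeodesicLift_chosenLift (hne y g h)
  have hec : ∀ y g₀, z g₀ ∈ ball y (ε y) → ∀ C ∈ 𝒞, ∀ c₀ : C,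
      Tendsto (fun a : T × C => e y a.1 a.2) (𝓝 (g₀, c₀)) (𝓝 (e y g₀ c₀)) := by
    intro y g₀ hy C hC c₀ W hW
    obtain ⟨b, hbS, κ, hκ, hκe, r, hr, hν⟩ := chosenLift_eq (hb y) (hne y g₀ hy)
    simp only [e, hκe] at hW
    rw [← Path.Homotopic.Quotient.refl_trans (κ c₀)] at hW
    obtain ⟨δ, hδ, hW⟩ := exists_radius_geo_trans hY _ _ hW
    have h1 := hlocal g₀ C hC (min r (δ / 2)) (by positivity)
    have h2 : ∀ᶠ c : C in 𝓝 c₀, dist (const ((j g₀).1 c)) (const ((j g₀).1 c₀)) < δ / 2 :=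
      Metric.tendsto_nhds.1 ((GeodesicSpace.continuous_const.comp
        ((j g₀).1.continuous.comp continuous_subtype_val)).tendsto c₀) _ (by positivity)
    have h3 : ∀ᶠ c : C in 𝓝 c₀, dist (geo hY (κ c)) (geo hY (κ c₀)) < δ :=
      Metric.tendsto_nhds.1 ((Continuous.comp (show Continuous fun x => geo hY (κ x) from hκ)
        continuous_subtype_val).tendsto c₀) _ hδ
    rw [mem_map, nhds_prod_eq]
    filter_upwards [h1.prod_mk (h2.and h3)] with a ⟨⟨ν, hνc, hνs⟩, h2, h3⟩
    have h4 := hνs a.2 a.2.2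
    simp only [mem_preimage, e]
    rw [hν (j a.1) ν hνc ((hνs x₀ (h𝒞 C hC)).trans_le (min_le_left _ _))]
    refine hW _ _ _ _ _ ?_ h3
    rw [geo_refl]
    have h5 := h4.trans_le (min_le_right _ _)
    exact (dist_triangle _ _ _).trans_lt (by linarith)
  classical
  let _ : LinearOrder Y := linearOrderOfSTO WellOrderingRel
  let active : Y → Finset Y := fun z => (f.locallyFinite.point_finite z).toFinset
  let step : T → X → GeodesicSpace Y → Y → GeodesicSpace Y := fun g x d y =>
    interpolate hY (φ y (z g)) d (e y g x)
  have fold_lift : ∀ (g : T) (l : List Y), (∀ y ∈ l, z g ∈ ball y (ε y)) →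
      ∀ d : X → GeodesicSpace Y, IsGeodesicLift S (j g) d →
        IsGeodesicLift S (j g) fun x => l.foldl (step g x) (d x) := by
    intro g l
    induction l with
    | nil => exact fun _ d hd => hd
    | cons y l ih =>
      intro hl d hd
      exact ih (fun y' hy' => hl y' (List.mem_cons_of_mem _ hy'))
        (fun x => step g x (d x) y) (hd.interpolate hX hS (he y g (hl y List.mem_cons_self)) _)
  refine ⟨fun g x => ((active (z g)).sort (· ≤ ·)).foldl (step g x) (s g x), fun g =>
    fold_lift g _ (fun y hy => ?_) _ (hs g), fun C hC => continuous_iff_continuousAt.2 ?_⟩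
  · simp only [active, Finset.mem_sort, Set.Finite.mem_toFinset] at hy
    exact hf y (subset_tsupport _ hy)
  rintro ⟨g₀, c₀⟩
  -- near `g₀` only the bump functions whose closed support contains `z g₀` matter
  let F : Finset Y := (f.locallyFinite.closure.point_finite (z g₀)).toFinset
  have hF : ∀ y ∈ F, z g₀ ∈ ball y (ε y) := fun y hy => hf y (by simpa [F, tsupport] using hy)
  have hactive : ∀ᶠ g in 𝓝 g₀, active (z g) ⊆ F := by
    have := hj.continuousAt.eventually
      (f.locallyFinite.closure.eventually_subset (fun _ => isClosed_closure) (z g₀))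
    filter_upwards [this] with g hg y hy
    simp only [active, Set.Finite.mem_toFinset] at hy
    simpa [F] using hg (subset_closure hy)
  have hball : ∀ y ∈ F, ∀ᶠ g in 𝓝 g₀, z g ∈ ball y (ε y) := fun y hy =>
    hj.continuousAt.preimage_mem_nhds (isOpen_ball.mem_nhds (hF y hy))
  have hfold : ∀ᶠ g in 𝓝 g₀, ∀ x, ((active (z g)).sort (· ≤ ·)).foldl (step g x) (s g x) =
      (F.sort (· ≤ ·)).foldl (step g x) (s g x) := by
    filter_upwards [hactive] with g hg x
    refine (List.foldl_sort_eq hg _ (fun d y _ hy => ?_) _).symm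
    have : φ y (z g) = 0 := Subtype.ext (by simpa [active, φ] using hy)
    simp only [step, this, interpolate_zero]
  -- one of them is equal to one near `z g₀`, so that the start of the interpolation is irrelevant
  obtain ⟨y₁, hy₁⟩ := f.eventuallyEq_one' (z g₀) (mem_univ _)
  have hy₁F : y₁ ∈ F := by
    have : f y₁ (z g₀) ≠ 0 := by
      have h1 : f y₁ (z g₀) = 1 := hy₁.self_of_nhds
      rw [h1]
      exact one_ne_zero
    simpa [F] using subset_closure this
  obtain ⟨l₁, l₂, hl⟩ := List.mem_iff_append.1 ((Finset.mem_sort (· ≤ ·)).2 hy₁F)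
  have hsub : ∀ y ∈ F.sort (· ≤ ·), y ∈ F := fun y hy => (Finset.mem_sort _).1 hy
  have hstart : ∀ᶠ g in 𝓝 g₀, ∀ x, ((active (z g)).sort (· ≤ ·)).foldl (step g x) (s g x) =
      l₂.foldl (step g x) (e y₁ g x) := by
    have h1 : ∀ᶠ g in 𝓝 g₀, ∀ y ∈ F, z g ∈ ball y (ε y) := (Finset.eventually_all F).2 hball
    filter_upwards [hfold, hj.continuousAt.eventually hy₁, h1] with g hg hg1 hgF x
    have h2 : φ y₁ (z g) = 1 := Subtype.ext hg1
    have h3 := fold_lift g l₁ (fun y hy => hgF y (hsub y (by simp [hl, hy]))) _ (hs g)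
    rw [hg, hl, List.foldl_append, List.foldl_cons]
    congr 1
    simp only [step, h2]
    exact interpolate_one hY ((h3.source x).trans ((he y₁ g (hgF y₁ hy₁F)).source x).symm)
  have hlist : ∀ (l : List Y), (∀ y ∈ l, y ∈ F) → ∀ d : T → X → GeodesicSpace Y,
      (∀ᶠ g in 𝓝 g₀, ∀ x, (d g x).1 0 = (j g).1 x) →
      Tendsto (fun a : T × C => d a.1 a.2) (𝓝 (g₀, c₀)) (𝓝 (d g₀ c₀)) →
      Tendsto (fun a : T × C => l.foldl (step a.1 a.2) (d a.1 a.2)) (𝓝 (g₀, c₀))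
        (𝓝 (l.foldl (step g₀ c₀) (d g₀ c₀))) := by
    intro l
    induction l with
    | nil => exact fun _ d _ hd => hd
    | cons y l ih =>
      intro hl d hd0 hd
      have hyF := hl y List.mem_cons_self
      have hsrc : ∀ᶠ g in 𝓝 g₀, ∀ x, (d g x).1 0 = (e y g x).1 0 := by
        filter_upwards [hd0, hball y hyF] with g h1 h2 x
        rw [h1 x, (he y g h2).source x]
      refine ih (fun y' hy' => hl y' (List.mem_cons_of_mem _ hy')) (fun g x => step g x (d g x) y)
        ?_ ?_
      · filter_upwards [hd0] with g hg x
        simp only [step]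
        rw [interpolate_apply_zero, hg x]
      · refine tendsto_interpolate hY ?_ hd (hec y g₀ (hF y hyF) C hC c₀) ?_ ?_
        · have h1 : Continuous fun a : T × C => φ y (z a.1) :=
            Continuous.subtype_mk ((f y).continuous.comp (hj.comp continuous_fst)) _
          exact h1.tendsto (g₀, c₀)
        · rw [nhds_prod_eq]
          filter_upwards [hsrc.prod_inl (𝓝 c₀)] with a ha
          exact ha a.2
        · exact hsrc.self_of_nhds c₀
  have hfinal := hlist l₂ (fun y hy => hsub y (by simp [hl, hy])) (e y₁)
    (by filter_upwards [hball y₁ hy₁F] with g hg x using (he y₁ g hg).source x)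
    (hec y₁ g₀ (hF y₁ hy₁F) C hC c₀)
  unfold ContinuousAt
  rw [← hstart.self_of_nhds c₀] at hfinal
  refine hfinal.congr' ?_
  rw [nhds_prod_eq]
  filter_upwards [hstart.prod_inl (𝓝 c₀)] with a ha
  exact (ha a.2).symm

end Deformation

/-! ### Lifts between nearby maps, for finitely generated fundamental groups -/

section FinitelyGenerated

open Set Metric unitInterval Filter GeodesicSpace

/-- In a length space each compact set lies in a connected compact set: join the points of finer and
finer finite nets by short paths. -/
theorem IsLengthSpace.exists_isPreconnected_superset {X : Type u} [MetricSpace X]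
    (hX : IsLengthSpace X) {C : Set X} (hC : IsCompact C) :
    ∃ K, IsCompact K ∧ _root_.IsPreconnected K ∧ C ⊆ K := by
  obtain rfl | ⟨x₀, hx₀⟩ := C.eq_empty_or_nonempty
  · exact ⟨∅, isCompact_empty, isPreconnected_empty, Subset.rfl⟩
  obtain ⟨R, hR⟩ := hC.isBounded.subset_ball x₀
  have net : ∀ n : ℕ, ∃ t ⊆ C, t.Finite ∧ C ⊆ ⋃ y ∈ t, ball y (1 / ((n : ℝ) + 1)) := fun n =>
    hC.finite_cover_balls (by positivity)
  choose t' ht'C ht'f ht'c using net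
  -- the first net consists of the base point only
  obtain ⟨t, ε, ht0, hε, htC, htf, htc⟩ : ∃ (t : ℕ → Set X) (ε : ℕ → ℝ), t 0 = {x₀} ∧
      (∀ n : ℕ, ε (n + 1) = 1 / ((n : ℝ) + 1)) ∧ (∀ n, t n ⊆ C) ∧ (∀ n, (t n).Finite) ∧
      ∀ n, ∀ y ∈ C, ∃ q ∈ t n, y ∈ ball q (ε n) := by
    refine ⟨fun n => Nat.casesOn n {x₀} t', fun n => Nat.casesOn n R fun n => 1 / ((n : ℝ) + 1),
      rfl, fun n => rfl, ?_, ?_, ?_⟩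
    · rintro (_ | n)
      exacts [singleton_subset_iff.2 hx₀, ht'C n]
    · rintro (_ | n)
      exacts [finite_singleton x₀, ht'f n]
    · rintro (_ | n) y hy
      · exact ⟨x₀, rfl, hR hy⟩
      · obtain ⟨p, hp, hy⟩ := mem_iUnion₂.1 (ht'c n hy)
        exact ⟨p, hp, hy⟩
  choose! q hqt hq using htc
  have hpath : ∀ n, ∀ p ∈ C, ∃ γ : Path (q n p) p, ∀ s, γ s ∈ ball (q n p) (ε n) := fun n p hp =>
    hX.joinedIn_ball (hq n p hp)
  choose γ hγ using hpath
  let D : ℕ → Set X := fun n => ⋃ p : t (n + 1), range (γ n p (htC (n + 1) p.2))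
  have hDc : ∀ n, IsCompact (D n) := fun n => by
    have := (htf (n + 1)).to_subtype
    exact isCompact_iUnion fun p => isCompact_range (γ n p _).continuous
  have hDt : ∀ n, D n ⊆ thickening (ε n) C := fun n x hx => by
    obtain ⟨p, s, rfl⟩ := mem_iUnion.1 hx
    exact mem_thickening_iff.2 ⟨q n p, htC n (hqt n p (htC _ p.2)), hγ n p _ s⟩
  have hmem : ∀ n, ∀ p ∈ t (n + 1), ∀ s, ∀ hp, γ n p hp s ∈ ⋃ n, D n := fun n p hp s hp' =>
    mem_iUnion.2 ⟨n, mem_iUnion.2 ⟨⟨p, hp⟩, s, rfl⟩⟩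
  have hx₀D : x₀ ∈ ⋃ n, D n := by
    obtain ⟨p, hp⟩ : (t 1).Nonempty := ⟨q 1 x₀, hqt 1 x₀ hx₀⟩
    have := hmem 0 p hp 0 (htC _ hp)
    rw [Path.source] at this
    rwa [show q 0 p = x₀ by simpa [ht0] using hqt 0 p (htC _ hp)] at this
  have hjoin : ∀ n, ∀ p ∈ t n, JoinedIn (⋃ n, D n) x₀ p := by
    intro n
    induction n with
    | zero =>
      intro p hp
      obtain rfl : p = x₀ := by simpa [ht0] using hp
      exact JoinedIn.refl hx₀D
    | succ n ih =>
      intro p hp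
      exact (ih _ (hqt n p (htC _ hp))).trans ⟨γ n p (htC _ hp), fun s => hmem n p hp s _⟩
  have hconn : IsPathConnected (⋃ n, D n) := by
    refine ⟨x₀, hx₀D, fun {y} hy => ?_⟩
    obtain ⟨n, hy⟩ := mem_iUnion.1 hy
    obtain ⟨p, s, rfl⟩ := mem_iUnion.1 hy
    refine (hjoin n _ (hqt n p (htC _ p.2))).trans
      ⟨((γ n p (htC _ p.2)).truncateOfLE s.2.1).cast (by simp) (by simp), fun s' => ?_⟩
    exact hmem n p p.2 _ _
  refine ⟨C ∪ ⋃ n, D n, ?_, ?_, subset_union_left⟩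
  · refine isCompact_of_finite_subcover fun U hU hcover => ?_
    obtain ⟨s, hs⟩ := hC.elim_finite_subcover U hU (subset_union_left.trans hcover)
    obtain ⟨δ, hδ, hsub⟩ := hC.exists_thickening_subset_open
      (isOpen_biUnion fun i (_ : i ∈ s) => hU i) hs
    obtain ⟨N, hN⟩ := exists_nat_one_div_lt hδ
    obtain ⟨s', hs'⟩ := ((finite_lt_nat (N + 1)).isCompact_biUnion fun n _ =>
      hDc n).elim_finite_subcover U hU
      ((iUnion₂_subset fun n _ => subset_iUnion D n).trans (subset_union_right.trans hcover))
    classical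
    refine ⟨s ∪ s', union_subset (hs.trans ?_) (iUnion_subset fun n => ?_)⟩
    · exact biUnion_subset_biUnion_left fun i hi => Finset.mem_union_left _ hi
    by_cases hn : n < N + 1
    · exact (subset_biUnion_of_mem (u := D) (show n ∈ {i | i < N + 1} from hn)).trans (hs'.trans
        (biUnion_subset_biUnion_left fun i hi => Finset.mem_union_right _ hi))
    · obtain ⟨m, rfl⟩ : ∃ m, n = m + 1 := ⟨n - 1, by omega⟩
      have hle : ε (m + 1) ≤ δ := by
        refine le_trans (hε m).le (le_trans ?_ hN.le)
        have : (N : ℝ) ≤ m := by exact_mod_cast (by omega : N ≤ m)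
        exact one_div_le_one_div_of_le (by positivity) (by linarith)
      exact (hDt _).trans ((thickening_mono hle C).trans (hsub.trans
        (biUnion_subset_biUnion_left fun i hi => Finset.mem_union_left _ hi)))
  · refine hconn.isConnected.isPreconnected.subset_closure subset_union_right
      (union_subset (fun y hy => Metric.mem_closure_iff.2 fun δ hδ => ?_) subset_closure)
    obtain ⟨N, hN⟩ := exists_nat_one_div_lt hδ
    refine ⟨q (N + 1) y, ?_, (hq (N + 1) y hy).trans_eq (hε N) |>.trans hN⟩
    have h := hqt (N + 1) y hy
    have := hmem N _ h 1 (htC _ h)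
    rwa [Path.target] at this

variable {X : Type u} {Y : Type v} [MetricSpace X] [MetricSpace Y] [CompleteSpace Y]
  {hY : IsLocallyBusemann Y}

/-- Over a parameter space, two maps at small distance are joined by a continuous family of short
classes. -/
theorem exists_short_classes {A : Type w} [TopologicalSpace A] {p q : A → Y} (hp : Continuous p)
    (hq : Continuous q) {ε : ℝ} (hε : 0 < ε) (hb : ∀ a, IsBusemannBall (q a) (2 * ε))
    (h : ∀ a, dist (p a) (q a) < ε) :
    ∃ κ : ∀ a, Path.Homotopic.Quotient (p a) (q a), ContinuousClasses hY κ ∧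
      ∀ a, dist (geo hY (κ a)) (const (q a)) < ε := by
  choose κ hκ using fun a => exists_short (hY := hY) hε (hb a) (h a)
  refine ⟨κ, continuous_iff_continuousAt.2 fun a => ?_, hκ⟩
  have hdist : ∀ a, dist (geo hY (κ a)) (const (q a)) = dist (p a) (q a) := fun a => by
    rw [← dist_ends_of_mem_ball (c := const (q a)) (fun _ => hb a) (hκ a) (mem_ball_self hε),
      ends_geo]
    exact max_eq_left ((dist_self (q a)).trans_le dist_nonneg)
  have hcont : Tendsto (fun b => dist (p b) (q b) + dist (const (q b)) (const (q a))) (𝓝 a)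
      (𝓝 (dist (p a) (q a) + dist (const (q a)) (const (q a)))) :=
    Continuous.tendsto ((hp.dist hq).add
      ((GeodesicSpace.continuous_const.comp hq).dist _root_.continuous_const)) a
  rw [dist_self, add_zero] at hcont
  have hnear : ∀ᶠ b in 𝓝 a, geo hY (κ b) ∈ ball (const (q a)) ε := by
    filter_upwards [hcont.eventually (gt_mem_nhds (h a))] with b hb
    exact (dist_triangle _ (const (q b)) _).trans_lt (by rw [hdist b]; exact hb)
  refine tendsto_iff_dist_tendsto_zero.2 ?_
  have hz : Tendsto (fun b => dist (p b, q b) (p a, q a)) (𝓝 a) (𝓝 0) :=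
    tendsto_iff_dist_tendsto_zero.1 ((hp.prodMk hq).tendsto a)
  refine hz.congr' ?_
  filter_upwards [hnear] with b hb'
  rw [← dist_ends_of_mem_ball (c := const (q a)) (fun _ => hb a) hb' (hκ a), ends_geo, ends_geo]

omit [CompleteSpace Y] in
/-- The classes of loops which are intertwined by a given class form a subgroup. -/
theorem intertwine_of_closure_eq_top {x₀ : X} {f g : C(X, Y)}
    (κ : Path.Homotopic.Quotient (f x₀) (g x₀)) {G : Set (FundamentalGroup X x₀)}
    (hG : Subgroup.closure G = ⊤)
    (h : ∀ u ∈ G, κ.trans (u.toPath.map g) = (u.toPath.map f).trans κ) (γ : Path x₀ x₀) :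
    κ.trans (.mk (γ.map g.continuous)) =
      (Path.Homotopic.Quotient.mk (γ.map f.continuous)).trans κ := by
  have hmem : FundamentalGroup.fromPath (.mk γ) ∈ Subgroup.closure G := by
    rw [hG]
    trivial
  have key : ∀ u ∈ Subgroup.closure G,
      κ.trans ((FundamentalGroup.toPath u).map g) = ((FundamentalGroup.toPath u).map f).trans κ := by
    intro u hu
    induction hu using Subgroup.closure_induction with
    | mem u hu => exact h u hu
    | one =>
      exact (Path.Homotopic.Quotient.trans_refl κ).trans (Path.Homotopic.Quotient.refl_trans κ).symm
    | mul u v _ _ hu hv =>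
      have hm : ∀ k : C(X, Y), (FundamentalGroup.toPath (u * v)).map k =
          ((FundamentalGroup.toPath v).map k).trans ((FundamentalGroup.toPath u).map k) := by
        intro k
        induction u using Path.Homotopic.Quotient.ind with | mk α =>
        induction v using Path.Homotopic.Quotient.ind with | mk β =>
        exact congrArg Path.Homotopic.Quotient.mk (Path.map_trans β α k.continuous)
      rw [hm, hm, ← Path.Homotopic.Quotient.trans_assoc, hv, Path.Homotopic.Quotient.trans_assoc, hu,
        Path.Homotopic.Quotient.trans_assoc]
    | inv u _ hu =>
      have hm : ∀ k : C(X, Y), (FundamentalGroup.toPath u⁻¹).map k =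
          ((FundamentalGroup.toPath u).map k).symm := by
        intro k
        induction u using Path.Homotopic.Quotient.ind with | mk α => rfl
      rw [hm, hm]
      have h1 := congrArg (fun c => (((FundamentalGroup.toPath u).map f).symm.trans c).trans
        ((FundamentalGroup.toPath u).map g).symm) hu
      simp only [Path.Homotopic.Quotient.symm_trans_cancel_left,
        Path.Homotopic.Quotient.trans_assoc, Path.Homotopic.Quotient.trans_symm,
        Path.Homotopic.Quotient.trans_refl] at h1
      exact h1.symm
  exact key _ hmem

/-- If the fundamental group of `X` is finitely generated, then maps that are close in the
compact-open topology are joined by geodesics which are short on a given compact set. -/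
theorem eventually_exists_short_lift (hY : IsLocallyBusemann Y) (hX : IsLengthSpace X) {x₀ : X}
    (hfg : Group.FG (FundamentalGroup X x₀)) (g₀ : LipSpace X Y) {C : Set X} (hC : IsCompact C)
    {r : ℝ} (hr : 0 < r) :
    ∀ᶠ g : LipSpace X Y in 𝓝 g₀, ∃ ν : ∀ x, Path.Homotopic.Quotient (g.1 x) (g₀.1 x),
      ContinuousClasses hY ν ∧
      ∀ x ∈ C, dist (geo hY (ν x)) (const (g₀.1 x)) < r := by
  have : Nonempty X := ⟨x₀⟩
  have := hX.pathConnectedSpace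
  have := hX.locallyPathConnectedSpace
  obtain ⟨G, hG, hGf⟩ := Group.fg_iff.1 hfg
  choose γ hγ using fun u : FundamentalGroup X x₀ =>
    Path.Homotopic.Quotient.mk_surjective (FundamentalGroup.toPath u)
  obtain ⟨K, hK, hKc, hCK⟩ := hX.exists_isPreconnected_superset ((hC.insert x₀).union
    (hGf.isCompact_biUnion fun u _ => isCompact_range (γ u).continuous))
  obtain ⟨ε, hε, hb⟩ := exists_radius_of_isCompact hY (hK.image g₀.1.continuous)
  have hr' : 0 < min r ε := lt_min hr hε
  have hnear : ∀ᶠ g : LipSpace X Y in 𝓝 g₀, ∀ x ∈ K, dist (g₀.1 x) (g.1 x) < min r ε :=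
    Metric.tendstoUniformlyOn_iff.1 (ContinuousMap.tendsto_iff_forall_isCompact_tendstoUniformlyOn.1
      (continuous_subtype_val.tendsto g₀) K hK) _ hr'
  filter_upwards [hnear] with g hg
  have hx₀ : x₀ ∈ K := hCK (Or.inl (mem_insert _ _))
  have : PreconnectedSpace K := isPreconnected_iff_preconnectedSpace.1 hKc
  obtain ⟨κ, hκ, hκs⟩ := exists_short_classes (hY := hY) (A := K) (p := fun x => g.1 x)
    (q := fun x => g₀.1 x) (by fun_prop) (by fun_prop) hr'
    (fun x => (hb _ (mem_image_of_mem _ x.2)).mono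
      (ball_subset_ball (by linarith [min_le_right r ε])))
    fun x => by rw [dist_comm]; exact hg x x.2
  obtain ⟨ν, hν, hν₀⟩ := ContinuousClasses.exists_of_intertwine (hY := hY) (A := X) (p := g.1)
    (q := g₀.1) (a₀ := x₀) g.1.continuous g₀.1.continuous (κ ⟨x₀, hx₀⟩)
    (intertwine_of_closure_eq_top _ hG fun u hu => by
      have hrange : ∀ s, γ u s ∈ K := fun s =>
        hCK (Or.inr (mem_biUnion hu (mem_range_self s)))
      have := hκ.naturality (a := ⟨x₀, hx₀⟩) (b := ⟨x₀, hx₀⟩)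
        ⟨⟨fun s => ⟨γ u s, hrange s⟩, by fun_prop⟩, by simp, by simp⟩ (by fun_prop) (by fun_prop)
      rw [← hγ u]
      exact this)
  refine ⟨ν, hν, fun x hx => ?_⟩
  have hxK : x ∈ K := hCK (Or.inl (mem_insert_of_mem _ hx))
  have heq := (hν.comp (f := ((↑) : K → X)) continuous_subtype_val).eq_of_eq hκ
    (a := ⟨x₀, hx₀⟩) hν₀
  have h1 := hκs ⟨x, hxK⟩
  rw [← congrFun heq ⟨x, hxK⟩] at h1
  exact h1.trans_le (min_le_left _ _)

end FinitelyGenerated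

/-! ### Homotopy equivalences -/

section HomotopyEquiv

open Set Metric unitInterval Filter GeodesicSpace

variable {X : Type u} {Y : Type v} [MetricSpace X] [MetricSpace Y] [CompleteSpace Y]
  {hY : IsLocallyBusemann Y}

variable (hY) in
/-- The intermediate maps of a geodesic lift. -/
theorem IsGeodesicLift.exists_map (hX : IsLengthSpace X) {S : Set (LipSpace X Y)}
    {g : LipSpace X Y} {e : X → GeodesicSpace Y} (he : IsGeodesicLift S g e) (t : I) :
    ∃ h : LipSpace X Y, (∀ x, h.1 x = (e x).1 t) ∧
      ∀ S', S ⊆ S' → IsGeodesicallyConvex hY S' → g ∈ S' → h ∈ S' := by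
  obtain ⟨b, hb, κ, hκ, rfl⟩ := he.exists_classes hY
  exact ⟨geodesicMap hX hκ t, fun x => rfl, fun S' hSS' hS' hg =>
    hS' g hg b (hSS' hb) κ hκ t _ fun x => rfl⟩

omit [CompleteSpace Y] in
theorem LipSpace.continuous_of_isCompact {A : Type w} [TopologicalSpace A] {F : A → LipSpace X Y}
    (h : ∀ K : Set X, IsCompact K → Continuous fun z : A × K => (F z.1).1 z.2) : Continuous F := by
  refine Continuous.subtype_mk ?_ _
  rw [ContinuousMap.compactOpen_eq_iInf_induced]
  refine continuous_iInf_rng.2 fun K => continuous_iInf_rng.2 fun hK => continuous_induced_rng.2 ?_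
  exact ContinuousMap.continuous_of_continuous_uncurry _ (h K hK)

omit [CompleteSpace Y] in
theorem LipSpace.continuous_of_lipConst_le {A : Type w} [TopologicalSpace A]
    {F : A → LipSpace X Y} {L : ℝ} (hF : ∀ a, lipConst (F a) ≤ L)
    (hc : ∀ x, Continuous fun a => (F a).1 x) : Continuous F := by
  obtain h | ⟨⟨a₀⟩⟩ := isEmpty_or_nonempty A
  · exact continuous_of_const fun a => h.elim a
  lift L to ℝ≥0 using (lipConst_nonneg (F a₀)).trans (hF a₀)
  exact Continuous.subtype_mk (ContinuousMap.continuous_of_lipschitzWith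
    (fun a => (lipConst_le_iff _ _).1 (hF a)) hc) _

theorem isGeodesicallyConvex_setOf_lipConst_le (hX : IsLengthSpace X) (L : ℝ) :
    IsGeodesicallyConvex hY {f : LipSpace X Y | lipConst f ≤ L} := by
  intro f hf g hg κ hκ t h hh
  have hfg : g ∈ pathComponent f := ⟨geodesicMapPath hX hκ⟩
  exact ((isGeodesicallyConnected_lipComponent hX f L).mem f ⟨mem_pathComponent_self f, hf⟩ g
    ⟨hfg, hg⟩ κ hκ t h hh).2

/-- If the fundamental group is finitely generated, then nearby maps are homotopic. -/
theorem eventually_joined (hY : IsLocallyBusemann Y) (hX : IsLengthSpace X) {x : X}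
    (hfg : Group.FG (FundamentalGroup X x)) (g₀ : LipSpace X Y) : ∀ᶠ g in 𝓝 g₀, Joined g g₀ := by
  filter_upwards [eventually_exists_short_lift hY hX hfg g₀ isCompact_empty one_pos] with g hg
  obtain ⟨ν, hν, -⟩ := hg
  exact ⟨geodesicMapPath hX hν⟩

/-- Path components are open, hence closed, too. -/
theorem connectedComponent_eq_pathComponent (hY : IsLocallyBusemann Y) (hX : IsLengthSpace X)
    {x : X} (hfg : Group.FG (FundamentalGroup X x)) (f : LipSpace X Y) :
    connectedComponent f = pathComponent f := by
  refine Subset.antisymm (IsClopen.connectedComponent_subset ⟨⟨?_⟩, ?_⟩ (mem_pathComponent_self f))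
    (pathComponent_subset_component f)
  · refine isOpen_iff_mem_nhds.2 fun g hg => ?_
    filter_upwards [eventually_joined hY hX hfg g] with h hh hfh
    exact hg (Joined.trans hfh hh)
  · refine isOpen_iff_mem_nhds.2 fun g hg => ?_
    filter_upwards [eventually_joined hY hX hfg g] with h hh
    exact Joined.trans hg hh.symm

/-- The homotopy inverse moves each map in the component to an `L`-Lipschitz map, along a geodesic
homotopy that depends continuously on the map. -/
theorem isHomotopyEquiv_lipComponentInclusion (hY : IsLocallyBusemann Y) (hX : IsLengthSpace X)
    {x₀ : X} (hfg : Group.FG (FundamentalGroup X x₀)) (f : LipSpace X Y) {L : ℝ}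
    (hne : (lipComponent f L).Nonempty) : IsHomotopyEquiv (lipComponentInclusion f L) := by
  have hK := isGeodesicallyConnected_pathComponent (hY := hY) hX f
  have hS : IsGeodesicallyConvex hY (lipComponent f L) :=
    (isGeodesicallyConnected_lipComponent hX f L).mem
  obtain ⟨b, hb⟩ := hne
  obtain ⟨E, hE, hEc⟩ := exists_continuous_lift hX x₀ (T := pathComponent f) (j := Subtype.val)
    (by fun_prop) (𝒞 := {C | IsCompact C ∧ x₀ ∈ C}) (fun C hC => hC.2)
    (fun g₀ C hC r hr => (continuous_subtype_val.tendsto g₀).eventually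
      (eventually_exists_short_lift hY hX hfg g₀.1 hC.1 hr)) hS fun g => by
        obtain ⟨κ, hκ⟩ := hK.exists_classes g g.2 b hb.1
        exact ⟨_, .of_classes hb hκ⟩
  choose H hH hHS using fun (t : I) g => (hE g).exists_map hY hX t
  have hHc : Continuous fun z : I × pathComponent f => H z.1 z.2 := by
    refine LipSpace.continuous_of_isCompact fun K hK => ?_
    have h1 := hEc (insert x₀ K) ⟨hK.insert x₀, mem_insert _ _⟩
    have h2 : Continuous fun z : (I × pathComponent f) × K => (z.1.2,
        (⟨z.2, mem_insert_of_mem _ z.2.2⟩ : (insert x₀ K : Set X))) := by fun_prop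
    have h3 : Continuous fun z : (I × pathComponent f) × K => ((E z.1.2 z.2).1, z.1.1) :=
      (continuous_subtype_val.comp (h1.comp h2)).prodMk (by fun_prop)
    simp only [hH]
    exact continuous_eval.comp h3
  have h0 : ∀ g, H 0 g = g := fun g =>
    LipSpace.ext_apply fun x => (hH 0 g x).trans ((hE g).source x)
  have h1 : ∀ g, H 1 g ∈ lipComponent f L := fun g => by
    obtain ⟨c, hc, hcE⟩ := (hE g).target
    rwa [show H 1 g = c from LipSpace.ext_apply fun x => (hH 1 g x).trans (hcE x)]
  have hsub : lipComponent f L ⊆ pathComponent f := fun g hg => hg.1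
  let r : C(pathComponent f, lipComponent f L) := ⟨fun g => ⟨H 1 g, h1 g⟩,
    (hHc.comp (Continuous.prodMk_right (1 : I))).subtype_mk _⟩
  refine ⟨⟨lipComponentInclusion f L, r, ?_, ?_⟩, rfl⟩
  · refine ContinuousMap.Homotopic.symm ⟨⟨⟨fun z => ⟨H z.1 ⟨z.2, hsub z.2.2⟩,
      hHS _ _ _ Subset.rfl hS z.2.2⟩, ?_⟩, ?_, ?_⟩⟩
    · exact (hHc.comp (f := fun z : I × lipComponent f L => (z.1, (⟨z.2, hsub z.2.2⟩ :
        pathComponent f))) (by fun_prop)).subtype_mk _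
    · exact fun g => Subtype.ext (h0 _)
    · exact fun g => rfl
  · refine ContinuousMap.Homotopic.symm ⟨⟨⟨fun z => ⟨H z.1 z.2,
      hHS _ _ _ hsub hK.mem z.2.2⟩, hHc.subtype_mk _⟩, ?_, ?_⟩⟩
    · exact fun g => Subtype.ext (h0 g)
    · exact fun g => rfl

end HomotopyEquiv

/-! ### Locally path connected families of maps -/

section LocallyPathConnected

open Set Metric unitInterval Filter GeodesicSpace

variable (X : Type u) [TopologicalSpace X]

/-- The finest topology on `X` with the same singular simplices. -/
abbrev SimplexGenerated : Type u :=
  Topology.WithGeneratedByTopology (fun n : ℕ => stdSimplex ℝ (Fin (n + 1))) X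

instance SimplexGenerated.locallyPathConnectedSpace :
    LocallyPathConnectedSpace (SimplexGenerated X) := by
  have : ∀ x : (n : ℕ) × C(stdSimplex ℝ (Fin (n + 1)), X),
      LocallyPathConnectedSpace (stdSimplex ℝ (Fin (x.1 + 1))) := fun x =>
    (convex_stdSimplex ℝ _).locallyPathConnectedSpace
  have h := LocallyPathConnectedSpace.coinduced
    (fun x : (f : (n : ℕ) × C(stdSimplex ℝ (Fin (n + 1)), X)) × stdSimplex ℝ (Fin (f.1 + 1)) =>
      x.1.2 x.2)
  rw [← TopologicalSpace.generatedBy_eq_coinduced (Y := X)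
    (fun n : ℕ => stdSimplex ℝ (Fin (n + 1)))] at h
  exact h

variable {Y : Type v} [MetricSpace Y] [CompleteSpace Y] {hY : IsLocallyBusemann Y}

/-- The class of a path that stays in a small ball about its target is short. -/
theorem dist_geo_mk_lt {z : Y} {ε : ℝ} (hε : 0 < ε) (hz : IsBusemannBall z (2 * ε)) {p : Y}
    (α : Path p z) (hα : ∀ s, dist (α s) z < ε) : dist (geo hY (.mk α)) (const z) < ε := by
  obtain ⟨α, rfl, rfl⟩ := α
  obtain ⟨κ, hκ, hκε⟩ := exists_short_classes (hY := hY) α.continuous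
    (_root_.continuous_const (y := α.toFun 1)) hε (fun _ => hz) hα
  have h1 : κ 1 = .refl _ := short_unique hz (hκε 1) (by rw [geo_refl]; exact mem_ball_self hε)
  have h2 := hκ.naturality (a := 0) (b := 1) ⟨.id I, rfl, rfl⟩ α.continuous _root_.continuous_const
  rw [h1] at h2
  have h3 : κ 0 = .mk ⟨α, rfl, rfl⟩ := by
    refine (Path.Homotopic.Quotient.trans_refl _).symm.trans (h2.trans ?_)
    exact Path.Homotopic.Quotient.trans_refl _
  rw [← h3]
  exact hκε 0

end LocallyPathConnected

section

open Set Metric unitInterval Filter GeodesicSpace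

variable {X : Type u} {Y : Type v} [MetricSpace X] [MetricSpace Y] [CompleteSpace Y]

/-- In a locally path connected family of maps, nearby members are joined by homotopies which are
short over a given compact set. -/
theorem eventually_exists_short_lift_of_locallyPathConnectedSpace (hY : IsLocallyBusemann Y)
    {T : Type w} [TopologicalSpace T] [LocallyPathConnectedSpace T] {j : T → LipSpace X Y}
    (hj : Continuous j) (g₀ : T) {C : Set X} (hC : IsCompact C) {r : ℝ} (hr : 0 < r) :
    ∀ᶠ g in 𝓝 g₀, ∃ ν : ∀ x, Path.Homotopic.Quotient ((j g).1 x) ((j g₀).1 x),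
      ContinuousClasses hY ν ∧ ∀ x ∈ C, dist (geo hY (ν x)) (const ((j g₀).1 x)) < r := by
  obtain ⟨ε, hε, hb⟩ := exists_radius_of_isCompact hY (hC.image (j g₀).1.continuous)
  have hδ : 0 < min r ε := lt_min hr hε
  have hU : ∀ᶠ g in 𝓝 g₀, ∀ x ∈ C, dist ((j g₀).1 x) ((j g).1 x) < min r ε :=
    Metric.tendstoUniformlyOn_iff.1 (ContinuousMap.tendsto_iff_forall_isCompact_tendstoUniformlyOn.1
      ((continuous_subtype_val.comp hj).tendsto g₀) C hC) _ hδ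
  filter_upwards [pathComponentIn_mem_nhds hU] with g hg
  obtain ⟨γ, hγ⟩ := hg.symm
  refine ⟨_, LipSpace.continuousClasses_track (γ.map hj), fun x hx => ?_⟩
  refine (dist_geo_mk_lt hδ ((hb _ (mem_image_of_mem _ hx)).mono
    (ball_subset_ball ?_)) _ fun s => ?_).trans_le
    (min_le_left _ _)
  · linarith [min_le_right r ε]
  · rw [dist_comm]
    exact hγ s x hx

end

/-! ### Injectivity in singular homology -/

section Retraction

open Set unitInterval Filter GeodesicSpace

variable {X : Type u} {Y : Type v} [MetricSpace X] [MetricSpace Y] [CompleteSpace Y]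

/-- A locally path connected family of maps can be deformed to `L`-Lipschitz maps wherever this is
possible for each member of the family, in such a way that the members which are `L`-Lipschitz
already stay so during the deformation. -/
theorem exists_deformation_lipConst_le (hY : IsLocallyBusemann Y) (hX : IsLengthSpace X)
    {T : Type w} [TopologicalSpace T] [LocallyPathConnectedSpace T] {j : T → LipSpace X Y} (hj : Continuous j)
    {L : ℝ} (hne : ∃ f : LipSpace X Y, lipConst f ≤ L) :
    ∃ r : C(T, {f : LipSpace X Y // lipConst f ≤ L}), ∀ {A : Type w} [TopologicalSpace A]
      (i : C(A, T)) (k : C(A, {f : LipSpace X Y // lipConst f ≤ L})), (∀ a, j (i a) = k a) →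
        k.Homotopic (r.comp i) := by
  obtain ⟨a₀, ha₀⟩ := hne
  obtain h | ⟨⟨x₀⟩⟩ := isEmpty_or_nonempty X
  · refine ⟨.const T ⟨a₀, ha₀⟩, fun i k _ => ?_⟩
    convert ContinuousMap.Homotopic.refl k
    ext a x
    exact h.elim x
  have hS := isGeodesicallyConvex_setOf_lipConst_le (hY := hY) (X := X) hX L
  let U : Set T := {g | ∃ a : LipSpace X Y, lipConst a ≤ L ∧ Joined (j g) a}
  have hlocal : ∀ g₀ : T, ∀ C ∈ {C : Set X | IsCompact C ∧ x₀ ∈ C}, ∀ r > 0, ∀ᶠ g in 𝓝 g₀,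
      ∃ ν : ∀ x, Path.Homotopic.Quotient ((j g).1 x) ((j g₀).1 x), ContinuousClasses hY ν ∧
        ∀ x ∈ C, dist (geo hY (ν x)) (const ((j g₀).1 x)) < r := fun g₀ C hC r hr =>
    eventually_exists_short_lift_of_locallyPathConnectedSpace hY hj g₀ hC.1 hr
  have hjoin : ∀ g₀, ∀ᶠ g in 𝓝 g₀, Joined (j g) (j g₀) := fun g₀ => by
    filter_upwards [hlocal g₀ {x₀} ⟨isCompact_singleton, rfl⟩ 1 one_pos] with g ⟨ν, hν, _⟩
    exact ⟨geodesicMapPath hX hν⟩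
  have hU : IsOpen U := isOpen_iff_mem_nhds.2 fun g₀ ⟨a, ha, h⟩ => by
    filter_upwards [hjoin g₀] with g hg using ⟨a, ha, hg.trans h⟩
  have hUc : IsOpen Uᶜ := isOpen_iff_mem_nhds.2 fun g₀ hg₀ => by
    filter_upwards [hjoin g₀] with g hg ⟨a, ha, h⟩ using hg₀ ⟨a, ha, hg.symm.trans h⟩
  obtain ⟨E, hE, hEc⟩ := exists_continuous_lift hX x₀ (T := U) (j := fun g => j g) (by fun_prop)
    (fun C hC => hC.2) (fun g₀ C hC r hr =>
      (continuous_subtype_val.tendsto g₀).eventually (hlocal g₀ C hC r hr)) hS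
    fun g => by
      obtain ⟨a, ha, ⟨γ⟩⟩ := g.2
      exact ⟨_, .of_classes ha (LipSpace.continuousClasses_track (hY := hY) γ)⟩
  choose H hH hHS using fun (t : I) g => (hE g).exists_map hY hX t
  have hEx : ∀ x, Continuous fun g => E g x := fun x =>
    (hEc {x₀, x} ⟨(toFinite _).isCompact, mem_insert _ _⟩).comp
      (f := fun g : U => (g, (⟨x, by simp⟩ : ({x₀, x} : Set X)))) (by fun_prop)
  have hHc : ∀ x, Continuous fun z : I × U => (H z.1 z.2).1 x := fun x => by
    simp only [hH]
    have : Continuous fun z : I × U => ((E z.2 x).1, z.1) :=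
      (continuous_subtype_val.comp ((hEx x).comp continuous_snd)).prodMk continuous_fst
    exact continuous_eval.comp this
  have h0 : ∀ g : U, H 0 g = j g := fun g =>
    LipSpace.ext_apply fun x => (hH 0 g x).trans ((hE g).source x)
  have h1 : ∀ g, lipConst (H 1 g) ≤ L := fun g => by
    obtain ⟨c, hc, hcE⟩ := (hE g).target
    rwa [show H 1 g = c from LipSpace.ext_apply fun x => (hH 1 g x).trans (hcE x)]
  classical
  let r : T → {f : LipSpace X Y // lipConst f ≤ L} := fun g =>
    if h : g ∈ U then ⟨H 1 ⟨g, h⟩, h1 _⟩ else ⟨a₀, ha₀⟩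
  have hr : Continuous r := by
    refine continuous_iff_continuousAt.2 fun g => ?_
    by_cases hg : g ∈ U
    · refine (hU.isOpenEmbedding_subtypeVal.continuousAt_iff (x := ⟨g, hg⟩)).1 ?_
      have : r ∘ Subtype.val = fun g : U => ⟨H 1 g, h1 g⟩ := funext fun g => dif_pos g.2
      rw [this]
      exact Continuous.continuousAt ((LipSpace.continuous_of_lipConst_le h1 fun x =>
        (hHc x).comp (Continuous.prodMk_right (1 : I))).subtype_mk _)
    · refine ContinuousAt.congr (f := fun _ => ⟨a₀, ha₀⟩) continuousAt_const ?_
      filter_upwards [hUc.mem_nhds hg] with g hg using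
        (dif_neg hg : r g = _).symm
  refine ⟨⟨r, hr⟩, fun {A} _ i k hik => ?_⟩
  have hi : ∀ a, i a ∈ U := fun a => ⟨k a, (k a).2, by rw [hik]⟩
  have hL : ∀ z : I × A, lipConst (H z.1 ⟨i z.2, hi z.2⟩) ≤ L := fun z =>
    hHS _ _ _ Subset.rfl hS (by simp only [hik]; exact (k z.2).2)
  refine ⟨⟨⟨fun z => ⟨H z.1 ⟨i z.2, hi z.2⟩, hL z⟩, ?_⟩, fun a => Subtype.ext ?_, fun a => ?_⟩⟩
  · exact (LipSpace.continuous_of_lipConst_le hL fun x => (hHc x).comp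
      (f := fun z : I × A => (z.1, (⟨i z.2, hi z.2⟩ : U))) (by fun_prop)).subtype_mk _
  · exact (h0 _).trans (hik a)
  · exact (dif_pos (hi a) : r (i a) = _).symm

end Retraction

section Homology

open AlgebraicTopology Limits

variable {R : Type v} [Ring R]

theorem isGeneratedBy_apply {ι : Type u} (F : ι → Type w) [∀ i, TopologicalSpace (F i)] (i : ι) :
    Topology.IsGeneratedBy F (F i) :=
  inferInstance

/-- The natural map from the topology generated by the singular simplices. -/
def SimplexGenerated.toTop (A : TopCat.{w}) : TopCat.of (SimplexGenerated A) ⟶ A :=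
  TopCat.ofHom ⟨Topology.WithGeneratedByTopology.equiv,
    Topology.WithGeneratedByTopology.continuous_equiv⟩

/-- A continuous map is continuous for the topologies generated by the singular simplices, too. -/
def SimplexGenerated.map {A B : TopCat.{w}} (f : A ⟶ B) :
    TopCat.of (SimplexGenerated A) ⟶ TopCat.of (SimplexGenerated B) :=
  TopCat.ofHom ⟨fun a => Topology.WithGeneratedByTopology.equiv.symm
    (f (Topology.WithGeneratedByTopology.equiv a)),
    (Topology.IsGeneratedBy.equiv_symm_comp_continuous_iff
      (X := fun n : ℕ => stdSimplex ℝ (Fin (n + 1))) _).2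
      (f.hom.continuous.comp Topology.WithGeneratedByTopology.continuous_equiv)⟩

theorem SimplexGenerated.map_toTop {A B : TopCat.{w}} (f : A ⟶ B) :
    SimplexGenerated.map f ≫ SimplexGenerated.toTop B = SimplexGenerated.toTop A ≫ f := rfl

/-- The two topologies have the same singular simplices. -/
instance SimplexGenerated.isIso_toSSet_map_toTop (A : TopCat.{w}) :
    IsIso (TopCat.toSSet.map (SimplexGenerated.toTop A)) := by
  refine (NatTrans.isIso_iff_isIso_app _).2 fun n => (isIso_iff_bijective _).2 ⟨?_, ?_⟩
  · intro a b h
    refine (TopCat.toSSetObjEquiv _ _).injective (ContinuousMap.ext fun z => ?_)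
    exact congrArg (fun c => TopCat.toSSetObjEquiv A n c z) h
  · intro b
    have hc : Continuous ((Topology.WithGeneratedByTopology.equiv
        (X := fun n : ℕ => stdSimplex ℝ (Fin (n + 1)))).symm ∘ TopCat.toSSetObjEquiv A n b) := by
      have : Topology.IsGeneratedBy (fun n : ℕ => stdSimplex ℝ (Fin (n + 1)))
          (stdSimplex ℝ (Fin (n.unop.len + 1))) :=
        isGeneratedBy_apply _ n.unop.len
      exact (Topology.IsGeneratedBy.equiv_symm_comp_continuous_iff _ _).2
        (ContinuousMap.continuous _)
    exact ⟨(TopCat.toSSetObjEquiv (.of (SimplexGenerated A)) n).symm ⟨_, hc⟩, rfl⟩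

instance SimplexGenerated.isIso_singularHomology_map_toTop (n : ℕ) (M : ModuleCat.{w} R)
    (A : TopCat.{w}) : IsIso ((singularHomology n M).map (SimplexGenerated.toTop A)) :=
  inferInstanceAs (IsIso ((HomologicalComplex.homologyFunctor _ _ n).map
    (((SSet.chainComplexFunctor (ModuleCat.{w} R)).obj M).map
      (TopCat.toSSet.map (SimplexGenerated.toTop A)))))

theorem singularHomology_map_eq_of_homotopic (n : ℕ) (M : ModuleCat.{w} R) {A B : TopCat.{w}}
    {f g : A ⟶ B} (h : f.hom.Homotopic g.hom) :
    (singularHomology n M).map f = (singularHomology n M).map g :=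
  TopCat.Homotopy.congr_homologyMap_singularChainComplexFunctor h.some M n

theorem isZero_singularHomology_of_isEmpty (n : ℕ) (M : ModuleCat.{w} R) (A : TopCat.{w})
    [IsEmpty A] : IsZero ((singularHomology n M).obj A) := by
  have : TotallyDisconnectedSpace A := ⟨fun _ _ _ a => (IsEmpty.false a).elim⟩
  obtain rfl | hn := eq_or_ne n 0
  · refine IsZero.of_iso ?_ (singularHomologyFunctorZeroOfTotallyDisconnectedSpace _ M A)
    exact (IsZero.iff_id_eq_zero _).2 (Sigma.hom_ext _ _ fun a => (IsEmpty.false a).elim)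
  · exact isZero_singularHomologyFunctor_of_totallyDisconnectedSpace _ n M A hn

variable {X : Type u} {Y : Type w} [MetricSpace X] [MetricSpace Y] [CompleteSpace Y]

/-- The inclusion of the `L`-Lipschitz maps into a larger family of Lipschitz maps is injective in
homology: after refining the topologies, the larger family can be retracted. -/
theorem singularHomology_map_injective (hY : IsLocallyBusemann Y) (hX : IsLengthSpace X) (n : ℕ)
    (M : ModuleCat.{max u w} R) {L : ℝ} {B : TopCat.{max u w}}
    (ι : TopCat.of {f : LipSpace X Y // lipConst f ≤ L} ⟶ B) {j : B → LipSpace X Y}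
    (hj : Continuous j) (hι : ∀ a, j (ι a) = a.1) :
    Function.Injective ((singularHomology n M).map ι).hom := by
  obtain h | ⟨⟨a₀⟩⟩ := isEmpty_or_nonempty {f : LipSpace X Y // lipConst f ≤ L}
  · have := ModuleCat.subsingleton_of_isZero (isZero_singularHomology_of_isEmpty n M
      (.of {f : LipSpace X Y // lipConst f ≤ L}))
    exact Function.injective_of_subsingleton _
  obtain ⟨r, hr⟩ := exists_deformation_lipConst_le hY hX
    (hj.comp (Topology.WithGeneratedByTopology.continuous_equiv
      (X := fun n : ℕ => stdSimplex ℝ (Fin (n + 1))))) ⟨a₀.1, a₀.2⟩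
  have h := singularHomology_map_eq_of_homotopic n M (f := SimplexGenerated.toTop _)
    (g := SimplexGenerated.map ι ≫ TopCat.ofHom r)
    (hr (SimplexGenerated.map ι).hom (SimplexGenerated.toTop _).hom fun a =>
      hι (Topology.WithGeneratedByTopology.equiv a))
  have h2 : IsIso ((singularHomology n M).map (SimplexGenerated.map ι) ≫
      (singularHomology n M).map (TopCat.ofHom r)) := by
    rw [← Functor.map_comp, ← h]
    infer_instance
  have h3 : Mono ((singularHomology n M).map (SimplexGenerated.map ι)) := mono_of_mono _
    ((singularHomology n M).map (TopCat.ofHom r))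
  have h4 : (singularHomology n M).map ι = inv ((singularHomology n M).map
      (SimplexGenerated.toTop _)) ≫ (singularHomology n M).map (SimplexGenerated.map ι) ≫
        (singularHomology n M).map (SimplexGenerated.toTop B) := by
    rw [IsIso.eq_inv_comp, ← Functor.map_comp, ← Functor.map_comp, SimplexGenerated.map_toTop]
  refine (ModuleCat.mono_iff_injective _).1 ?_
  rw [h4]
  infer_instance

theorem persistentHomology_lipConst_map_injective (hY : IsLocallyBusemann Y) (hX : IsLengthSpace X)
    (n : ℕ) (M : ModuleCat.{max u w} R) (s t : ℝ) (hst : s ≤ t) : Function.Injective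
      ((persistentHomology n (lipConst (X := X) (Y := Y)) M).map (homOfLE hst)).hom :=
  singularHomology_map_injective hY hX n M
    ((sublevelFunctor (lipConst (X := X) (Y := Y))).map (homOfLE hst))
    (j := Subtype.val) continuous_subtype_val fun _ => rfl

end Homology

/-! ### Bars of persistence modules with injective transition maps -/

section Bars

variable {k : Type w} [Field k] {M : ℝ ⥤ ModuleCat.{w} k}

/-- If `k_I` is a summand of `M`, then the class `1` at a point of `I` survives in `M` forever,
whence in `k_I`. -/
theorem IsBar.not_bddAbove (hM : ∀ s t (hst : s ≤ t), Function.Injective (M.map (homOfLE hst)).hom)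
    {I : Set ℝ} (hI : IsBar M I) : ¬ BddAbove I := by
  obtain ⟨⟨i, hi⟩, hconn, ⟨h⟩⟩ := hI
  rintro ⟨b, hb⟩
  have hib : i ≤ b + 1 := (hb hi).trans (by linarith)
  have hbI : b + 1 ∉ I := fun h => by linarith [hb h]
  let x : intervalFiber k I i := ⟨1, fun hi' => (hi' hi).elim⟩
  have hx : intervalMap k I i (b + 1) x = 0 := Subtype.ext (if_neg hbI)
  have h1 : (M.map (homOfLE hib)).hom ((h.i.app i).hom x) = 0 := by
    have h2 := congrArg (fun f => f.hom x) (h.i.naturality (homOfLE hib))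
    refine (h2.symm.trans ?_)
    exact (congrArg (h.i.app (b + 1)).hom hx).trans (map_zero _)
  have h3 : (h.i.app i).hom x = 0 := hM _ _ hib (h1.trans (map_zero _).symm)
  have h4 : (h.r.app i).hom ((h.i.app i).hom x) = x :=
    congrArg (fun f => (f.app i).hom x) h.retract
  rw [h3, map_zero] at h4
  exact zero_ne_one (congrArg Subtype.val h4)

theorem NoFiniteBars.of_injective
    (hM : ∀ s t (hst : s ≤ t), Function.Injective (M.map (homOfLE hst)).hom) : NoFiniteBars M where
  not_bddAbove _ hI := hI.not_bddAbove hM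
  multiplicity_eq_zero a b c d hab hbc hcd := by
    have hV : LinearMap.range (M.map (homOfLE hbc)).hom ⊓
        LinearMap.ker (M.map (homOfLE hcd.le)).hom = ⊥ := by
      rw [LinearMap.ker_eq_bot.2 (hM _ _ hcd.le), inf_bot_eq]
    unfold barMultiplicity
    rw [hV]
    exact rank_subsingleton' _ _

end Bars

theorem theoremA {X : Type u} {Y : Type v} [MetricSpace X] [MetricSpace Y] [CompleteSpace Y]
    (hX : IsLengthSpace X) (hcover : AdmitsUniversalCover X) (hY : IsLocallyCAT0 Y) :
    -- a cycle of `L`-Lipschitz maps which bounds later bounds already among `L`-Lipschitz maps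
    (∀ (R : Type w) [Ring R] (M : ModuleCat.{max u v} R) (n : ℕ),
      (∀ (s t : ℝ) (hst : s ≤ t), Function.Injective
        ((persistentHomology n (lipConst (X := X) (Y := Y)) M).map (homOfLE hst)).hom) ∧
      (∀ t : ℝ, Function.Injective
        ((singularHomology n M).map
          (sublevelInclusion (lipConst (X := X) (Y := Y)) t)).hom)) ∧
    -- no bar has finite length
    (∀ (k : Type (max u v)) [Field k] (n : ℕ),
      NoFiniteBars (persistentHomology n (lipConst (X := X) (Y := Y)) (ModuleCat.of k k))) ∧
    -- the components of the mapping space, and the `L`-Lipschitz maps in them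
    (∀ (f : LipSpace X Y) (x : X),
      IsEilenbergMacLaneOne (pathComponent f) (imageCentralizer f x) ∧
      (Group.FG (FundamentalGroup X x) → connectedComponent f = pathComponent f) ∧
      ∀ L : ℝ, (lipComponent f L).Nonempty →
        IsEilenbergMacLaneOne (lipComponent f L) (imageCentralizer f x) ∧
        IsWeakHomotopyEquiv (lipComponentInclusion f L) ∧
        (Group.FG (FundamentalGroup X x) → IsHomotopyEquiv (lipComponentInclusion f L))) := by
  have hYB := hY.isLocallyBusemann
  refine ⟨fun R _ M n => ⟨persistentHomology_lipConst_map_injective hYB hX n M, fun t => ?_⟩,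
    fun k _ n => .of_injective (persistentHomology_lipConst_map_injective hYB hX n _),
    fun f x => ?_⟩
  · exact singularHomology_map_injective hYB hX n M
      (sublevelInclusion (lipConst (X := X) (Y := Y)) t) (j := id) continuous_id fun _ => rfl
  · exact ⟨isEilenbergMacLaneOne_pathComponent hYB hX f x,
      fun hfg => connectedComponent_eq_pathComponent hYB hX hfg f,
      fun L hne => ⟨isEilenbergMacLaneOne_lipComponent hYB hX f x hne,
        isWeakHomotopyEquiv_lipComponentInclusion hYB hX f x hne,
        fun hfg => isHomotopyEquiv_lipComponentInclusion hYB hX hfg f hne⟩⟩
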